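/- **Setting.** Let $k\ge 1$ and let $X\subset\mathbb C^n$ be a bounded domain with smooth boundary $M=\partial X$, outward unit normal $\nu$, complex structure $J$, surface measure $d\mu$ and second fundamental form $L(Y,W)=(\nabla_Y\nu,W)$. Let $\mathcal H=\{Y\in TM:(Y,J\nu)=0\}$, with $T^{1,0}M=\{Y-\sqrt{-1}JY:Y\in\mathcal H\}$. Use the unitary frame $Z_i=\sqrt2\,\partial/\partial z_i$ of $T^{1,0}\mathbb C^n$, write $u_i=Z_iu$, $u_{\bar j}=\overline{Z_j}u$, $D^{1,1}u=(u_{i\bar j})$ with $u_{i\bar j}=2\,\partial^2u/\partial z_i\partial\bar z_j$, and on $M$ let an index $n$ in $T_{n\bar i}$, $T_{j\bar n}$ stand for the direction $Z_n=\frac1{\sqrt2}(\nu-\sqrt{-1}J\nu)$. For $v\in C^\infty(\overline X)$, $L|_{\mathcal H}$ and $D^{1,1}v|_{\mathcal H}$ are the restrictions to $T^{1,0}M\times T^{0,1}M$, written as $(n-1)\times(n-1)$ matrices in a unitary frame of $T^{1,0}M$. Put $$\sigma_r(A_1,\dots,A_r)=\tfrac1{r!}\delta^{i_1\cdots i_r}_{j_1\cdots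 j_r}(A_1)_{i_1\bar j_1}\cdots(A_r)_{i_r\bar j_r},\qquad \sigma_r(A)=\sigma_r(A,\dots,A),$$ $$T_r(A_1,\dots,A_r)_{j\bar i}=\tfrac1{r!}\delta^{i i_1\cdots i_r}_{j j_1\cdots j_r}(A_1)_{i_1\bar j_1}\cdots(A_r)_{i_r\bar j_r}.$$ For $v^0,\dots,v^k\in C^\infty(\overline X)$ let $T^{a,b}=T_{k-1}$ of the $D^{1,1}v^c$, $c\ne a,b$, and define $$S_0=-\sum_{a\ne b}\int_X v^a_i v^b_{\bar j}\,T^{a,b}_{j\bar i}\,dx,\qquad S_1=-\frac1{2\sqrt2}\sum_{a\neq b}\oint_M\bigl(v^a_i v^b\,T^{a,b}_{n\bar i}+v^a v^b_{\bar j}\,T^{a,b}_{j\bar n}\bigr)d\mu,$$ and for $2\le i\le k+1$ $$S_i=(-1)^i\frac k2\sum_{a}\ \sum_{\substack{B\not\ni a\\|B|=i-1}}\oint_M v^a\prod_{b\in B}v^b_\nu\ \sigma_{k-1}\bigl(\underbrace{L|_{\mathcal H},\dots,L|_{\mathcal H}}_{i-2},(D^{1,1}v^c|_{\mathcal H})_{c\notin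 B\cup\{a\}}\bigr)d\mu .$$ Let $L_{k+1}=-\frac1{k^2(k+1)}\bigl(S_0-\sum_{i=1}^{k+1}S_i\bigr)$, $\mathcal E_{k+1}(u)=L_{k+1}(u,\dots,u)$ and $S_i(u)=S_i(u,\dots,u)$. **Proposition.** (1) For every $u\in C^\infty(\overline X)$, $\mathcal E_{k+1}(u)$ is real and $$\mathcal E_{k+1}(u)=-\int_Xu\,\sigma_k(D^{1,1}u)\,dx+\frac1{k^2(k+1)}\sum_{i=2}^{k+1}S_i(u),$$ $$S_i(u)=(-1)^i\frac{k(k+1)}2\binom k{i-1}\oint_Mu\,u_\nu^{i-1}\sigma_{k-1}\bigl(\underbrace{L|_{\mathcal H},\dots}_{i-2},\underbrace{D^{1,1}u|_{\mathcal H},\dots}_{k+1-i}\bigr)d\mu .$$ Along $M$, $D^{1,1}u|_{\mathcal H}=\overline D^{1,1}u+u_\nu L|_{\mathcal H}$, where $\overline D^{1,1}u$ is the restriction to $T^{1,0}M\times T^{0,1}M$ of the Hessian of $u|_M$ for the Levi-Civita connection of $M$. Consequently $\mathcal E_{k+1}(u)$ is given by the same formulas with $D^{1,1}u|_{\mathcal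 H}$ replaced by $\overline D^{1,1}u+u_\nu L|_{\mathcal H}$. (2) Let $u\in C^2(X)\cap C^2(M)\cap C^1(\overline X)$. For $2\le i\le k+1$ the boundary density $$s_i(u)=u\,u_\nu^{i-1}\sigma_{k-1}\bigl(\underbrace{L|_{\mathcal H},\dots}_{i-2},\underbrace{\overline D^{1,1}u+u_\nu L|_{\mathcal H},\dots}_{k+1-i}\bigr)$$ is real, independent of the unitary frame, and integrable on $M$. The interior density $u\,\sigma_k(D^{1,1}u)$ is continuous on $X$, and it is integrable on $X$ whenever the entries of $D^{1,1}u$ belong to $L^k(X)$ (in particular when they are bounded). So the formula in (1), with $\overline D^{1,1}u+u_\nu L|_{\mathcal H}$ in place of $D^{1,1}u|_{\mathcal H}$, defines a real number $\mathcal E_{k+1}(u)$ as soon as the interior integral converges absolutely. (3) The boundary densities involve only tangential derivatives of order at most two and $u_\nu$: if $u,v\in C^2(X)\cap C^2(M)\cap C^1(\overline X)$ and $p\in M$ satisfy $u(x)-v(x)=o(|x-p|^2)$ as $x\to p$ in $M$, and $u_\nu(p)=v_\nu(p)$, then $s_i(u)(p)=s_i(v)(p)$ for $2\le i\le k+1$.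 -/

import Mathlib

open MeasureTheory Set Topology Asymptotics
open scoped ContDiff Nat InnerProductSpace

noncomputable section

namespace ComplexHessian

/-! ### Multilinear algebra -/

section Algebra

variable {ι m : Type*} [Fintype ι] [DecidableEq ι] [Fintype m] [DecidableEq m]

/-- The generalized Kronecker delta `δ^I_J`: it is `±1` if `I` has distinct entries and `J` is an
even / odd rearrangement of `I`, and `0` otherwise. -/
def genDelta (I J : ι → m) : ℂ :=
  Matrix.det (Matrix.of fun a b : ι => if I a = J b then (1 : ℂ) else 0)

/-- The polarized elementary symmetric function
`σ_r(A_1, …, A_r) = (1 / r!) δ^{i_1 … i_r}_{j_1 … j_r} (A_1)_{i_1 j_1} ⋯ (A_r)_{i_r j_r}`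
of a family of `r = card ι` matrices; it is symmetric in the family. -/
def sigmaPol (A : ι → Matrix m m ℂ) : ℂ :=
  ((Fintype.card ι)! : ℂ)⁻¹ *
    ∑ I : ι → m, ∑ J : ι → m, genDelta I J * ∏ l, A l (I l) (J l)

/-- The elementary symmetric function `σ_k(A)`. -/
def sigma (k : ℕ) (A : Matrix m m ℂ) : ℂ := sigmaPol fun _ : Fin k => A

/-- The polarized Newton tensor `T_r(A_1, …, A_r)_{j ī}
= (1 / r!) δ^{i i_1 … i_r}_{j j_1 … j_r} (A_1)_{i_1 j_1} ⋯ (A_r)_{i_r j_r}`, `r = card ι`. -/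
def newtonPol (A : ι → Matrix m m ℂ) (j i : m) : ℂ :=
  ((Fintype.card ι)! : ℂ)⁻¹ *
    ∑ I : ι → m, ∑ J : ι → m,
      genDelta (fun o : Option ι => o.elim i I) (fun o : Option ι => o.elim j J) *
        ∏ l, A l (I l) (J l)

end Algebra

/-- `ℂⁿ` with its Euclidean structure; the complex structure `J` is multiplication by `I`. -/
abbrev Cn (n : ℕ) : Type := EuclideanSpace ℂ (Fin n)

variable {n : ℕ}

/-! ### Complexified derivatives

A real vector `a ∈ ℂⁿ` is identified with the `(1,0)`-vector `Z_a = (a - i J a) / √2`. This is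
`ℂ`-linear in `a` and takes unitary bases of `ℂⁿ` to unitary frames of `T^{1,0} ℂⁿ`. -/

/-- `ℓ(Z_a)`, for the complex linear extension of a real covector `ℓ`. -/
def dZ (l : Cn n →L[ℝ] ℝ) (a : Cn n) : ℂ :=
  ((l a : ℂ) - Complex.I * (l (Complex.I • a) : ℂ)) / (Real.sqrt 2 : ℂ)

/-- `ℓ(Z̄_a)`, for the complex linear extension of a real covector `ℓ`. -/
def dZbar (l : Cn n →L[ℝ] ℝ) (a : Cn n) : ℂ :=
  ((l a : ℂ) + Complex.I * (l (Complex.I • a) : ℂ)) / (Real.sqrt 2 : ℂ)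

/-- `B(Z_a, Z̄_b)`, for the complex bilinear extension of a real bilinear form `B`. -/
def part11 (B : Cn n → Cn n → ℝ) (a b : Cn n) : ℂ :=
  (((B a b + B (Complex.I • a) (Complex.I • b) : ℝ) : ℂ) +
    Complex.I * ((B a (Complex.I • b) - B (Complex.I • a) b : ℝ) : ℂ)) / 2

/-- The matrix `(B(Z_{e_a}, Z̄_{e_b}))_{a b}` of a real bilinear form in the frame `e`. -/
def formMatrix {m : Type*} (B : Cn n → Cn n → ℝ) (e : m → Cn n) : Matrix m m ℂ :=
  Matrix.of fun a b => part11 B (e a) (e b)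

/-- The standard unitary basis of `ℂⁿ`. -/
def stdFrame (n : ℕ) (i : Fin n) : Cn n := EuclideanSpace.single i (1 : ℂ)

/-- The differential of a function on `X̄`. -/
def diff (X : Set (Cn n)) (u : Cn n → ℝ) (x : Cn n) : Cn n →L[ℝ] ℝ :=
  fderivWithin ℝ u (closure X) x

/-- The real Hessian of a function on `X̄`. At points of the open set `X` it is the usual one. -/
def hess (X : Set (Cn n)) (u : Cn n → ℝ) (x a b : Cn n) : ℝ :=
  fderivWithin ℝ (diff X u) (closure X) x a b

/-- The complex Hessian `D^{1,1}u = (u_{i j̄})`, `u_{i j̄} = ∇²u(Z_i, Z̄_j)`, in the standard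
unitary frame `Z_i = (∂/∂x_i - √-1 ∂/∂y_i) / √2`; that is `u_{i j̄} = 2 ∂²u / ∂z_i ∂z̄_j`. -/
def cHess (X : Set (Cn n)) (u : Cn n → ℝ) (x : Cn n) : Matrix (Fin n) (Fin n) ℂ :=
  formMatrix (hess X u x) (stdFrame n)

/-! ### Smooth bounded domains and their boundaries -/

/-- `ρ` is a smooth defining function of `X` near the boundary point `p`. -/
structure IsDefiningAt (X : Set (Cn n)) (p : Cn n) (ρ : Cn n → ℝ) : Prop where
  contDiff : ContDiff ℝ ∞ ρ
  eq_zero : ρ p = 0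
  gradient_ne_zero : gradient ρ p ≠ 0
  mem_iff : ∀ᶠ x in 𝓝 p, x ∈ X ↔ ρ x < 0

/-- A bounded domain of `ℂⁿ` with smooth boundary. -/
structure IsSmoothBoundedDomain (X : Set (Cn n)) : Prop where
  isOpen : IsOpen X
  isConnected : IsConnected X
  isBounded : Bornology.IsBounded X
  smooth_boundary : ∀ p ∈ frontier X, ∃ ρ, IsDefiningAt X p ρ

open Classical in
/-- The outward unit normal `ν = ∇ρ / |∇ρ|` along `M = ∂X` (it does not depend on the local
defining function `ρ`); it is set to `0` off `M`. -/
def normal (X : Set (Cn n)) (p : Cn n) : Cn n :=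
  if h : p ∈ frontier X ∧ ∃ ρ, IsDefiningAt X p ρ then
    ‖gradient h.2.choose p‖⁻¹ • gradient h.2.choose p
  else 0

/-- The integral over `M = ∂X` against the `(2n-1)`-dimensional surface measure. -/
def bdryIntegral (X : Set (Cn n)) (f : Cn n → ℂ) : ℂ :=
  ∫ p in frontier X, f p ∂(μHE[2 * n - 1])

/-- The normal derivative `u_ν` along `M`. -/
def normalDeriv (X : Set (Cn n)) (u : Cn n → ℝ) (p : Cn n) : ℝ := diff X u p (normal X p)

/-- The second fundamental form `L(a, b) = (∇_a ν, b)` of `M`, for `a`, `b` tangent to `M`. -/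
def secondFF (X : Set (Cn n)) (p a b : Cn n) : ℝ :=
  ⟪fderivWithin ℝ (normal X) (frontier X) p a, b⟫_ℝ

/-- The gradient on `M` of a function on `M`: the component tangent to `M` of a derivative of
`f` along `M`. -/
def bdryGrad (X : Set (Cn n)) (f : Cn n → ℝ) (p : Cn n) : Cn n :=
  gradientWithin f (frontier X) p -
    ⟪normal X p, gradientWithin f (frontier X) p⟫_ℝ • normal X p

/-- The Hessian of a function `f` on `M` for the Levi-Civita connection `∇̄` of the induced
metric, for `a`, `b` tangent to `M`: it is `(∇̄_a grad f, b)`, and `∇̄_a` is the tangential part of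
the flat derivative. It depends only on the restriction of `f` to `M`. -/
def bdryHess (X : Set (Cn n)) (f : Cn n → ℝ) (p a b : Cn n) : ℝ :=
  ⟪fderivWithin ℝ (bdryGrad X f) (frontier X) p a, b⟫_ℝ

/-- The holomorphic tangent space `ℋ_p = {Y ∈ T_pM : (Y, Jν) = 0}`, the complex orthogonal
complement of `ν`; under `a ↦ Z_a` it corresponds to `T^{1,0}_p M`. -/
def holTangent (X : Set (Cn n)) (p : Cn n) : Submodule ℂ (Cn n) := (ℂ ∙ normal X p)ᗮ

/-- A unitary basis of `ℋ_p`, i.e. a unitary frame `Z_1, …, Z_{n-1}` of `T^{1,0}_p M`. -/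
def holFrame (X : Set (Cn n)) (p : Cn n) (a : Fin (Module.finrank ℂ (holTangent X p))) : Cn n :=
  (stdOrthonormalBasis ℂ (holTangent X p) a : Cn n)

/-! ### The symmetric form and the energy

`v 0, v 1, …, v k` are the arguments `u, w¹, …, wᵏ`. All sums below run over all ways of
distributing the `k + 1` arguments over the slots, so that each term is symmetric. -/

/-- `S_0 = - ∑_{a ≠ b} ∫_X vᵃ_i vᵇ_j̄ T_{k-1}(D^{1,1} of the other arguments)_{j ī} dx`. -/
def S0 (X : Set (Cn n)) (k : ℕ) (v : Fin (k + 1) → Cn n → ℝ) : ℂ :=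
  -∑ a, ∑ b ∈ Finset.univ.erase a, ∫ x in X, ∑ i, ∑ j,
    dZ (diff X (v a) x) (stdFrame n i) * dZbar (diff X (v b) x) (stdFrame n j) *
      newtonPol (fun c : {c // c ≠ a ∧ c ≠ b} => cHess X (v c) x) j i

/-- `S_1 = - (1 / (2√2)) ∑_{a ≠ b} ∮_M vᵃ_i vᵇ T_{n ī} + vᵃ vᵇ_j̄ T_{j n̄}`, where
`T = T_{k-1}(D^{1,1} of the other arguments)` and the index `n` stands for the direction
`Z_n = (ν - √-1 Jν) / √2 = ∑_j ν_j Z_j`, so that `T_{n ī} = ν_j T_{j ī}` and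
`T_{j n̄} = ν̄_i T_{j ī}`. -/
def S1 (X : Set (Cn n)) (k : ℕ) (v : Fin (k + 1) → Cn n → ℝ) : ℂ :=
  -(1 / (2 * (Real.sqrt 2 : ℂ))) * ∑ a, ∑ b ∈ Finset.univ.erase a, bdryIntegral X fun p =>
    (∑ i, dZ (diff X (v a) p) (stdFrame n i) * (v b p : ℂ) *
      ∑ j, normal X p j *
        newtonPol (fun c : {c // c ≠ a ∧ c ≠ b} => cHess X (v c) p) j i) +
    (∑ j, (v a p : ℂ) * dZbar (diff X (v b) p) (stdFrame n j) *
      ∑ i, (starRingEnd ℂ) (normal X p i) *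
        newtonPol (fun c : {c // c ≠ a ∧ c ≠ b} => cHess X (v c) p) j i)

/-- For `2 ≤ i ≤ k + 1`,
`S_i = (-1)^i (k / 2) ∑_{a, B} ∮_M vᵃ (∏_{b ∈ B} vᵇ_ν)
  σ_{k-1}(L|_ℋ, …, L|_ℋ (i - 2 times), D^{1,1}vᶜ|_ℋ for c ∉ B ∪ {a})`,
summed over an argument `a` and a set `B` of `i - 1` other arguments. (The first argument may be
`a`, or belong to `B`, or be one of the `c`: these are the three types of boundary terms.) -/
def S (X : Set (Cn n)) (k i : ℕ) (v : Fin (k + 1) → Cn n → ℝ) : ℂ :=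
  (-1) ^ i * ((k : ℂ) / 2) *
    ∑ a, ∑ B ∈ (Finset.univ.erase a).powersetCard (i - 1), bdryIntegral X fun p =>
      (v a p : ℂ) * (∏ b ∈ B, (normalDeriv X (v b) p : ℂ)) *
        sigmaPol (Sum.elim
          (fun _ : Fin (i - 2) => formMatrix (secondFF X p) (holFrame X p))
          (fun c : {c // c ∉ insert a B} => formMatrix (hess X (v c) p) (holFrame X p)))

/-- The symmetric form `L_{k+1} = - (S_0 - ∑_{i=1}^{k+1} S_i) / (k² (k + 1))`. -/
def Lform (X : Set (Cn n)) (k : ℕ) (v : Fin (k + 1) → Cn n → ℝ) : ℂ :=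
  -(1 / ((k : ℂ) ^ 2 * (k + 1))) *
    (S0 X k v - (S1 X k v + ∑ i ∈ Finset.Icc 2 (k + 1), S X k i v))

/-- The energy `E_{k+1}(u) = L_{k+1}(u, …, u)`. -/
def energy (X : Set (Cn n)) (k : ℕ) (u : Cn n → ℝ) : ℂ := Lform X k fun _ => u

/-! ### The energy on `C²(X) ∩ C²(M) ∩ C¹(X̄)` -/

/-- The class `C²(X) ∩ C²(M) ∩ C¹(X̄)`. -/
structure InClass (X : Set (Cn n)) (u : Cn n → ℝ) : Prop where
  interior : ContDiffOn ℝ 2 u X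
  boundary : ContDiffOn ℝ 2 u (frontier X)
  closure : ContDiffOn ℝ 1 u (closure X)

/-- The form `D̄²u + u_ν L` on the tangent spaces of `M`. It is made of the derivatives of order
at most two of `u|_M` along `M` and of the normal derivative `u_ν`. -/
def bdryForm (X : Set (Cn n)) (u : Cn n → ℝ) (p a b : Cn n) : ℝ :=
  bdryHess X u p a b + normalDeriv X u p * secondFF X p a b

/-- The boundary density `u u_ν^{i-1} σ_{k-1}(L|_ℋ, …, L|_ℋ, Φ|_ℋ, …, Φ|_ℋ)` at `p ∈ M`, with
`i - 2` entries `L|_ℋ` and `k + 1 - i` entries `Φ|_ℋ`, computed in the frame `e` of `ℋ_p`. -/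
def density {m : Type*} [Fintype m] [DecidableEq m] (X : Set (Cn n)) (k i : ℕ)
    (Φ : Cn n → Cn n → ℝ) (u : Cn n → ℝ) (p : Cn n) (e : m → Cn n) : ℂ :=
  (u p : ℂ) * (normalDeriv X u p : ℂ) ^ (i - 1) *
    sigmaPol (Sum.elim
      (fun _ : Fin (i - 2) => formMatrix (secondFF X p) e)
      (fun _ : Fin (k + 1 - i) => formMatrix Φ e))

/-- The coefficient `(-1)^i (k (k + 1) / 2) (k choose i - 1)`. -/
def coeff (k i : ℕ) : ℂ := (-1) ^ i * ((k : ℂ) * (k + 1) / 2) * (k.choose (i - 1) : ℂ)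

/-- The formula for `E_{k+1}(u)` in which only first and second derivatives of `u` in `X`,
derivatives of `u|_M` along `M` of order at most two, and `u_ν` occur. -/
def extEnergy (X : Set (Cn n)) (k : ℕ) (u : Cn n → ℝ) : ℂ :=
  -(∫ x in X, (u x : ℂ) * sigma k (cHess X u x)) +
    1 / ((k : ℂ) ^ 2 * (k + 1)) * ∑ i ∈ Finset.Icc 2 (k + 1),
      coeff k i * bdryIntegral X fun p => density X k i (bdryForm X u p) u p (holFrame X p)

end ComplexHessian

end

open ComplexHessian

/-!
The energy formula is an integration by parts, and everything else is a statement about forms on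
the boundary.

*The energy.* For equal arguments, `S_0` is a multiple of `∫ u_i u_j̄ T_{j ī}` and `S_1` a multiple
of the flux of `u u_i T_{j ī}`, where `T` is the Newton tensor of `D^{1,1}u`. Since third
derivatives are symmetric, `T` is divergence free (`sum_deriv_newtonPol_eq_zero`,
`dbarAt_fderiv_cHess_symm`), and `∑ u_{i j̄} T_{j ī} = k σ_k` (`sum_mul_newtonPol`), so that
`Z̄_j (u u_i T_{j ī}) = u_i u_j̄ T_{j ī} + k u σ_k`. The divergence theorem turns this into
`S_0 - S_1 = k² (k + 1) ∫ u σ_k` (`S0_sub_S1_const`); the two halves of the integrand of `S_1` are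
conjugate to each other, so only one of them has to be treated. In `S_i` with `i ≥ 2` all
`(k + 1) (k choose i - 1)` terms are equal (`S_const`).

*The divergence theorem* is proved for bounded open sets with `C¹` boundary and the Hausdorff
measure on the boundary (`setIntegral_deriv_eq_integral_frontier`). Near a boundary point with
normal `ν` and for a direction `e` with `⟪ν, e⟫ = 1`, the set lies below a graph in the oblique
coordinates `t e + y`, `y ⟂ ν`, which preserve volume. The fundamental theorem of calculus on the
lines in direction `e` gives the integral over the hyperplane `νᗮ`, and projection along `e` maps
the boundary to this hyperplane with bi-Lipschitz constants close to `1`, so it nearly preserves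
the surface measure. A partition of unity adds up these local identities, with an error
`ε ∮ |f|` for every `ε > 0`; so no area formula is needed.

*The boundary.* Differentiating the tangential gradient along the boundary gives
`∇²u = ∇̄²u + u_ν L` on tangent vectors (`IsSmoothBoundedDomain.hess_eq`). A function on the
boundary is extended by composition with a smooth retraction onto it
(`IsSmoothBoundedDomain.exists_retraction_extension`), which shows that its Hessian is symmetric,
continuous, and determined by the 2-jet. The densities do not depend on the unitary frame because
they can be written in terms of the matrix of the projection onto the holomorphic tangent space
(`sigmaPol_formMatrix`, `density_eq_projSigma`); since this matrix varies continuously, so do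
the densities, although no frame is assumed to do so. They are real because the forms are Hermitian.
-/

namespace ComplexHessian

/-! ### Multilinear algebra of the generalized Kronecker delta -/

section Algebra

set_option linter.unusedSectionVars false

variable {ι κ m m' : Type*} [Fintype ι] [DecidableEq ι] [Fintype κ] [DecidableEq κ]
  [Fintype m] [DecidableEq m] [Fintype m'] [DecidableEq m']

theorem genDelta_swap (I J : ι → m) : genDelta I J = genDelta J I := by
  unfold genDelta
  rw [← Matrix.det_transpose]
  congr 1
  ext a b
  simp [eq_comm]

theorem star_genDelta (I J : ι → m) : (starRingEnd ℂ) (genDelta I J) = genDelta I J := by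
  unfold genDelta
  rw [RingHom.map_det]
  congr 1
  ext a b
  simp only [RingHom.mapMatrix_apply, Matrix.map_apply, Matrix.of_apply]
  split_ifs <;> simp

theorem genDelta_reindex (e : κ ≃ ι) (I J : ι → m) :
    genDelta (I ∘ e) (J ∘ e) = genDelta I J := by
  unfold genDelta
  rw [← Matrix.det_submatrix_equiv_self e]
  rfl

/-- Transposing two of the lower indices changes the sign of the generalized Kronecker delta. -/
theorem genDelta_comp_swap {a b : ι} (hab : a ≠ b) (I J : ι → m) :
    genDelta I (J ∘ Equiv.swap a b) = -genDelta I J := by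
  unfold genDelta
  have h := Matrix.det_permute' (Equiv.swap a b)
    (Matrix.of fun a b : ι => if I a = J b then (1 : ℂ) else 0)
  rw [Equiv.Perm.sign_swap hab] at h
  simp only [Units.val_neg, Units.val_one, Int.cast_neg, Int.cast_one, neg_mul, one_mul] at h
  exact h

theorem sigmaPol_reindex (e : κ ≃ ι) (A : ι → Matrix m m ℂ) :
    sigmaPol (fun l => A (e l)) = sigmaPol A := by
  unfold sigmaPol
  rw [Fintype.card_congr e]
  congr 1
  refine Fintype.sum_equiv (e.arrowCongr (Equiv.refl m)) _ _ fun I => ?_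
  refine Fintype.sum_equiv (e.arrowCongr (Equiv.refl m)) _ _ fun J => ?_
  rw [← genDelta_reindex e, ← Equiv.prod_comp e]
  congr 1
  · congr 1 <;> ext x <;> simp [Equiv.arrowCongr]
  · simp [Equiv.arrowCongr]

theorem newtonPol_reindex (e : κ ≃ ι) (A : ι → Matrix m m ℂ) (j i : m) :
    newtonPol (fun l => A (e l)) j i = newtonPol A j i := by
  unfold newtonPol
  rw [Fintype.card_congr e]
  congr 1
  refine Fintype.sum_equiv (e.arrowCongr (Equiv.refl m)) _ _ fun I => ?_
  refine Fintype.sum_equiv (e.arrowCongr (Equiv.refl m)) _ _ fun J => ?_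
  rw [← genDelta_reindex e.optionCongr, ← Equiv.prod_comp e]
  congr 1
  · congr 1 <;> ext x <;> cases x <;> simp [Equiv.arrowCongr]
  · simp [Equiv.arrowCongr]

/-- Polarized symmetric functions of Hermitian matrices are real. -/
theorem sigmaPol_im_eq_zero {A : ι → Matrix m m ℂ}
    (hA : ∀ l a b, (starRingEnd ℂ) (A l a b) = A l b a) : (sigmaPol A).im = 0 := by
  rw [← Complex.conj_eq_iff_im]
  unfold sigmaPol
  rw [map_mul, map_sum, Finset.sum_comm]
  simp only [map_sum, map_mul, map_prod, star_genDelta, hA, map_inv₀, map_natCast]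
  congr 1
  refine Finset.sum_congr rfl fun I _ => Finset.sum_congr rfl fun J _ => ?_
  rw [genDelta_swap]

/-- The Cauchy–Binet formula, with the sum over increasing multi-indices replaced by the sum of
generalized Kronecker deltas over all of them. -/
theorem sum_genDelta_mul_prod (u : m → m' → ℂ) (v : m → m' → ℂ) (K L : ι → m') :
    ∑ I : ι → m, ∑ J : ι → m, genDelta I J * ((∏ l, u (I l) (K l)) * ∏ l, v (J l) (L l)) =
      Matrix.det (Matrix.of fun a b : ι => ∑ i, u i (K a) * v i (L b)) := by
  simp only [genDelta, Matrix.det_apply', Matrix.of_apply, Finset.sum_mul]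
  rw [Finset.sum_congr rfl fun I _ => Finset.sum_comm, Finset.sum_comm]
  refine Finset.sum_congr rfl fun π _ => ?_
  rw [← Equiv.sum_comp (π.symm.arrowCongr (Equiv.refl m)).symm]
  simp only [mul_assoc, ← Finset.mul_sum]
  congr 1
  rw [Finset.prod_univ_sum]
  simp only [Fintype.piFinset_univ]
  refine Finset.sum_congr rfl fun I _ => ?_
  rw [Finset.sum_eq_single I]
  · rw [← Equiv.prod_comp π (fun l => u _ (K l)), Finset.prod_mul_distrib]
    simp [Equiv.arrowCongr]
  · intro J _ hJ
    obtain ⟨l, hl⟩ := Function.ne_iff.1 hJ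
    rw [Finset.prod_eq_zero (Finset.mem_univ l), zero_mul]
    simp [Equiv.arrowCongr, Ne.symm hl]
  · simp

/-- The polarized symmetric function of the matrices `u A_l v` depends on `u`, `v` only through
the Gram-type products `∑ i, u i c * v i d`. For the components of forms in a unitary frame, these
are the entries of the orthogonal projection onto the span of the frame. -/
theorem sigmaPol_frame (u v : m → m' → ℂ) (A : ι → Matrix m' m' ℂ) :
    sigmaPol (fun l => Matrix.of fun a b => ∑ c, ∑ d, u a c * v b d * A l c d) =
      ((Fintype.card ι)! : ℂ)⁻¹ * ∑ K : ι → m', ∑ L : ι → m',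
        Matrix.det (Matrix.of fun a b : ι => ∑ i, u i (K a) * v i (L b)) *
          ∏ l, A l (K l) (L l) := by
  unfold sigmaPol
  congr 1
  simp only [← sum_genDelta_mul_prod, Matrix.of_apply, Finset.prod_univ_sum,
    Fintype.piFinset_univ, Finset.sum_mul, Finset.mul_sum]
  have h : ∀ I J : ι → m, ∑ K : ι → m', ∑ L : ι → m',
      genDelta I J * ∏ l, u (I l) (K l) * v (J l) (L l) * A l (K l) (L l) =
      ∑ K : ι → m', ∑ L : ι → m',
        genDelta I J * ((∏ l, u (I l) (K l)) * ∏ l, v (J l) (L l)) * ∏ l, A l (K l) (L l) := by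
    intro I J
    refine Finset.sum_congr rfl fun K _ => Finset.sum_congr rfl fun L _ => ?_
    simp only [Finset.prod_mul_distrib]
    ring
  simp only [h]
  calc _ = ∑ I : ι → m, ∑ K : ι → m', ∑ J : ι → m, ∑ L : ι → m', _ :=
        Finset.sum_congr rfl fun I _ => Finset.sum_comm
    _ = ∑ K : ι → m', ∑ I : ι → m, ∑ J : ι → m, ∑ L : ι → m', _ := Finset.sum_comm
    _ = ∑ K : ι → m', ∑ I : ι → m, ∑ L : ι → m', ∑ J : ι → m, _ :=
        Finset.sum_congr rfl fun K _ => Finset.sum_congr rfl fun I _ => Finset.sum_comm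
    _ = _ := Finset.sum_congr rfl fun K _ => Finset.sum_comm

/-- Contraction with the Newton tensor: `∑ A_{i j̄} T_{k-1}(A)_{j ī} = k σ_k(A)`. -/
theorem sum_mul_newtonPol (k : ℕ) (A : Matrix m m ℂ) :
    ∑ i, ∑ j, A i j * newtonPol (fun _ : Fin k => A) j i = (k + 1 : ℂ) * sigma (k + 1) A := by
  have h : sigma (k + 1) A = sigmaPol fun _ : Option (Fin k) => A := by
    unfold sigma
    exact sigmaPol_reindex (finSuccEquiv k) fun _ => A
  rw [h]
  unfold sigmaPol newtonPol
  simp only [Fintype.card_option, Fintype.card_fin, Nat.factorial_succ]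
  have hk : (k + 1 : ℂ) ≠ 0 := by exact_mod_cast Nat.succ_ne_zero k
  have hf : ((k ! : ℕ) : ℂ) ≠ 0 := by exact_mod_cast Nat.factorial_ne_zero k
  push_cast
  rw [mul_inv, ← mul_assoc, ← mul_assoc, mul_inv_cancel₀ hk, one_mul]
  have e1 : ∀ F : (Option (Fin k) → m) → ℂ,
      ∑ I, F I = ∑ i : m, ∑ I : Fin k → m, F fun o => o.elim i I := by
    intro F
    rw [← (Equiv.piOptionEquivProd (β := fun _ : Option (Fin k) => m)).symm.sum_comp,
      Fintype.sum_prod_type]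
    refine Finset.sum_congr rfl fun i _ => Finset.sum_congr rfl fun I _ => ?_
    congr 1
    ext o
    cases o <;> rfl
  rw [e1]
  simp only [e1, Fintype.prod_option, Option.elim_none, Option.elim_some, Finset.mul_sum]
  refine Finset.sum_congr rfl fun i _ => ?_
  rw [Finset.sum_comm]
  rw [Finset.sum_comm]
  calc _ = ∑ j : m, ∑ I : Fin k → m, ∑ J : Fin k → m, (((k ! : ℕ) : ℂ)⁻¹ *
          (genDelta (fun o : Option (Fin k) => o.elim i I) (fun o => o.elim j J) *
          (A i j * ∏ l, A (I l) (J l)))) := by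
        refine Finset.sum_congr rfl fun i _ => Finset.sum_congr rfl fun j _ =>
          Finset.sum_congr rfl fun J _ => ?_
        ring
    _ = _ := Finset.sum_comm

/-- The Newton tensor of a Hessian is divergence free. Here `A' j` stands for the derivative of
the matrix `A` in the direction `j̄`; the hypothesis is the symmetry of third derivatives. -/
theorem sum_deriv_newtonPol_eq_zero (A : Matrix m m ℂ) (A' : m → Matrix m m ℂ)
    (hA : ∀ j a b, A' j a b = A' b a j) (i : m) :
    ∑ j, ∑ I : ι → m, ∑ J : ι → m,
      genDelta (fun o : Option ι => o.elim i I) (fun o : Option ι => o.elim j J) *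
        ∑ l, (∏ l' ∈ Finset.univ.erase l, A (I l') (J l')) * A' j (I l) (J l) = 0 := by
  have e1 : ∀ F : (Option ι → m) → ℂ,
      ∑ J, F J = ∑ j : m, ∑ J : ι → m, F fun o => o.elim j J := by
    intro F
    rw [← (Equiv.piOptionEquivProd (β := fun _ : Option ι => m)).symm.sum_comp,
      Fintype.sum_prod_type]
    refine Finset.sum_congr rfl fun i _ => Finset.sum_congr rfl fun I _ => ?_
    congr 1
    ext o
    cases o <;> rfl
  rw [Finset.sum_comm]
  refine Finset.sum_eq_zero fun I _ => ?_
  simp only [Finset.mul_sum]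
  rw [Finset.sum_congr rfl fun j _ => Finset.sum_comm, Finset.sum_comm]
  refine Finset.sum_eq_zero fun l _ => ?_
  -- for fixed `I` and `l`, exchanging `j` and `J l` changes the sign of the delta only
  have h := e1 fun J => genDelta (fun o : Option ι => o.elim i I) J *
    ((∏ l' ∈ Finset.univ.erase l, A (I l') (J (some l'))) * A' (J none) (I l) (J (some l)))
  simp only [Option.elim_none, Option.elim_some] at h
  refine h.symm.trans ?_
  rw [← self_eq_neg, ← Finset.sum_neg_distrib]
  refine Fintype.sum_equiv ((Equiv.swap none (some l)).arrowCongr (Equiv.refl m)) _ _ fun J => ?_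
  have h1 : (Equiv.swap none (some l)).arrowCongr (Equiv.refl m) J
      = J ∘ Equiv.swap none (some l) := by
    ext o; simp [Equiv.arrowCongr]
  rw [h1, genDelta_comp_swap (by simp), hA]
  have h2 : ∏ l' ∈ Finset.univ.erase l, A (I l') ((J ∘ Equiv.swap none (some l)) (some l')) =
      ∏ l' ∈ Finset.univ.erase l, A (I l') (J (some l')) := by
    refine Finset.prod_congr rfl fun l' hl' => ?_
    rw [Function.comp_apply, Equiv.swap_apply_of_ne_of_ne (by simp)
      (by simpa using Finset.ne_of_mem_erase hl')]
  rw [h2]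
  simp

end Algebra

end ComplexHessian

/-! ### Comparison of integrals with respect to nearly equal measures -/

/-- If each of two measures is at most `c` times the other, their integrals differ by at most
`(c - 1)` times the `L¹` norm. -/
theorem MeasureTheory.abs_integral_sub_integral_le_of_le_smul {α : Type*} [MeasurableSpace α]
    {μ ν : Measure α} {c : NNReal} (hc : 1 ≤ c) (hμ : μ ≤ c • ν) (hν : ν ≤ c • μ) {f : α → ℝ}
    (hf : Integrable f ν) : |∫ x, f x ∂μ - ∫ x, f x ∂ν| ≤ (c - 1) * ∫ x, |f x| ∂ν := by
  have hfμ : Integrable f μ := (hf.smul_measure_nnreal (c := c)).mono_measure hμ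
  have hc' : (1 : ℝ) ≤ c := by exact_mod_cast hc
  have key : ∀ g : α → ℝ, (∀ x, 0 ≤ g x) → Integrable g ν → Integrable g μ →
      |∫ x, g x ∂μ - ∫ x, g x ∂ν| ≤ (c - 1) * ∫ x, g x ∂ν := by
    intro g hg hgν hgμ
    have h1 : ∫ x, g x ∂μ ≤ c * ∫ x, g x ∂ν := by
      have := integral_mono_measure hμ (.of_forall hg) hgν.smul_measure_nnreal
      rwa [integral_smul_nnreal_measure] at this
    have h2 : ∫ x, g x ∂ν ≤ c * ∫ x, g x ∂μ := by
      have := integral_mono_measure hν (.of_forall hg) hgμ.smul_measure_nnreal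
      rwa [integral_smul_nnreal_measure] at this
    have h3 : 0 ≤ ∫ x, g x ∂ν := integral_nonneg hg
    have h4 : 0 ≤ ∫ x, g x ∂μ := integral_nonneg hg
    rw [abs_le]
    constructor
    · nlinarith
    · linarith
  have hp := key (fun x => max (f x) 0) (fun x => le_max_right _ _) hf.pos_part hfμ.pos_part
  have hn := key (fun x => max (-f x) 0) (fun x => le_max_right _ _) hf.neg_part hfμ.neg_part
  have e1 : ∀ x, f x = max (f x) 0 - max (-f x) 0 := fun x => by
    rcases le_total (f x) 0 with h | h <;> simp [h]
  have e2 : ∀ x, |f x| = max (f x) 0 + max (-f x) 0 := fun x => by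
    rcases le_total (f x) 0 with h | h <;> simp [h, abs_of_nonneg, abs_of_nonpos]
  have i1 : ∫ x, f x ∂μ = ∫ x, max (f x) 0 ∂μ - ∫ x, max (-f x) 0 ∂μ := by
    rw [← integral_sub hfμ.pos_part hfμ.neg_part]; exact integral_congr_ae (.of_forall e1)
  have i2 : ∫ x, f x ∂ν = ∫ x, max (f x) 0 ∂ν - ∫ x, max (-f x) 0 ∂ν := by
    rw [← integral_sub hf.pos_part hf.neg_part]; exact integral_congr_ae (.of_forall e1)
  have i3 : ∫ x, |f x| ∂ν = ∫ x, max (f x) 0 ∂ν + ∫ x, max (-f x) 0 ∂ν := by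
    rw [← integral_add hf.pos_part hf.neg_part]; exact integral_congr_ae (.of_forall e2)
  rw [i1, i2, i3]
  rw [abs_le] at *
  constructor <;> linarith [hp.1, hp.2, hn.1, hn.2]

theorem LipschitzOnWith.euclideanHausdorffMeasure_image_le {Y Z : Type*} [MetricSpace Y]
    [MetricSpace Z] [MeasurableSpace Y] [BorelSpace Y] [MeasurableSpace Z] [BorelSpace Z]
    {K : NNReal} {f : Y → Z} {s : Set Y} (h : LipschitzOnWith K f s) (d : ℕ) :
    μHE[d] (f '' s) ≤ (K : ENNReal) ^ d * μHE[d] s := by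
  simp only [Measure.euclideanHausdorffMeasure_def, Measure.smul_apply, ENNReal.smul_def,
    smul_eq_mul]
  have := h.hausdorffMeasure_image_le (d := d) (by positivity)
  rw [ENNReal.rpow_natCast] at this
  calc _ ≤ _ * ((K : ENNReal) ^ d * _) := by gcongr
    _ = _ := mul_left_comm _ _ _

/-! ### Oblique coordinates along a hyperplane -/

section Oblique

variable {E : Type*} [NormedAddCommGroup E] [InnerProductSpace ℝ E]

/-- The oblique projection onto `νᗮ` along `e`, for `⟪ν, e⟫ = 1`. -/
noncomputable def obliqueProj (ν e : E) (he : ⟪ν, e⟫_ℝ = 1) : E →L[ℝ] (ℝ ∙ ν)ᗮ :=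
  (ContinuousLinearMap.id ℝ E - (innerSL ℝ ν).smulRight e).codRestrict (ℝ ∙ ν)ᗮ fun x => by
    rw [Submodule.mem_orthogonal_singleton_iff_inner_right]
    simp [inner_sub_right, inner_smul_right, he]

theorem coe_obliqueProj (ν e : E) (he : ⟪ν, e⟫_ℝ = 1) (x : E) :
    (obliqueProj ν e he x : E) = x - ⟪ν, x⟫_ℝ • e := by
  simp [obliqueProj]

theorem inner_orthogonal_singleton (ν : E) (y : (ℝ ∙ ν)ᗮ) : ⟪ν, (y : E)⟫_ℝ = 0 :=
  Submodule.mem_orthogonal_singleton_iff_inner_right.1 y.2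

/-- Oblique coordinates `(t, y) ↦ t e + y`, `y ⟂ ν`, for `⟪ν, e⟫ = 1`. -/
noncomputable def obliqueCoord (ν e : E) (he : ⟪ν, e⟫_ℝ = 1) : (ℝ × (ℝ ∙ ν)ᗮ) ≃L[ℝ] E :=
  ContinuousLinearEquiv.equivOfInverse
    ((ContinuousLinearMap.fst ℝ ℝ (ℝ ∙ ν)ᗮ).smulRight e +
      (ℝ ∙ ν)ᗮ.subtypeL ∘L ContinuousLinearMap.snd ℝ ℝ (ℝ ∙ ν)ᗮ)
    ((innerSL ℝ ν).prod (obliqueProj ν e he))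
    (fun z => by
      ext
      · simp [inner_add_right, inner_smul_right, he, inner_orthogonal_singleton]
      · simp [coe_obliqueProj, inner_add_right, inner_smul_right, he, inner_orthogonal_singleton])
    (fun x => by simp [coe_obliqueProj])

theorem obliqueCoord_apply (ν e : E) (he : ⟪ν, e⟫_ℝ = 1) (z : ℝ × (ℝ ∙ ν)ᗮ) :
    obliqueCoord ν e he z = z.1 • e + (z.2 : E) := rfl

/-- Oblique coordinates preserve volume: they differ from orthonormal ones by a shear. -/
theorem measurePreserving_obliqueCoord [FiniteDimensional ℝ E] [MeasurableSpace E] [BorelSpace E]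
    {ν : E} (hν : ‖ν‖ = 1) (e : E) (he : ⟪ν, e⟫_ℝ = 1) :
    MeasurePreserving (obliqueCoord ν e he) (volume.prod volume) volume := by
  have h1 : MeasurePreserving (fun p : (ℝ ∙ ν) × (ℝ ∙ ν)ᗮ => (p.1 : E) + p.2)
      (volume.prod volume) volume := by
    have h := ((ℝ ∙ ν).measurePreserving_measurableEquivProd (0 : E)).symm
    rw [InnerProductSpace.euclideanHausdorffMeasure_eq_volume] at h
    have hh : (fun p : (ℝ ∙ ν) × (ℝ ∙ ν)ᗮ => (p.1 : E) + p.2) =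
        ((ℝ ∙ ν).measurableEquivProd (0 : E)).symm := by
      ext p
      simp
    rw [hh]
    exact h
  have hs : (ν : E) + ((obliqueProj ν ν (by simp [hν]) e : (ℝ ∙ ν)ᗮ) : E) = e := by
    simp [coe_obliqueProj, he]
  set w : (ℝ ∙ ν)ᗮ := obliqueProj ν ν (by simp [hν]) e
  have h2 : MeasurePreserving (fun p : ℝ × (ℝ ∙ ν)ᗮ =>
      (LinearIsometryEquiv.toSpanUnitSingleton (𝕜 := ℝ) ν hν p.1, p.1 • w + p.2))
      (volume.prod volume) (volume.prod volume) := by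
    refine MeasurePreserving.skew_product (g := fun t y => t • w + y)
      (LinearIsometryEquiv.toSpanUnitSingleton (𝕜 := ℝ) ν hν).measurePreserving ?_ ?_
    · fun_prop
    · exact .of_forall fun t => (measurePreserving_add_left volume (t • w)).map_eq
  convert h1.comp h2 using 1
  ext p
  rw [obliqueCoord_apply]
  simp only [Function.comp_apply, LinearIsometryEquiv.toSpanUnitSingleton_apply]
  conv_lhs => rw [← hs]
  simp [smul_add, add_assoc]

end Oblique

/-! ### Boundaries as Lipschitz graphs -/

section LocalGraph

variable {E : Type*} [NormedAddCommGroup E] [InnerProductSpace ℝ E]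

/-- Near `q`, the open set `X` is the region below the graph of `h` in the oblique coordinates
`(t, y) ↦ q + t e + y`, over the ball of radius `b` in `νᗮ`, and the graph is nearly orthogonal
to `ν`, the deviation being measured by `η`. -/
structure IsSubgraphAt (X : Set E) (q ν e : E) (b η : ℝ) (h : (ℝ ∙ ν)ᗮ → ℝ) : Prop where
  pos : 0 < b
  mem_Ioo : ∀ y ∈ Metric.ball (0 : (ℝ ∙ ν)ᗮ) b, h y ∈ Ioo (-b) b
  mem_iff : ∀ y ∈ Metric.ball (0 : (ℝ ∙ ν)ᗮ) b, ∀ t ∈ Icc (-b) b,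
    q + (t • e + (y : E)) ∈ X ↔ t < h y
  mem_closure_iff : ∀ y ∈ Metric.ball (0 : (ℝ ∙ ν)ᗮ) b, ∀ t ∈ Icc (-b) b,
    q + (t • e + (y : E)) ∈ closure X ↔ t ≤ h y
  mem_frontier_iff : ∀ y ∈ Metric.ball (0 : (ℝ ∙ ν)ᗮ) b, ∀ t ∈ Icc (-b) b,
    q + (t • e + (y : E)) ∈ frontier X ↔ t = h y
  lip : ∀ y ∈ Metric.ball (0 : (ℝ ∙ ν)ᗮ) b, ∀ y' ∈ Metric.ball (0 : (ℝ ∙ ν)ᗮ) b,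
    |h y - h y'| ≤ η * ‖(h y - h y') • e + ((y : E) - y')‖

/-- Near a zero of a function `ρ` strictly differentiable with derivative `c ν`, the set
`{ρ < 0}` is a subgraph in any direction `e` with `⟪ν, e⟫ = 1`, and the slope of the graph
relative to `νᗮ` can be made as small as desired. -/
theorem exists_isSubgraphAt {X : Set E} {q ν e : E} {ρ : E → ℝ} {c : ℝ} (hc : 0 < c)
    (he : ⟪ν, e⟫_ℝ = 1) (hρ : HasStrictFDerivAt ρ (c • innerSL ℝ ν) q) (hq : ρ q = 0)
    (hX : ∀ᶠ x in 𝓝 q, x ∈ X ↔ ρ x < 0) (hXc : ∀ᶠ x in 𝓝 q, x ∈ closure X ↔ ρ x ≤ 0)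
    (hXf : ∀ᶠ x in 𝓝 q, x ∈ frontier X ↔ ρ x = 0) (hcont : Continuous ρ) {η : ℝ} (hη : 0 < η)
    (hηe : η * (‖e‖ + 1) < 1) : ∃ b h, IsSubgraphAt X q ν e b η h := by
  have hs : ∀ᶠ p : E × E in 𝓝 (q, q),
      ‖ρ p.1 - ρ p.2 - (c • innerSL ℝ ν) (p.1 - p.2)‖ ≤ c * η * ‖p.1 - p.2‖ :=
    hρ.isLittleO.def (by positivity)
  rw [nhds_prod_eq] at hs
  obtain ⟨s, hs, hs'⟩ := (Filter.eventually_prod_self_iff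
    (r := fun x x' => ‖ρ x - ρ x' - (c • innerSL ℝ ν) (x - x')‖ ≤ c * η * ‖x - x'‖)).1 hs
  obtain ⟨δ, hδ, hball⟩ := Metric.mem_nhds_iff.1
    (Filter.inter_mem hs (Filter.inter_mem hX (Filter.inter_mem hXc hXf)))
  have hest : ∀ x ∈ Metric.ball q δ, ∀ x' ∈ Metric.ball q δ,
      |ρ x - ρ x' - c * ⟪ν, x - x'⟫_ℝ| ≤ c * η * ‖x - x'‖ := fun x hx x' hx' => by
    simpa using hs' x (hball hx).1 x' (hball hx').1
  set b : ℝ := δ / (2 * (‖e‖ + 1)) with hb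
  have hb0 : 0 < b := by positivity
  have hbδ : b * (‖e‖ + 1) < δ := by
    rw [hb]; field_simp; linarith
  have hmem : ∀ y ∈ Metric.ball (0 : (ℝ ∙ ν)ᗮ) b, ∀ t ∈ Icc (-b) b,
      q + (t • e + (y : E)) ∈ Metric.ball q δ := by
    intro y hy t ht
    have hy' : ‖(y : E)‖ < b := by simpa using hy
    rw [mem_ball_iff_norm, add_sub_cancel_left]
    calc ‖t • e + (y : E)‖ ≤ |t| * ‖e‖ + ‖(y : E)‖ := by
          simpa [norm_smul] using norm_add_le (t • e) (y : E)
      _ ≤ b * ‖e‖ + b := by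
          gcongr
          exact abs_le.2 ht
      _ < δ := by linarith
  have hin : ∀ (y y' : (ℝ ∙ ν)ᗮ) (t t' : ℝ),
      ⟪ν, q + (t • e + (y : E)) - (q + (t' • e + (y' : E)))⟫_ℝ = t - t' := by
    intro y y' t t'
    simp [inner_sub_right, inner_add_right, inner_smul_right, he, inner_orthogonal_singleton]
  -- `ρ` increases along the lines in direction `e`, and changes sign on each of them
  have hmono : ∀ y ∈ Metric.ball (0 : (ℝ ∙ ν)ᗮ) b,
      StrictMonoOn (fun t : ℝ => ρ (q + (t • e + (y : E)))) (Icc (-b) b) := by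
    intro y hy t ht t' ht' htt
    have h := hest _ (hmem y hy t' ht') _ (hmem y hy t ht)
    rw [hin] at h
    have h2 : q + (t' • e + (y : E)) - (q + (t • e + (y : E))) = (t' - t) • e := by module
    rw [h2, norm_smul, Real.norm_of_nonneg (by linarith)] at h
    have h3 := (abs_le.1 h).1
    have h4 : c * (t' - t) * (η * ‖e‖) < c * (t' - t) * 1 := by
      have : 0 < c * (t' - t) := mul_pos hc (by linarith)
      gcongr
      linarith
    simp only
    linarith
  have hends : ∀ y ∈ Metric.ball (0 : (ℝ ∙ ν)ᗮ) b, ∀ t, |t| = b →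
      |ρ (q + (t • e + (y : E))) - c * t| < c * b := by
    intro y hy t ht
    have hq0 : q ∈ Metric.ball q δ := Metric.mem_ball_self hδ
    have h := hest _ (hmem y hy t (abs_le.1 ht.le)) _ hq0
    have h1 := hin y 0 t 0
    simp only [zero_smul, Submodule.coe_zero, add_zero, sub_zero] at h1
    rw [h1, hq, sub_zero, add_sub_cancel_left] at h
    have hy' : ‖(y : E)‖ < b := by simpa using hy
    refine h.trans_lt ?_
    have h5 : ‖t • e + (y : E)‖ ≤ b * (‖e‖ + 1) := by
      calc ‖t • e + (y : E)‖ ≤ |t| * ‖e‖ + ‖(y : E)‖ := by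
            simpa [norm_smul] using norm_add_le (t • e) (y : E)
        _ ≤ _ := by rw [ht]; linarith
    calc c * η * ‖t • e + (y : E)‖ ≤ c * η * (b * (‖e‖ + 1)) := by gcongr
      _ = c * b * (η * (‖e‖ + 1)) := by ring
      _ < c * b * 1 := by gcongr
      _ = c * b := mul_one _
  have hex : ∀ y ∈ Metric.ball (0 : (ℝ ∙ ν)ᗮ) b, ∃ t ∈ Ioo (-b) b,
      ρ (q + (t • e + (y : E))) = 0 := by
    intro y hy
    have h1 := (abs_lt.1 (hends y hy b (abs_of_pos hb0))).1
    have h2 := (abs_lt.1 (hends y hy (-b) (by rw [abs_neg, abs_of_pos hb0]))).2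
    have hc' : ContinuousOn (fun t : ℝ => ρ (q + (t • e + (y : E)))) (Icc (-b) b) :=
      (hcont.comp (by fun_prop)).continuousOn
    exact intermediate_value_Ioo (by linarith) hc' ⟨by linarith, by linarith⟩
  choose! h hh hh0 using hex
  have hcmp : ∀ y ∈ Metric.ball (0 : (ℝ ∙ ν)ᗮ) b, ∀ t ∈ Icc (-b) b,
      (ρ (q + (t • e + (y : E))) < 0 ↔ t < h y) ∧ (ρ (q + (t • e + (y : E))) ≤ 0 ↔ t ≤ h y) := by
    intro y hy t ht
    rw [← hh0 y hy]
    exact ⟨(hmono y hy).lt_iff_lt ht (Ioo_subset_Icc_self (hh y hy)),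
      (hmono y hy).le_iff_le ht (Ioo_subset_Icc_self (hh y hy))⟩
  refine ⟨b, h, hb0, hh, fun y hy t ht => ?_, fun y hy t ht => ?_, fun y hy t ht => ?_,
    fun y hy y' hy' => ?_⟩
  · exact (hball (hmem y hy t ht)).2.1.trans (hcmp y hy t ht).1
  · exact (hball (hmem y hy t ht)).2.2.1.trans (hcmp y hy t ht).2
  · refine (hball (hmem y hy t ht)).2.2.2.trans ?_
    rw [eq_iff_le_not_lt, eq_iff_le_not_lt, (hcmp y hy t ht).1, (hcmp y hy t ht).2]
  · have h1 := hest _ (hmem y hy (h y) (Ioo_subset_Icc_self (hh y hy))) _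
      (hmem y' hy' (h y') (Ioo_subset_Icc_self (hh y' hy')))
    rw [hh0 y hy, hh0 y' hy', hin, sub_zero, zero_sub, abs_neg, abs_mul, abs_of_pos hc,
      mul_assoc] at h1
    have h2 := le_of_mul_le_mul_left h1 hc
    have h3 : q + (h y • e + (y : E)) - (q + (h y' • e + (y' : E))) =
        (h y - h y') • e + ((y : E) - y') := by module
    rwa [h3] at h2

namespace IsSubgraphAt

variable {X : Set E} {q ν e : E} {b η : ℝ} {h : (ℝ ∙ ν)ᗮ → ℝ}

/-- The parametrization of the boundary as a graph. -/
def graphMap (q e : E) {ν : E} (h : (ℝ ∙ ν)ᗮ → ℝ) (y : (ℝ ∙ ν)ᗮ) : E := q + (h y • e + (y : E))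

/-- The box `|t| < b`, `‖y‖ < b` in oblique coordinates at `q`. -/
def box (q ν e : E) (he : ⟪ν, e⟫_ℝ = 1) (b : ℝ) : Set E :=
  {x | ⟪ν, x - q⟫_ℝ ∈ Ioo (-b) b ∧ obliqueProj ν e he (x - q) ∈ Metric.ball 0 b}

theorem isOpen_box (he : ⟪ν, e⟫_ℝ = 1) : IsOpen (box q ν e he b) := by
  refine IsOpen.inter ?_ ?_
  · exact isOpen_Ioo.preimage (f := fun x => ⟪ν, x - q⟫_ℝ) (by fun_prop)
  · exact Metric.isOpen_ball.preimage (f := fun x => obliqueProj ν e he (x - q)) (by fun_prop)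

theorem eq_add_obliqueProj (he : ⟪ν, e⟫_ℝ = 1) (q x : E) :
    q + (⟪ν, x - q⟫_ℝ • e + (obliqueProj ν e he (x - q) : E)) = x := by
  rw [coe_obliqueProj]
  module

theorem obliqueProj_smul_add (he : ⟪ν, e⟫_ℝ = 1) (t : ℝ) (y : (ℝ ∙ ν)ᗮ) :
    obliqueProj ν e he (t • e + (y : E)) = y := by
  ext
  simp [coe_obliqueProj, he, inner_orthogonal_singleton]

theorem inner_smul_add (he : ⟪ν, e⟫_ℝ = 1) (t : ℝ) (y : (ℝ ∙ ν)ᗮ) :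
    ⟪ν, t • e + (y : E)⟫_ℝ = t := by
  simp [inner_add_right, inner_smul_right, he, inner_orthogonal_singleton]

theorem ball_subset_box (hν : ‖ν‖ = 1) (he : ⟪ν, e⟫_ℝ = 1) {r : ℝ} (hr : r * (‖e‖ + 1) ≤ b) :
    Metric.ball q r ⊆ box q ν e he b := by
  intro x hx
  rw [mem_ball_iff_norm] at hx
  have hr0 : 0 < r := (norm_nonneg _).trans_lt hx
  have hin : |⟪ν, x - q⟫_ℝ| ≤ ‖x - q‖ := by simpa [hν] using abs_real_inner_le_norm ν (x - q)
  constructor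
  · rw [Set.mem_Ioo, ← abs_lt]
    nlinarith [norm_nonneg e]
  · rw [mem_ball_zero_iff, Submodule.coe_norm, coe_obliqueProj]
    calc _ ≤ ‖x - q‖ + |⟪ν, x - q⟫_ℝ| * ‖e‖ := by
          simpa [norm_smul] using norm_sub_le (x - q) (⟪ν, x - q⟫_ℝ • e)
      _ ≤ ‖x - q‖ + ‖x - q‖ * ‖e‖ := by gcongr
      _ = ‖x - q‖ * (‖e‖ + 1) := by ring
      _ < r * (‖e‖ + 1) := by gcongr
      _ ≤ b := hr

theorem image_graphMap (H : IsSubgraphAt X q ν e b η h) (he : ⟪ν, e⟫_ℝ = 1) :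
    graphMap q e h '' Metric.ball 0 b = frontier X ∩ box q ν e he b := by
  ext x
  constructor
  · rintro ⟨y, hy, rfl⟩
    refine ⟨(H.mem_frontier_iff y hy _ (Ioo_subset_Icc_self (H.mem_Ioo y hy))).2 rfl, ?_, ?_⟩
    · rw [graphMap, add_sub_cancel_left, inner_smul_add he]
      exact H.mem_Ioo y hy
    · rwa [graphMap, add_sub_cancel_left, obliqueProj_smul_add he]
  · rintro ⟨hx, ht, hy⟩
    refine ⟨_, hy, ?_⟩
    have := (H.mem_frontier_iff _ hy _ (Ioo_subset_Icc_self ht)).1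
      (by rwa [eq_add_obliqueProj])
    rw [graphMap, ← this, eq_add_obliqueProj]

theorem lipschitzOnWith_graphMap (H : IsSubgraphAt X q ν e b η h) {K : NNReal}
    (hK : 1 ≤ K * (1 - η * ‖e‖)) :
    LipschitzOnWith K (graphMap q e h) (Metric.ball 0 b) := by
  refine LipschitzOnWith.of_dist_le_mul fun y hy y' hy' => ?_
  have h1 := H.lip y hy y' hy'
  have e1 : graphMap q e h y - graphMap q e h y' = (h y - h y') • e + ((y : E) - y') := by
    unfold graphMap; module
  rw [dist_eq_norm, dist_eq_norm, e1, Submodule.coe_norm, Submodule.coe_sub]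
  set w := (h y - h y') • e + ((y : E) - y')
  have h2 : ‖(y : E) - y'‖ ≥ ‖w‖ - |h y - h y'| * ‖e‖ := by
    have e2 : w = (h y - h y') • e + ((y : E) - y') := rfl
    have := norm_add_le ((h y - h y') • e) ((y : E) - y')
    rw [← e2, norm_smul, Real.norm_eq_abs] at this
    linarith
  have h3 : |h y - h y'| * ‖e‖ ≤ η * ‖w‖ * ‖e‖ := by gcongr
  calc ‖w‖ ≤ K * (1 - η * ‖e‖) * ‖w‖ := by nlinarith [norm_nonneg w]
    _ = K * (‖w‖ - η * ‖w‖ * ‖e‖) := by ring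
    _ ≤ K * ‖(y : E) - y'‖ := by gcongr; linarith

theorem lipschitzOnWith_obliqueProj (H : IsSubgraphAt X q ν e b η h) (he : ⟪ν, e⟫_ℝ = 1)
    {K : NNReal} (hK : 1 + η * ‖e‖ ≤ K) :
    LipschitzOnWith K (fun x => obliqueProj ν e he (x - q))
      (graphMap q e h '' Metric.ball 0 b) := by
  refine LipschitzOnWith.of_dist_le_mul ?_
  rintro _ ⟨y, hy, rfl⟩ _ ⟨y', hy', rfl⟩
  have h1 := H.lip y hy y' hy'
  have e1 : graphMap q e h y - graphMap q e h y' = (h y - h y') • e + ((y : E) - y') := by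
    unfold graphMap; module
  rw [dist_eq_norm, dist_eq_norm, e1]
  simp only [graphMap, add_sub_cancel_left, obliqueProj_smul_add he]
  rw [Submodule.coe_norm, Submodule.coe_sub]
  set w := (h y - h y') • e + ((y : E) - y')
  have e2 : (y : E) - y' = w - (h y - h y') • e := by simp [w]
  have h3 : |h y - h y'| * ‖e‖ ≤ η * ‖w‖ * ‖e‖ := by gcongr
  calc ‖(y : E) - y'‖ ≤ ‖w‖ + |h y - h y'| * ‖e‖ := by
        rw [e2]; simpa [norm_smul] using norm_sub_le w ((h y - h y') • e)
    _ ≤ (1 + η * ‖e‖) * ‖w‖ := by linarith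
    _ ≤ K * ‖w‖ := by gcongr

end IsSubgraphAt

end LocalGraph

/-! ### The divergence theorem near a boundary point -/

section LocalDivergence

variable {E : Type*} [NormedAddCommGroup E] [InnerProductSpace ℝ E]

/-- `f` is continuously differentiable up to the boundary of the open set `X`, with
derivative `f'`. -/
structure IsC1UpToBoundary (X : Set E) (f : E → ℝ) (f' : E → E →L[ℝ] ℝ) : Prop where
  continuousOn : ContinuousOn f (closure X)
  hasFDerivAt : ∀ x ∈ X, HasFDerivAt f (f' x) x
  continuousOn_deriv : ContinuousOn f' (closure X)

/-- The function `f` and its derivative `f'` vanish on `closure X` outside `s`. -/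
def VanishesOutside (X : Set E) (f : E → ℝ) (f' : E → E →L[ℝ] ℝ) (s : Set E) : Prop :=
  ∀ x ∈ closure X, x ∉ s → f x = 0 ∧ f' x = 0

variable {X : Set E} {q ν e : E} {b η : ℝ} {h : (ℝ ∙ ν)ᗮ → ℝ}

namespace IsSubgraphAt

/-- The fundamental theorem of calculus along a line in the direction `e`. -/
theorem integral_line (H : IsSubgraphAt X q ν e b η h) (he : ⟪ν, e⟫_ℝ = 1)
    {f : E → ℝ} {f' : E → E →L[ℝ] ℝ} (hf : IsC1UpToBoundary X f f')
    (h0 : VanishesOutside X f f' (box q ν e he b)) (y : (ℝ ∙ ν)ᗮ) :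
    ∫ t : ℝ, X.indicator (fun x => f' x e) (q + (t • e + (y : E))) =
      (Metric.ball 0 b).indicator (fun y => f (graphMap q e h y)) y := by
  by_cases hy : y ∈ Metric.ball (0 : (ℝ ∙ ν)ᗮ) b
  · rw [indicator_of_mem hy]
    have hh := H.mem_Ioo y hy
    have hsub : ∀ t ∈ Icc (-b) (h y), t ∈ Icc (-b) b := fun t ht => ⟨ht.1, ht.2.trans hh.2.le⟩
    have hbox : ∀ t, q + (t • e + (y : E)) ∈ box q ν e he b ↔ t ∈ Ioo (-b) b := by
      intro t
      rw [box, mem_ofPred_eq, add_sub_cancel_left, inner_smul_add he, obliqueProj_smul_add he,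
        and_iff_left hy]
    have e1 : (fun t : ℝ => X.indicator (fun x => f' x e) (q + (t • e + (y : E)))) =
        (Ioo (-b) (h y)).indicator fun t => f' (q + (t • e + (y : E))) e := by
      ext t
      by_cases ht : t ∈ Ioo (-b) b
      · have := H.mem_iff y hy t (Ioo_subset_Icc_self ht)
        by_cases hth : t < h y
        · rw [indicator_of_mem (this.2 hth),
            indicator_of_mem (s := Ioo (-b) (h y)) ⟨ht.1, hth⟩]
        · rw [indicator_of_notMem (fun hx => hth (this.1 hx)),
            indicator_of_notMem (fun hx => hth hx.2)]
      · rw [indicator_of_notMem (s := Ioo (-b) (h y))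
          (fun hx => ht ⟨hx.1, hx.2.trans hh.2⟩)]
        by_cases hx : q + (t • e + (y : E)) ∈ X
        · rw [indicator_of_mem hx, (h0 _ (subset_closure hx) (fun hb => ht ((hbox t).1 hb))).2]
          rfl
        · rw [indicator_of_notMem hx]
    rw [e1, integral_indicator measurableSet_Ioo, ← integral_Ioc_eq_integral_Ioo,
      ← intervalIntegral.integral_of_le hh.1.le]
    have hcl : ∀ t ∈ Icc (-b) (h y), q + (t • e + (y : E)) ∈ closure X := fun t ht =>
      (H.mem_closure_iff y hy t (hsub t ht)).2 ht.2
    have hline : Continuous fun t : ℝ => q + (t • e + (y : E)) := by fun_prop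
    rw [intervalIntegral.integral_eq_sub_of_hasDerivAt_of_le hh.1.le
      (f := fun t => f (q + (t • e + (y : E))))]
    · have hb : q + (-b • e + (y : E)) ∉ box q ν e he b := by
        rw [hbox]; simp
      rw [(h0 _ (hcl (-b) ⟨le_rfl, hh.1.le⟩) hb).1, sub_zero]
      rfl
    · exact hf.continuousOn.comp hline.continuousOn hcl
    · intro t ht
      have hx := (H.mem_iff y hy t (hsub t (Ioo_subset_Icc_self ht))).2 ht.2
      have hl : HasDerivAt (fun t : ℝ => q + (t • e + (y : E))) e t := by
        have := (((hasDerivAt_id t).smul_const e).add_const (y : E)).const_add q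
        simpa using this
      exact (hf.hasFDerivAt _ hx).comp_hasDerivAt t hl
    · apply ContinuousOn.intervalIntegrable
      rw [uIcc_of_le hh.1.le]
      exact (hf.continuousOn_deriv.comp hline.continuousOn hcl).clm_apply continuousOn_const
  · rw [indicator_of_notMem hy]
    rw [← integral_zero ℝ ℝ]
    congr 1
    ext t
    by_cases hx : q + (t • e + (y : E)) ∈ X
    · rw [indicator_of_mem hx, (h0 _ (subset_closure hx) _).2]
      · rfl
      · rw [box, mem_ofPred_eq, add_sub_cancel_left, obliqueProj_smul_add he]
        exact fun hb => hy hb.2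
    · rw [indicator_of_notMem hx]

theorem finrank_orthogonal [FiniteDimensional ℝ E] {d : ℕ} (hν : ‖ν‖ = 1)
    (hd : Module.finrank ℝ E = d + 1) :
    Module.finrank ℝ (ℝ ∙ ν)ᗮ = d := by
  have hν0 : ν ≠ 0 := by
    rintro rfl
    simp at hν
  have := (ℝ ∙ ν).finrank_add_finrank_orthogonal
  rw [finrank_span_singleton hν0, hd] at this
  omega

variable [FiniteDimensional ℝ E] [MeasurableSpace E] [BorelSpace E]

/-- The integral of a derivative over the subgraph is an integral over the hyperplane `νᗮ`, by
Fubini's theorem in oblique coordinates. -/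
theorem setIntegral_deriv_eq (H : IsSubgraphAt X q ν e b η h) (hν : ‖ν‖ = 1)
    (he : ⟪ν, e⟫_ℝ = 1) (hXo : IsOpen X) (hXb : Bornology.IsBounded X)
    {f : E → ℝ} {f' : E → E →L[ℝ] ℝ} (hf : IsC1UpToBoundary X f f')
    (h0 : VanishesOutside X f f' (box q ν e he b)) :
    ∫ x in X, f' x e = ∫ y in Metric.ball 0 b, f (graphMap q e h y) := by
  have hint : IntegrableOn (fun x => f' x e) X :=
    ((hf.continuousOn_deriv.clm_apply continuousOn_const).integrableOn_compact
      hXb.isCompact_closure).mono_set subset_closure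
  rw [← integral_indicator hXo.measurableSet,
    ← integral_add_left_eq_self (μ := volume) _ q,
    ← (measurePreserving_obliqueCoord hν e he).integral_comp
      (obliqueCoord ν e he).toHomeomorph.measurableEmbedding, integral_prod_symm,
    ← integral_indicator Metric.isOpen_ball.measurableSet]
  · refine integral_congr_ae (.of_forall fun y => ?_)
    simpa only [obliqueCoord_apply] using H.integral_line he hf h0 y
  · refine (measurePreserving_obliqueCoord hν e he).integrable_comp_of_integrable
      (g := fun x => X.indicator (fun x => f' x e) (q + x)) ?_
    exact ((integrable_indicator_iff hXo.measurableSet).2 hint).comp_add_left q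

variable {d : ℕ}

theorem measure_frontier_inter_box_lt_top (H : IsSubgraphAt X q ν e b η h) (hν : ‖ν‖ = 1)
    (he : ⟪ν, e⟫_ℝ = 1) (hd : Module.finrank ℝ E = d + 1) {K : NNReal}
    (hK : 1 ≤ K * (1 - η * ‖e‖)) :
    μHE[d] (frontier X ∩ box q ν e he b) < ⊤ := by
  rw [← H.image_graphMap he]
  refine ((H.lipschitzOnWith_graphMap hK).euclideanHausdorffMeasure_image_le d).trans_lt ?_
  refine ENNReal.mul_lt_top (by finiteness) ?_
  rw [← finrank_orthogonal hν hd, InnerProductSpace.euclideanHausdorffMeasure_eq_volume]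
  exact measure_ball_lt_top

/-- The surface measure and the Lebesgue measure of the tangent hyperplane are nearly equal,
since the oblique projection along `e` and its inverse are Lipschitz with constant `K`. -/
theorem abs_integral_sub_le (H : IsSubgraphAt X q ν e b η h) (hν : ‖ν‖ = 1)
    (he : ⟪ν, e⟫_ℝ = 1) (hd : Module.finrank ℝ E = d + 1) {K : NNReal} (hK1 : 1 ≤ K)
    (hK : 1 ≤ K * (1 - η * ‖e‖)) (hK' : 1 + η * ‖e‖ ≤ K) {f : E → ℝ}
    (hf : IntegrableOn f (frontier X) μHE[d]) (hfc : ContinuousOn f (frontier X))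
    (h0 : ∀ x ∈ frontier X, x ∉ box q ν e he b → f x = 0) :
    |(∫ y in Metric.ball 0 b, f (graphMap q e h y)) - ∫ x in frontier X, f x ∂μHE[d]| ≤
      ((K : ℝ) ^ d - 1) * ∫ x in frontier X, |f x| ∂μHE[d] := by
  set ψ := graphMap q e h with hψ
  set π : E → (ℝ ∙ ν)ᗮ := fun x => obliqueProj ν e he (x - q) with hπ
  have hπm : Measurable π := (by fun_prop : Continuous π).measurable
  set S := ψ '' Metric.ball 0 b with hS
  have hSe : S = frontier X ∩ box q ν e he b := H.image_graphMap he
  have hSm : MeasurableSet S := by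
    rw [hSe]
    exact isClosed_frontier.measurableSet.inter (isOpen_box he).measurableSet
  have hSf : S ⊆ frontier X := hSe ▸ inter_subset_left
  have hπψ : ∀ y, π (ψ y) = y := fun y => by
    simp only [hπ, hψ, graphMap, add_sub_cancel_left, obliqueProj_smul_add he]
  have hψπ : ∀ x ∈ S, ψ (π x) = x := by
    rintro _ ⟨y, -, rfl⟩
    rw [hπψ]
  set m : Measure (ℝ ∙ ν)ᗮ := volume.restrict (Metric.ball 0 b) with hm
  set n : Measure (ℝ ∙ ν)ᗮ := ((μHE[d] : Measure E).restrict S).map π with hn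
  have hvol : (volume : Measure (ℝ ∙ ν)ᗮ) = μHE[d] := by
    rw [← finrank_orthogonal hν hd, InnerProductSpace.euclideanHausdorffMeasure_eq_volume]
  have hSA : ∀ A, π ⁻¹' A ∩ S = ψ '' (A ∩ Metric.ball 0 b) := by
    intro A
    ext x
    constructor
    · rintro ⟨hxA, y, hy, rfl⟩
      exact ⟨y, ⟨by simpa [hπψ] using hxA, hy⟩, rfl⟩
    · rintro ⟨y, ⟨hyA, hy⟩, rfl⟩
      exact ⟨by simpa [hπψ] using hyA, y, hy, rfl⟩
  have hnm : n ≤ (K ^ d) • m := by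
    refine Measure.le_iff.2 fun A hA => ?_
    rw [hn, Measure.map_apply hπm hA, Measure.restrict_apply (hπm hA), hSA,
      Measure.smul_apply, hm, Measure.restrict_apply hA, hvol, ENNReal.smul_def, smul_eq_mul,
      ENNReal.coe_pow]
    exact ((H.lipschitzOnWith_graphMap hK).mono
      inter_subset_right).euclideanHausdorffMeasure_image_le d
  have hmn : m ≤ (K ^ d) • n := by
    refine Measure.le_iff.2 fun A hA => ?_
    rw [hn, Measure.smul_apply, Measure.map_apply hπm hA, Measure.restrict_apply (hπm hA), hSA,
      hm, Measure.restrict_apply hA, hvol, ENNReal.smul_def, smul_eq_mul, ENNReal.coe_pow]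
    have h1 := ((H.lipschitzOnWith_obliqueProj he hK').mono
      (image_mono (inter_subset_right (s := A)))).euclideanHausdorffMeasure_image_le d
    have h2 : (fun x => obliqueProj ν e he (x - q)) ''
        (graphMap q e h '' (A ∩ Metric.ball 0 b)) = A ∩ Metric.ball 0 b := by
      change π '' (ψ '' (A ∩ Metric.ball 0 b)) = _
      simp only [image_image, hπψ, image_id']
    rwa [h2] at h1
  have hcont : ContinuousOn (fun y => f (ψ y)) (Metric.ball 0 b) :=
    hfc.comp (H.lipschitzOnWith_graphMap hK).continuousOn fun y hy => hSf ⟨y, hy, rfl⟩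
  have hmeas : ∀ {g : (ℝ ∙ ν)ᗮ → ℝ}, ContinuousOn g (Metric.ball 0 b) →
      AEStronglyMeasurable g n := fun hg =>
    (hg.aestronglyMeasurable Metric.isOpen_ball.measurableSet).mono_ac
      ((Measure.absolutelyContinuous_of_le hnm).trans
        (Measure.smul_absolutelyContinuous (c := K ^ d)))
  have htrans : ∀ g : E → ℝ, ContinuousOn (fun y => g (ψ y)) (Metric.ball 0 b) →
      (∀ x ∈ frontier X, x ∉ box q ν e he b → g x = 0) →
      ∫ x in frontier X, g x ∂μHE[d] = ∫ y, g (ψ y) ∂n := by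
    intro g hg hg0
    have hc : ∫ x in S, g (ψ (π x)) ∂μHE[d] = ∫ x in S, g x ∂μHE[d] :=
      setIntegral_congr_fun hSm fun x hx => by simp only [hψπ x hx]
    rw [hn, integral_map hπm.aemeasurable (hmeas hg), hc]
    refine (setIntegral_eq_of_subset_of_forall_sdiff_eq_zero isClosed_frontier.measurableSet
      hSf fun x hx => hg0 x hx.1 fun hb => hx.2 ?_)
    rw [hSe]
    exact ⟨hx.1, hb⟩
  have hfn : Integrable (fun y => f (ψ y)) n := by
    rw [hn, integrable_map_measure (hmeas hcont) hπm.aemeasurable]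
    refine (hf.mono_set hSf).congr ?_
    filter_upwards [ae_restrict_mem hSm] with x hx
    simp only [Function.comp_apply, hψπ x hx]
  rw [htrans f hcont h0, htrans (fun x => |f x|) hcont.abs
    (fun x hx hb => by simp only [h0 x hx hb, abs_zero])]
  have := abs_integral_sub_integral_le_of_le_smul (one_le_pow₀ hK1 : 1 ≤ K ^ d) hmn hnm hfn
  simpa using this

end IsSubgraphAt

end LocalDivergence

/-! ### The divergence theorem -/

section Divergence

variable {E : Type*} [NormedAddCommGroup E] [InnerProductSpace ℝ E]

/-- `X` has a boundary of class `C¹` at `q`, with outward unit normal `ν`. -/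
structure HasC1BoundaryAt (X : Set E) (q ν : E) : Prop where
  norm_eq_one : ‖ν‖ = 1
  exists_defining : ∃ (ρ : E → ℝ) (c : ℝ), 0 < c ∧ Continuous ρ ∧
    HasStrictFDerivAt ρ (c • innerSL ℝ ν) q ∧ ρ q = 0 ∧ (∀ᶠ x in 𝓝 q, x ∈ X ↔ ρ x < 0) ∧
    (∀ᶠ x in 𝓝 q, x ∈ closure X ↔ ρ x ≤ 0) ∧ ∀ᶠ x in 𝓝 q, x ∈ frontier X ↔ ρ x = 0

namespace HasC1BoundaryAt

variable {X : Set E} {q ν : E}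

theorem exists_isSubgraphAt (H : HasC1BoundaryAt X q ν) {e : E} (he : ⟪ν, e⟫_ℝ = 1) {η : ℝ}
    (hη : 0 < η) (hηe : η * (‖e‖ + 1) < 1) : ∃ b h, IsSubgraphAt X q ν e b η h := by
  obtain ⟨ρ, c, hc, hcont, hρ, hq, hX, hXc, hXf⟩ := H.exists_defining
  exact _root_.exists_isSubgraphAt hc he hρ hq hX hXc hXf hcont hη hηe

variable [FiniteDimensional ℝ E] [MeasurableSpace E] [BorelSpace E] {d : ℕ}

theorem exists_measure_lt_top (H : HasC1BoundaryAt X q ν) (hd : Module.finrank ℝ E = d + 1) :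
    ∃ U ∈ 𝓝 q, μHE[d] (frontier X ∩ U) < ⊤ := by
  have he : ⟪ν, ν⟫_ℝ = 1 := by simp [H.norm_eq_one]
  obtain ⟨b, h, hs⟩ := H.exists_isSubgraphAt he (η := 1 / 4) (by norm_num)
    (by rw [H.norm_eq_one]; norm_num)
  refine ⟨IsSubgraphAt.box q ν ν he b, ?_,
    hs.measure_frontier_inter_box_lt_top H.norm_eq_one he hd (K := 2) ?_⟩
  · refine (IsSubgraphAt.isOpen_box he).mem_nhds ⟨?_, ?_⟩
    · simpa using hs.pos
    · simpa using hs.pos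
  · rw [H.norm_eq_one]; norm_num

/-- Near a boundary point, integrating the derivative of `f` in a direction `e` with
`⟪ν, e⟫ = 1` amounts, up to a small error, to integrating `f` over the boundary. -/
theorem exists_radius_of_inner_eq_one (H : HasC1BoundaryAt X q ν)
    (hd : Module.finrank ℝ E = d + 1) (hXo : IsOpen X) (hXb : Bornology.IsBounded X)
    {e : E} (he : ⟪ν, e⟫_ℝ = 1) {ε : ℝ} (hε : 0 < ε) :
    ∃ r > 0, ∀ f f', IsC1UpToBoundary X f f' → VanishesOutside X f f' (Metric.ball q r) →
      IntegrableOn f (frontier X) μHE[d] →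
      |(∫ x in X, f' x e) - ∫ x in frontier X, f x ∂μHE[d]| ≤
        ε * ∫ x in frontier X, |f x| ∂μHE[d] := by
  obtain ⟨s, hs0, hs⟩ : ∃ s : ℝ, 0 < s ∧ (1 + s) ^ d - 1 ≤ ε := by
    have hc : Filter.Tendsto (fun s : ℝ => (1 + s) ^ d - 1) (𝓝 0) (𝓝 0) := by
      have : Continuous fun s : ℝ => (1 + s) ^ d - 1 := by fun_prop
      simpa using this.tendsto 0
    obtain ⟨δ, hδ, h⟩ := Metric.eventually_nhds_iff.1 (hc.eventually (eventually_le_nhds hε))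
    exact ⟨δ / 2, by positivity, h (by simp [abs_of_pos hδ]; linarith)⟩
  -- with this slope the bi-Lipschitz constant `K = 1 + s` satisfies `1 ≤ K (1 - η ‖e‖)`
  set η : ℝ := s / ((1 + s) * (‖e‖ + 1)) with hη
  have hη0 : 0 < η := by positivity
  have hη1 : η * (‖e‖ + 1) = s / (1 + s) := by rw [hη]; field_simp
  have hη2 : s / (1 + s) < 1 := by rw [div_lt_one (by positivity)]; linarith
  have hη3 : s / (1 + s) ≤ s := div_le_self hs0.le (by linarith)
  have hη4 : (1 + s) * (1 - s / (1 + s)) = 1 := by field_simp; ring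
  obtain ⟨b, h, hsub⟩ := H.exists_isSubgraphAt he hη0 (by rw [hη1]; exact hη2)
  refine ⟨b / (‖e‖ + 1), div_pos hsub.pos (by positivity), fun f f' hf h0 hint => ?_⟩
  have hbox : Metric.ball q (b / (‖e‖ + 1)) ⊆ IsSubgraphAt.box q ν e he b :=
    IsSubgraphAt.ball_subset_box H.norm_eq_one he (by rw [div_mul_cancel₀ _ (by positivity)])
  have h0' : VanishesOutside X f f' (IsSubgraphAt.box q ν e he b) :=
    fun x hx hxb => h0 x hx fun hb => hxb (hbox hb)
  rw [hsub.setIntegral_deriv_eq H.norm_eq_one he hXo hXb hf h0']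
  set K : NNReal := 1 + ⟨s, hs0.le⟩ with hK
  have hKs : (K : ℝ) = 1 + s := rfl
  refine (hsub.abs_integral_sub_le H.norm_eq_one he hd (K := K) ?_ ?_ ?_ hint
    (hf.continuousOn.mono frontier_subset_closure)
    fun x hx hb => (h0' x (frontier_subset_closure hx) hb).1).trans ?_
  · rw [hK]; exact le_self_add
  · calc (1 : ℝ) = (1 + s) * (1 - s / (1 + s)) := hη4.symm
      _ ≤ K * (1 - η * ‖e‖) := by
        rw [hKs]
        gcongr
        nlinarith
  · rw [hKs]; nlinarith
  · rw [hKs]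
    gcongr

/-- The divergence theorem near a boundary point, up to a small error. A general direction `e` is
a combination of directions `e'` with `⟪ν, e'⟫ = 1`. -/
theorem exists_radius (H : HasC1BoundaryAt X q ν)
    (hd : Module.finrank ℝ E = d + 1) (hXo : IsOpen X) (hXb : Bornology.IsBounded X)
    {N : E → E} (hN : ContinuousWithinAt N (frontier X) q) (hNq : N q = ν)
    (hNc : ContinuousOn N (frontier X)) (hfin : μHE[d] (frontier X) < ⊤)
    (e : E) {ε : ℝ} (hε : 0 < ε) :
    ∃ r > 0, ∀ f f', IsC1UpToBoundary X f f' → VanishesOutside X f f' (Metric.ball q r) →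
      |(∫ x in X, f' x e) - ∫ x in frontier X, f x * ⟪N x, e⟫_ℝ ∂μHE[d]| ≤
        ε * ∫ x in frontier X, |f x| ∂μHE[d] := by
  have hM : IsCompact (frontier X) :=
    hXb.isCompact_closure.of_isClosed_subset isClosed_frontier frontier_subset_closure
  set c : ℝ := ⟪ν, e⟫_ℝ with hc
  have hν := H.norm_eq_one
  have he1 : ⟪ν, ν⟫_ℝ = 1 := by simp [hν]
  have he2 : ⟪ν, ν + (e - c • ν)⟫_ℝ = 1 := by
    simp [inner_add_right, inner_sub_right, inner_smul_right, hν, ← hc]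
  set ε' : ℝ := ε / (3 + |c|) with hε'
  have hε'0 : 0 < ε' := by positivity
  obtain ⟨r₁, hr₁, h₁⟩ := H.exists_radius_of_inner_eq_one hd hXo hXb he1 hε'0
  obtain ⟨r₂, hr₂, h₂⟩ := H.exists_radius_of_inner_eq_one hd hXo hXb he2 hε'0
  have hN' : ContinuousWithinAt (fun x => ⟪N x, e⟫_ℝ) (frontier X) q :=
    hN.inner continuousWithinAt_const
  obtain ⟨r₃, hr₃, h₃⟩ := Metric.continuousWithinAt_iff.1 hN' ε' hε'0
  refine ⟨min r₁ (min r₂ r₃), by positivity, fun f f' hf h0 => ?_⟩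
  have hfc : ContinuousOn f (frontier X) := hf.continuousOn.mono frontier_subset_closure
  have hint : ∀ g : E → ℝ, ContinuousOn g (frontier X) → IntegrableOn g (frontier X) μHE[d] :=
    fun g hg => hg.integrableOn_of_subset_isCompact hM isClosed_frontier.measurableSet
      subset_rfl hfin.ne
  have hfint := hint f hfc
  have h0₁ := h₁ f f' hf (fun x hx hb => h0 x hx fun hb' => hb
    (Metric.ball_subset_ball (min_le_left _ _) hb')) hfint
  have h0₂ := h₂ f f' hf (fun x hx hb => h0 x hx fun hb' => hb
    (Metric.ball_subset_ball ((min_le_right _ _).trans (min_le_left _ _)) hb')) hfint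
  have hXint : ∀ v : E, IntegrableOn (fun x => f' x v) X := fun v =>
    ((hf.continuousOn_deriv.clm_apply continuousOn_const).integrableOn_compact
      hXb.isCompact_closure).mono_set subset_closure
  -- `e = (ν + (e - c ν)) + (c - 1) ν`, where both vectors have inner product `1` with `ν`
  have hdec : ∫ x in X, f' x e =
      (∫ x in X, f' x (ν + (e - c • ν))) + (c - 1) * ∫ x in X, f' x ν := by
    rw [← integral_const_mul, ← integral_add (hXint _) ((hXint _).const_mul _)]
    refine integral_congr_ae (.of_forall fun x => ?_)
    simp only [map_add, map_sub, map_smul, smul_eq_mul]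
    ring
  set A := ∫ x in frontier X, |f x| ∂μHE[d] with hA
  have hA0 : 0 ≤ A := integral_nonneg fun x => abs_nonneg _
  set I := ∫ x in frontier X, f x ∂μHE[d] with hI
  have h0₃ : |(∫ x in frontier X, f x * ⟪N x, e⟫_ℝ ∂μHE[d]) - c * I| ≤ ε' * A := by
    rw [hI, ← integral_const_mul, ← integral_sub
      (hint (fun x => f x * ⟪N x, e⟫_ℝ) (hfc.mul (hNc.inner continuousOn_const)))
      (hfint.const_mul _), hA, ← integral_const_mul]
    refine abs_integral_le_integral_abs.trans ?_
    refine setIntegral_mono_on ?_ (hfint.abs.const_mul _) isClosed_frontier.measurableSet ?_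
    · exact (hint _ ((hfc.mul (hNc.inner continuousOn_const)).sub
        (continuousOn_const.mul hfc))).abs
    · intro x hx
      by_cases hxb : x ∈ Metric.ball q (min r₁ (min r₂ r₃))
      · have h4 := h₃ hx (lt_of_lt_of_le (Metric.mem_ball.1 hxb)
          ((min_le_right _ _).trans (min_le_right _ _)))
        rw [Real.dist_eq, hNq, ← hc] at h4
        have h5 : f x * ⟪N x, e⟫_ℝ - c * f x = (⟪N x, e⟫_ℝ - c) * f x := by ring
        rw [h5, abs_mul]
        gcongr
      · simp [(h0 x (frontier_subset_closure hx) hxb).1]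
  rw [hdec]
  have hεA : ε * A = (3 + |c|) * (ε' * A) := by rw [hε']; field_simp
  rw [hεA]
  have h6 : (∫ x in X, f' x (ν + (e - c • ν))) + (c - 1) * (∫ x in X, f' x ν) -
      ∫ x in frontier X, f x * ⟪N x, e⟫_ℝ ∂μHE[d] =
      ((∫ x in X, f' x (ν + (e - c • ν))) - I) + (c - 1) * ((∫ x in X, f' x ν) - I) -
        ((∫ x in frontier X, f x * ⟪N x, e⟫_ℝ ∂μHE[d]) - c * I) := by ring
  rw [h6]
  have h7 : |c - 1| ≤ |c| + 1 := by simpa using abs_sub c 1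
  have hεA0 : 0 ≤ ε' * A := by positivity
  calc _ ≤ |(∫ x in X, f' x (ν + (e - c • ν))) - I| + |(c - 1) * ((∫ x in X, f' x ν) - I)| +
        |(∫ x in frontier X, f x * ⟪N x, e⟫_ℝ ∂μHE[d]) - c * I| :=
        (abs_sub _ _).trans (by gcongr; exact abs_add_le _ _)
    _ ≤ ε' * A + (|c| + 1) * (ε' * A) + ε' * A := by
        rw [abs_mul]
        gcongr
    _ = _ := by ring

end HasC1BoundaryAt

variable [FiniteDimensional ℝ E] [MeasurableSpace E] [BorelSpace E] {X : Set E} {f : E → ℝ}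
  {f' : E → E →L[ℝ] ℝ}

theorem IsC1UpToBoundary.integrableOn_deriv (hf : IsC1UpToBoundary X f f')
    (hXb : Bornology.IsBounded X) (v : E) : IntegrableOn (fun x => f' x v) X :=
  ((hf.continuousOn_deriv.clm_apply continuousOn_const).integrableOn_compact
    hXb.isCompact_closure).mono_set subset_closure

/-- The derivative of a function supported away from the boundary has integral zero. -/
theorem IsC1UpToBoundary.setIntegral_deriv_eq_zero (hf : IsC1UpToBoundary X f f')
    (hXo : IsOpen X) (hXb : Bornology.IsBounded X) {K : Set E} (hK : IsClosed K) (hKX : K ⊆ X)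
    (h0 : VanishesOutside X f f' K) (e : E) : ∫ x in X, f' x e = 0 := by
  have hg : ∀ x, HasFDerivAt (X.indicator f) (X.indicator f' x) x := by
    intro x
    by_cases hx : x ∈ X
    · rw [indicator_of_mem hx]
      refine (hf.hasFDerivAt x hx).congr_of_eventuallyEq ?_
      filter_upwards [hXo.mem_nhds hx] with z hz using indicator_of_mem hz _
    · rw [indicator_of_notMem hx]
      refine (hasFDerivAt_const (0 : ℝ) x).congr_of_eventuallyEq ?_
      filter_upwards [hK.isOpen_compl.mem_nhds fun hxK => hx (hKX hxK)] with z hz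
      by_cases hzX : z ∈ X
      · rw [indicator_of_mem hzX, (h0 z (subset_closure hzX) hz).1]
      · rw [indicator_of_notMem hzX]
  have hf' : ∀ x, fderiv ℝ (X.indicator f) x e = X.indicator (fun x => f' x e) x := by
    intro x
    rw [(hg x).fderiv]
    by_cases hx : x ∈ X <;> simp [hx]
  have hint : Integrable (X.indicator fun x => f' x e) :=
    (integrable_indicator_iff hXo.measurableSet).2 (hf.integrableOn_deriv hXb e)
  have hint0 : Integrable (X.indicator f) :=
    (integrable_indicator_iff hXo.measurableSet).2
      ((hf.continuousOn.integrableOn_compact hXb.isCompact_closure).mono_set subset_closure)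
  have := integral_mul_fderiv_eq_neg_fderiv_mul_of_integrable (𝕜 := ℝ) (μ := volume) (v := e)
    (f := fun _ => 1) (g := X.indicator f) (by simp) (by simpa [hf'] using hint)
    (by simpa using hint0) (by fun_prop) (fun x _ => (hg x).differentiableAt)
  simpa [hf', integral_indicator hXo.measurableSet] using this

/-- A compact `C¹` boundary has finite surface measure. -/
theorem measure_frontier_lt_top {d : ℕ} (hd : Module.finrank ℝ E = d + 1)
    (hXb : Bornology.IsBounded X) {N : E → E}
    (hX : ∀ q ∈ frontier X, HasC1BoundaryAt X q (N q)) : μHE[d] (frontier X) < ⊤ := by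
  have hM : IsCompact (frontier X) :=
    hXb.isCompact_closure.of_isClosed_subset isClosed_frontier frontier_subset_closure
  refine hM.measure_lt_top_of_nhdsWithin fun q hq => ?_
  obtain ⟨U, hU, h⟩ := (hX q hq).exists_measure_lt_top hd
  exact ⟨frontier X ∩ U, Filter.inter_mem self_mem_nhdsWithin (mem_nhdsWithin_of_mem_nhds hU), h⟩

/-- The divergence theorem on a bounded open set with `C¹` boundary, for the Euclidean Hausdorff
measure on the boundary. -/
theorem setIntegral_deriv_eq_integral_frontier {d : ℕ} (hd : Module.finrank ℝ E = d + 1)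
    (hXo : IsOpen X) (hXb : Bornology.IsBounded X) {N : E → E}
    (hX : ∀ q ∈ frontier X, HasC1BoundaryAt X q (N q)) (hN : ContinuousOn N (frontier X))
    (hf : IsC1UpToBoundary X f f') (e : E) :
    ∫ x in X, f' x e = ∫ x in frontier X, f x * ⟪N x, e⟫_ℝ ∂μHE[d] := by
  have hM : IsCompact (frontier X) :=
    hXb.isCompact_closure.of_isClosed_subset isClosed_frontier frontier_subset_closure
  have hfin := measure_frontier_lt_top hd hXb hX
  have hint : ∀ g : E → ℝ, ContinuousOn g (frontier X) → IntegrableOn g (frontier X) μHE[d] :=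
    fun g hg => hg.integrableOn_of_subset_isCompact hM isClosed_frontier.measurableSet
      subset_rfl hfin.ne
  have key : ∀ ε > 0, |(∫ x in X, f' x e) - ∫ x in frontier X, f x * ⟪N x, e⟫_ℝ ∂μHE[d]| ≤
      ε * ∫ x in frontier X, |f x| ∂μHE[d] := by
    intro ε hε
    have hloc : ∀ q ∈ closure X, ∃ r > 0, ∀ f f', IsC1UpToBoundary X f f' →
        VanishesOutside X f f' (Metric.ball q r) →
        |(∫ x in X, f' x e) - ∫ x in frontier X, f x * ⟪N x, e⟫_ℝ ∂μHE[d]| ≤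
          ε * ∫ x in frontier X, |f x| ∂μHE[d] := by
      intro q hq
      by_cases hqX : q ∈ X
      · obtain ⟨r, hr, hrX⟩ := Metric.nhds_basis_closedBall.mem_iff.1 (hXo.mem_nhds hqX)
        refine ⟨r, hr, fun f f' hf h0 => ?_⟩
        have h1 := hf.setIntegral_deriv_eq_zero hXo hXb Metric.isClosed_closedBall hrX
          (fun x hx hxb => h0 x hx fun hb => hxb (Metric.ball_subset_closedBall hb)) e
        have h2 : ∀ x ∈ frontier X, f x = 0 := fun x hx =>
          (h0 x (frontier_subset_closure hx) fun hb => by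
            rw [hXo.frontier_eq] at hx
            exact hx.2 (hrX (Metric.ball_subset_closedBall hb))).1
        have h3 : ∫ x in frontier X, f x * ⟪N x, e⟫_ℝ ∂μHE[d] = 0 :=
          setIntegral_eq_zero_of_forall_eq_zero fun x hx => by rw [h2 x hx, zero_mul]
        rw [h1, h3, sub_zero, abs_zero]
        exact mul_nonneg hε.le (integral_nonneg fun x => abs_nonneg _)
      · have hqf : q ∈ frontier X := by
          rw [hXo.frontier_eq]; exact ⟨hq, hqX⟩
        exact (hX q hqf).exists_radius hd hXo hXb (hN q hqf) rfl hN hfin e hε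
    choose! r hr hloc using hloc
    obtain ⟨t, htX, ht⟩ := hXb.isCompact_closure.elim_nhds_subcover
      (fun q => Metric.ball q (r q)) fun q hq => Metric.ball_mem_nhds q (hr q hq)
    -- the local estimates add up, since the error terms `ε ∮ |χ_i f|` do
    obtain ⟨χ, hχ⟩ := SmoothPartitionOfUnity.exists_isSubordinate (modelWithCornersSelf ℝ E)
      (isClosed_closure (s := X)) (fun q : t => Metric.ball (q : E) (r q))
      (fun q => Metric.isOpen_ball) (by simpa [iUnion_subtype] using ht)
    have hχs : ∀ i, ContDiff ℝ ∞ (χ i) := fun i => (χ i).contMDiff.contDiff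
    have hsum : ∀ x ∈ closure X, ∑ i, χ i x = 1 := fun x hx => by
      rw [← χ.sum_eq_one hx, finsum_eq_sum_of_fintype]
    set g : t → E → ℝ := fun i x => χ i x * f x with hg
    set g' : t → E → E →L[ℝ] ℝ := fun i x => χ i x • f' x + f x • fderiv ℝ (χ i) x with hg'
    have hgC : ∀ i, IsC1UpToBoundary X (g i) (g' i) := by
      intro i
      refine ⟨(hχs i).continuous.continuousOn.mul hf.continuousOn, fun x hx => ?_, ?_⟩
      · exact ((hχs i).differentiable (by simp) x).hasFDerivAt.mul (hf.hasFDerivAt x hx)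
      · exact ((hχs i).continuous.continuousOn.smul hf.continuousOn_deriv).add
          (hf.continuousOn.smul ((hχs i).continuous_fderiv (by simp)).continuousOn)
    have hgV : ∀ i : t, VanishesOutside X (g i) (g' i) (Metric.ball (i : E) (r i)) := by
      intro i x hx hxb
      have hxt : x ∉ tsupport (χ i) := fun h => hxb (hχ i h)
      have h1 : χ i x = 0 := image_eq_zero_of_notMem_tsupport hxt
      have h2 : fderiv ℝ (χ i) x = 0 := fderiv_of_notMem_tsupport ℝ hxt
      simp [hg, hg', h1, h2]
    have hgloc := fun i : t => hloc i (htX i i.2) (g i) (g' i) (hgC i) (hgV i)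
    have hfsum : ∀ x ∈ closure X, ∑ i, g i x = f x := fun x hx => by
      rw [← Finset.sum_mul, hsum x hx, one_mul]
    have e1 : ∫ x in X, f' x e = ∑ i, ∫ x in X, g' i x e := by
      rw [← integral_finsetSum _ fun i _ => (hgC i).integrableOn_deriv hXb e]
      refine setIntegral_congr_fun hXo.measurableSet fun x hx => ?_
      have h1 : HasFDerivAt (fun x => ∑ i, g i x) (∑ i, g' i x) x :=
        HasFDerivAt.fun_sum fun i _ => (hgC i).hasFDerivAt x hx
      have h2 : HasFDerivAt (fun x => ∑ i, g i x) (f' x) x := by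
        refine (hf.hasFDerivAt x hx).congr_of_eventuallyEq ?_
        filter_upwards [hXo.mem_nhds hx] with z hz using hfsum z (subset_closure hz)
      simp only [h2.unique h1, sum_apply]
    have hgc : ∀ i, ContinuousOn (g i) (frontier X) := fun i =>
      (hgC i).continuousOn.mono frontier_subset_closure
    have e2 : ∫ x in frontier X, f x * ⟪N x, e⟫_ℝ ∂μHE[d] =
        ∑ i, ∫ x in frontier X, g i x * ⟪N x, e⟫_ℝ ∂μHE[d] := by
      rw [← integral_finsetSum _ fun i _ => hint (fun x => g i x * ⟪N x, e⟫_ℝ)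
        ((hgc i).mul (hN.inner continuousOn_const))]
      refine setIntegral_congr_fun isClosed_frontier.measurableSet fun x hx => ?_
      simp only [← Finset.sum_mul, hfsum x (frontier_subset_closure hx)]
    have e3 : ∫ x in frontier X, |f x| ∂μHE[d] = ∑ i, ∫ x in frontier X, |g i x| ∂μHE[d] := by
      rw [← integral_finsetSum _ fun i _ => (hint _ (hgc i)).abs]
      refine setIntegral_congr_fun isClosed_frontier.measurableSet fun x hx => ?_
      simp only [hg, abs_mul, abs_of_nonneg (χ.nonneg _ _), ← Finset.sum_mul,
        hsum x (frontier_subset_closure hx), one_mul]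
    rw [e1, e2, e3, ← Finset.sum_sub_distrib, Finset.mul_sum]
    exact (Finset.abs_sum_le_sum_abs _ _).trans (Finset.sum_le_sum fun i _ => hgloc i)
  set A := ∫ x in frontier X, |f x| ∂μHE[d]
  have hA0 : 0 ≤ A := integral_nonneg fun x => abs_nonneg _
  refine eq_of_abs_sub_nonpos (le_of_forall_pos_le_add fun ε hε => ?_)
  refine (key (ε / (A + 1)) (by positivity)).trans ?_
  rw [zero_add, div_mul_eq_mul_div, div_le_iff₀ (by positivity)]
  nlinarith

end Divergence

namespace ComplexHessian

/-! ### Smooth boundaries -/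

section Boundary

variable {n : ℕ} {X : Set (Cn n)} {p : Cn n} {ρ : Cn n → ℝ}

theorem inner_gradient (f : Cn n → ℝ) (x v : Cn n) : ⟪gradient f x, v⟫_ℝ = fderiv ℝ f x v :=
  InnerProductSpace.toDual_symm_apply

theorem eventually_neg_of_hasDerivAt_neg {g : ℝ → ℝ} {g' : ℝ} (hg : HasDerivAt g g' 0)
    (h0 : g 0 = 0) (hg' : g' < 0) : ∀ᶠ t in 𝓝[>] 0, g t < 0 := by
  have h := (hasDerivAt_iff_tendsto_slope.1 hg).mono_left (nhdsGT_le_nhdsNE 0)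
  filter_upwards [h.eventually (eventually_lt_nhds hg'), self_mem_nhdsWithin] with t ht ht0
  have ht0' : (0 : ℝ) < t := ht0
  rw [slope_def_field, h0, sub_zero, sub_zero] at ht
  by_contra hgt
  exact absurd ht (not_lt.2 (div_nonneg (not_lt.1 hgt) ht0'.le))

theorem eventually_neg_of_fderiv_neg {v : Cn n} (hρ : DifferentiableAt ℝ ρ p) (h0 : ρ p = 0)
    (hv : fderiv ℝ ρ p v < 0) : ∀ᶠ t : ℝ in 𝓝[>] 0, ρ (p + t • v) < 0 := by
  refine eventually_neg_of_hasDerivAt_neg (g' := fderiv ℝ ρ p v) ?_ (by simpa using h0) hv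
  have hl : HasDerivAt (fun t : ℝ => p + t • v) v 0 := by
    simpa using ((hasDerivAt_id (0 : ℝ)).smul_const v).const_add p
  refine HasFDerivAt.comp_hasDerivAt (0 : ℝ) ?_ hl
  simpa using hρ.hasFDerivAt

theorem tendsto_add_smul_nhdsGT (p v : Cn n) :
    Filter.Tendsto (fun t : ℝ => p + t • v) (𝓝[>] 0) (𝓝 p) := by
  have : Continuous fun t : ℝ => p + t • v := by fun_prop
  simpa using (this.tendsto 0).mono_left nhdsWithin_le_nhds

theorem contDiff_gradient {f : Cn n → ℝ} (hf : ContDiff ℝ ∞ f) : ContDiff ℝ ∞ (gradient f) :=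
  (InnerProductSpace.toDual ℝ (Cn n)).symm.toContinuousLinearEquiv.contDiff.comp
    (hf.fderiv_right (by simp))

/-- The unit normal field `∇ρ / |∇ρ|` of the level sets of `ρ`. -/
noncomputable def unitGradient (ρ : Cn n → ℝ) (x : Cn n) : Cn n := ‖gradient ρ x‖⁻¹ • gradient ρ x

namespace IsDefiningAt

theorem eventually (H : IsDefiningAt X p ρ) : ∀ᶠ x in 𝓝 p, ρ x = 0 → IsDefiningAt X x ρ := by
  have hg := (contDiff_gradient H.contDiff).continuous.continuousAt.eventually_ne
    H.gradient_ne_zero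
  filter_upwards [hg, H.mem_iff.eventually_nhds] with x hx hx' h0
  exact ⟨H.contDiff, h0, hx, hx'⟩

theorem differentiable (H : IsDefiningAt X p ρ) : Differentiable ℝ ρ :=
  H.contDiff.differentiable (by simp)

theorem fderiv_neg_gradient (H : IsDefiningAt X p ρ) : fderiv ℝ ρ p (-gradient ρ p) < 0 := by
  rw [map_neg, ← inner_gradient, real_inner_self_eq_norm_sq, neg_lt_zero]
  have := norm_pos_iff.2 H.gradient_ne_zero
  positivity

theorem mem_closure (H : IsDefiningAt X p ρ) : p ∈ closure X := by
  refine mem_closure_of_tendsto (tendsto_add_smul_nhdsGT p (-gradient ρ p)) ?_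
  filter_upwards [eventually_neg_of_fderiv_neg (H.differentiable p) H.eq_zero
    H.fderiv_neg_gradient, (tendsto_add_smul_nhdsGT p (-gradient ρ p)).eventually H.mem_iff]
    with t ht ht' using ht'.2 ht

theorem mem_frontier (H : IsDefiningAt X p ρ) : p ∈ frontier X := by
  refine ⟨H.mem_closure, fun h => ?_⟩
  have := H.mem_iff.self_of_nhds.1 (interior_subset h)
  rw [H.eq_zero] at this
  exact lt_irrefl _ this

theorem eventually_mem_iff (H : IsDefiningAt X p ρ) :
    ∀ᶠ x in 𝓝 p, (x ∈ closure X ↔ ρ x ≤ 0) ∧ (x ∈ frontier X ↔ ρ x = 0) := by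
  filter_upwards [H.eventually, H.mem_iff.eventually_nhds] with x hx hx'
  rcases lt_trichotomy (ρ x) 0 with h | h | h
  · have hxX : x ∈ interior X := by
      rw [mem_interior_iff_mem_nhds]
      filter_upwards [hx', H.contDiff.continuous.continuousAt.eventually (eventually_lt_nhds h)]
        with z hz hz' using hz.2 hz'
    exact ⟨iff_of_true (subset_closure (interior_subset hxX)) h.le,
      iff_of_false (fun hf => hf.2 hxX) h.ne⟩
  · exact ⟨iff_of_true (hx h).mem_closure h.le, iff_of_true (hx h).mem_frontier h⟩
  · have hxX : x ∉ closure X := by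
      rw [mem_closure_iff_frequently, Filter.not_frequently]
      filter_upwards [hx', H.contDiff.continuous.continuousAt.eventually (eventually_gt_nhds h)]
        with z hz hz' hzX using absurd (hz.1 hzX) hz'.not_gt
    exact ⟨iff_of_false hxX h.not_ge, iff_of_false (fun hf => hxX hf.1) h.ne'⟩

/-- Any two defining functions have gradients in the same direction. -/
theorem unitGradient_eq (H : IsDefiningAt X p ρ) {ρ' : Cn n → ℝ} (H' : IsDefiningAt X p ρ') :
    unitGradient ρ p = unitGradient ρ' p := by
  set g := gradient ρ p with hg
  set g' := gradient ρ' p with hg'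
  have hg0 : 0 < ‖g‖ := norm_pos_iff.2 H.gradient_ne_zero
  have hg0' : 0 < ‖g'‖ := norm_pos_iff.2 H'.gradient_ne_zero
  have key : ∀ v, ⟪g, v⟫_ℝ < 0 → ⟪g', v⟫_ℝ ≤ 0 := by
    intro v hv
    by_contra! hv'
    have h1 := eventually_neg_of_fderiv_neg (H.differentiable p) H.eq_zero
      (by rwa [← inner_gradient])
    have h2 : ∀ᶠ t : ℝ in 𝓝[>] 0, (-ρ') (p + t • v) < 0 := by
      refine eventually_neg_of_fderiv_neg (H'.differentiable p).neg (by simp [H'.eq_zero]) ?_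
      rw [fderiv_neg, neg_apply, ← inner_gradient]
      linarith
    obtain ⟨t, h1, h2, h3, h4⟩ := (h1.and (h2.and
      (((tendsto_add_smul_nhdsGT p v).eventually H.mem_iff).and
        ((tendsto_add_smul_nhdsGT p v).eventually H'.mem_iff)))).exists
    have h5 := h4.1 (h3.2 h1)
    simp only [Pi.neg_apply] at h2
    linarith
  -- for distinct unit vectors `a`, `a'`, the vector `a' - a` contradicts `key'` below
  set a := ‖g‖⁻¹ • g with ha
  set a' := ‖g'‖⁻¹ • g' with ha'
  have ha1 : ‖a‖ = 1 := by rw [ha, norm_smul, norm_inv, norm_norm, inv_mul_cancel₀ hg0.ne']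
  have ha1' : ‖a'‖ = 1 := by rw [ha', norm_smul, norm_inv, norm_norm, inv_mul_cancel₀ hg0'.ne']
  have key' : ∀ v, ⟪a, v⟫_ℝ < 0 → ⟪a', v⟫_ℝ ≤ 0 := by
    intro v hv
    rw [ha, inner_smul_left] at hv
    rw [ha', inner_smul_left]
    have hv' : ⟪g, v⟫_ℝ < 0 := by
      by_contra! h
      exact absurd hv (not_lt.2 (mul_nonneg (by simp) h))
    exact mul_nonpos_of_nonneg_of_nonpos (by simp) (key v hv')
  change a = a'
  by_contra hne
  have hlt : ⟪a, a'⟫_ℝ < 1 := by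
    rcases lt_or_eq_of_le (real_inner_le_norm a a') with h | h
    · simpa [ha1, ha1'] using h
    · rw [ha1, ha1', mul_one] at h
      exact absurd ((inner_eq_one_iff_of_norm_eq_one ha1 ha1').1 h) hne
  have h1 := key' (a' - a) (by
    rw [inner_sub_right, real_inner_self_eq_norm_sq, ha1]; linarith)
  rw [inner_sub_right, real_inner_self_eq_norm_sq, ha1', real_inner_comm] at h1
  linarith

theorem normal_eq (H : IsDefiningAt X p ρ) : normal X p = unitGradient ρ p := by
  have h : p ∈ frontier X ∧ ∃ ρ, IsDefiningAt X p ρ := ⟨H.mem_frontier, ρ, H⟩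
  rw [normal, dif_pos h]
  exact h.2.choose_spec.unitGradient_eq H

theorem norm_normal (H : IsDefiningAt X p ρ) : ‖normal X p‖ = 1 := by
  rw [H.normal_eq, unitGradient, norm_smul, norm_inv, norm_norm,
    inv_mul_cancel₀ (norm_ne_zero_iff.2 H.gradient_ne_zero)]

theorem contDiffAt_unitGradient (H : IsDefiningAt X p ρ) : ContDiffAt ℝ ∞ (unitGradient ρ) p :=
  ((contDiff_gradient H.contDiff).contDiffAt.norm ℝ H.gradient_ne_zero).inv
    (norm_ne_zero_iff.2 H.gradient_ne_zero) |>.smul (contDiff_gradient H.contDiff).contDiffAt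

theorem eventually_normal_eq (H : IsDefiningAt X p ρ) :
    normal X =ᶠ[𝓝[frontier X] p] unitGradient ρ := by
  filter_upwards [mem_nhdsWithin_of_mem_nhds H.eventually,
    mem_nhdsWithin_of_mem_nhds H.eventually_mem_iff, self_mem_nhdsWithin] with x hx hx' hxf
  exact (hx (hx'.2.1 hxf)).normal_eq

theorem fderiv_eq (H : IsDefiningAt X p ρ) :
    fderiv ℝ ρ p = ‖gradient ρ p‖ • innerSL ℝ (normal X p) := by
  ext v
  have := norm_ne_zero_iff.2 H.gradient_ne_zero
  rw [← inner_gradient, H.normal_eq, unitGradient]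
  simp [this]

theorem hasC1BoundaryAt (H : IsDefiningAt X p ρ) : HasC1BoundaryAt X p (normal X p) := by
  refine ⟨H.norm_normal, ρ, ‖gradient ρ p‖, norm_pos_iff.2 H.gradient_ne_zero,
    H.contDiff.continuous, ?_, H.eq_zero, H.mem_iff, ?_, ?_⟩
  · rw [← H.fderiv_eq]
    exact H.contDiff.contDiffAt.hasStrictFDerivAt (by simp)
  · exact H.eventually_mem_iff.mono fun x hx => hx.1
  · exact H.eventually_mem_iff.mono fun x hx => hx.2

/-- Derivatives within the closure are unique at boundary points: the tangent cone contains the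
open half space of directions pointing into `X`. -/
theorem uniqueDiffWithinAt (H : IsDefiningAt X p ρ) : UniqueDiffWithinAt ℝ (closure X) p := by
  rw [uniqueDiffWithinAt_closure]
  refine ⟨?_, H.mem_closure⟩
  have hcone : ∀ v, fderiv ℝ ρ p v < 0 → v ∈ tangentConeAt ℝ X p := by
    intro v hv
    refine mem_tangentConeAt_of_add_smul_mem (l := 𝓝[>] (0 : ℝ)) (c := id)
      (Filter.tendsto_id'.2 (nhdsGT_le_nhdsNE 0)) ?_
    filter_upwards [eventually_neg_of_fderiv_neg (H.differentiable p) H.eq_zero hv,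
      (tendsto_add_smul_nhdsGT p v).eventually H.mem_iff] with t ht ht' using ht'.2 ht
  have htop : Submodule.span ℝ (tangentConeAt ℝ X p) = ⊤ := by
    rw [eq_top_iff]
    intro w _
    set v := -gradient ρ p
    have hv := H.fderiv_neg_gradient
    -- a large multiple of the inner normal direction moves `w` into the cone
    obtain ⟨s, hs⟩ : ∃ s : ℝ, fderiv ℝ ρ p (w + s • v) < 0 := by
      refine ⟨(fderiv ℝ ρ p w + 1) / (-fderiv ℝ ρ p v), ?_⟩
      rw [map_add, map_smul, smul_eq_mul, div_mul_eq_mul_div, div_neg,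
        mul_div_cancel_right₀ _ hv.ne]
      linarith
    have : w = (w + s • v) - s • v := by simp
    rw [this]
    exact Submodule.sub_mem _ (Submodule.subset_span (hcone _ hs))
      (Submodule.smul_mem _ _ (Submodule.subset_span (hcone _ hv)))
  rw [htop]
  exact dense_univ

/-! ### Retractions and tangential derivatives -/

/-- A smooth local retraction onto the boundary. With `g = ∇ρ(p)`, the map
`Φ(x) = x + |g|⁻² (ρ(x) - ⟪g, x - p⟫) g` straightens the boundary and is tangent to the identity
at `p`; the retraction is the projection along `g` in these coordinates. -/
theorem exists_retraction (H : IsDefiningAt X p ρ) :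
    ∃ R : Cn n → Cn n, ContDiffAt ℝ ∞ R p ∧ R p = p ∧ (∀ᶠ x in 𝓝 p, R x ∈ frontier X) ∧
      (∀ᶠ x in 𝓝 p, x ∈ frontier X → R x = x) ∧
      ∀ a, ⟪normal X p, a⟫_ℝ = 0 → fderiv ℝ R p a = a := by
  set g := gradient ρ p with hg
  have hg0 : ‖g‖ ≠ 0 := norm_ne_zero_iff.2 H.gradient_ne_zero
  set s : ℝ := (‖g‖ ^ 2)⁻¹ with hs
  have hsg : s * ⟪g, g⟫_ℝ = 1 := by
    rw [real_inner_self_eq_norm_sq, hs, inv_mul_cancel₀ (pow_ne_zero 2 hg0)]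
  set Φ : Cn n → Cn n := fun x => x + (s * (ρ x - ⟪g, x - p⟫_ℝ)) • g with hΦ
  have hρs := H.contDiff
  have hΦs : ContDiff ℝ ∞ Φ := by
    refine contDiff_id.add (ContDiff.smul (contDiff_const.mul (hρs.sub ?_)) contDiff_const)
    exact contDiff_const.inner ℝ (contDiff_id.sub contDiff_const)
  have hρ' : HasFDerivAt ρ (innerSL ℝ g) p := by
    have h : fderiv ℝ ρ p = innerSL ℝ g := by
      ext v; rw [← inner_gradient]; rfl
    rw [← h]
    exact (H.differentiable p).hasFDerivAt
  have hinn : HasFDerivAt (fun x => ⟪g, x - p⟫_ℝ) (innerSL ℝ g) p :=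
    (innerSL ℝ g).hasFDerivAt.comp p ((hasFDerivAt_id p).sub_const p)
  have hΦ' : HasFDerivAt Φ ((ContinuousLinearEquiv.refl ℝ (Cn n) : Cn n ≃L[ℝ] Cn n) :
      Cn n →L[ℝ] Cn n) p := by
    have h1 := (hasFDerivAt_id p).add ((((hρ'.sub hinn).const_mul s)).smul_const g)
    convert! h1 using 1
    ext v
    simp
  have hΦp : Φ p = p := by simp [hΦ, H.eq_zero]
  have hin : ∀ z, ⟪g, Φ z - p⟫_ℝ = ρ z := by
    intro z
    have : Φ z - p = (z - p) + (s * (ρ z - ⟪g, z - p⟫_ℝ)) • g := by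
      simp only [hΦ]; module
    rw [this, inner_add_right, inner_smul_right, mul_right_comm, hsg]
    ring
  have hst : HasStrictFDerivAt Φ ((ContinuousLinearEquiv.refl ℝ (Cn n) : Cn n ≃L[ℝ] Cn n) :
      Cn n →L[ℝ] Cn n) p := hΦs.contDiffAt.hasStrictFDerivAt' hΦ' (by simp)
  set Ψ := hst.localInverse Φ _ p with hΨ
  have hΨs : ContDiffAt ℝ ∞ Ψ p := by
    have := (hΦs.contDiffAt (x := p)).to_localInverse hΦ' (by simp)
    rwa [hΦp] at this
  have hΨ' : HasFDerivAt Ψ (ContinuousLinearMap.id ℝ (Cn n)) p := by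
    have := hst.to_localInverse.hasFDerivAt
    rwa [hΦp] at this
  set Y : Cn n → Cn n := fun x => Φ x - (s * ρ x) • g with hY
  have hYs : ContDiff ℝ ∞ Y :=
    hΦs.sub ((contDiff_const.mul hρs).smul contDiff_const)
  have hYp : Y p = p := by simp [hY, hΦp, H.eq_zero]
  have hYt : Filter.Tendsto Y (𝓝 p) (𝓝 p) := by
    have := hYs.continuous.tendsto p
    rwa [hYp] at this
  have hΨp : Ψ p = p := by
    have := hst.localInverse_apply_image
    rwa [hΦp] at this
  have hRs : ContDiffAt ℝ ∞ (Ψ ∘ Y) p := by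
    refine ContDiffAt.comp p ?_ hYs.contDiffAt
    rwa [hYp]
  have hRp : (Ψ ∘ Y) p = p := by rw [Function.comp_apply, hYp, hΨp]
  refine ⟨Ψ ∘ Y, hRs, hRp, ?_, ?_, ?_⟩
  · have h1 : ∀ᶠ y in 𝓝 p, Φ (Ψ y) = y := by
      have := hst.eventually_right_inverse
      rwa [hΦp] at this
    have h2 : Filter.Tendsto (Ψ ∘ Y) (𝓝 p) (𝓝 p) := by
      have := hRs.continuousAt.tendsto
      rwa [hRp] at this
    filter_upwards [hYt.eventually h1, h2.eventually H.eventually_mem_iff] with x hx hx'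
    refine hx'.2.2 ?_
    rw [← hin, Function.comp_apply, hx]
    have : Y x - p = (Φ x - p) - (s * ρ x) • g := by simp only [hY]; module
    rw [this, inner_sub_right, inner_smul_right, mul_right_comm, hsg, hin]
    ring
  · filter_upwards [hst.eventually_left_inverse, H.eventually_mem_iff] with x hx hx' hxf
    have h0 := hx'.2.1 hxf
    have : Y x = Φ x := by simp [hY, h0]
    rw [Function.comp_apply, this]
    exact hx
  · intro a ha
    have ha' : ⟪g, a⟫_ℝ = 0 := by
      rw [H.normal_eq, unitGradient, inner_smul_left] at ha
      rcases mul_eq_zero.1 ha with h | h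
      · exact absurd h (by simpa using H.gradient_ne_zero)
      · exact h
    have hY' := hΦ'.sub ((hρ'.const_mul s).smul_const g)
    have hΨY : HasFDerivAt Ψ (ContinuousLinearMap.id ℝ (Cn n)) (Y p) := by rwa [hYp]
    have hR' : HasFDerivAt (Ψ ∘ Y) _ p := hΨY.comp p hY'
    rw [hR'.fderiv]
    simp [ha']

/-- Vectors orthogonal to the normal are tangent to the boundary. -/
theorem mem_tangentConeAt (H : IsDefiningAt X p ρ) {a : Cn n} (ha : ⟪normal X p, a⟫_ℝ = 0) :
    a ∈ tangentConeAt ℝ (frontier X) p := by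
  obtain ⟨R, hRs, hRp, hRm, -, hR'⟩ := H.exists_retraction
  have h1 : HasFDerivWithinAt R (fderiv ℝ R p) {x | R x ∈ frontier X} p :=
    (hRs.differentiableAt (by simp)).hasFDerivAt.hasFDerivWithinAt
  have h0 : a ∈ tangentConeAt ℝ {x | R x ∈ frontier X} p := by
    rw [tangentConeAt_of_mem_nhds hRm]; trivial
  have h2 := h1.mapsTo_tangent_cone h0
  rw [hR' a ha, hRp] at h2
  exact tangentConeAt_mono (by rintro _ ⟨x, hx, rfl⟩; exact hx) h2

theorem fderivWithin_frontier_apply {F : Type*} [NormedAddCommGroup F] [NormedSpace ℝ F]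
    (H : IsDefiningAt X p ρ) {f : Cn n → F} {f' : Cn n →L[ℝ] F}
    (hf : HasFDerivWithinAt f f' (frontier X) p) {a : Cn n} (ha : ⟪normal X p, a⟫_ℝ = 0) :
    fderivWithin ℝ f (frontier X) p a = f' a :=
  hf.differentiableWithinAt.hasFDerivWithinAt.unique_on hf (H.mem_tangentConeAt ha)

theorem hasFDerivWithinAt_normal (H : IsDefiningAt X p ρ) :
    HasFDerivWithinAt (normal X) (fderiv ℝ (unitGradient ρ) p) (frontier X) p :=
  (H.contDiffAt_unitGradient.differentiableAt
    (by simp)).hasFDerivAt.hasFDerivWithinAt.congr_of_eventuallyEq H.eventually_normal_eq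
      H.normal_eq

theorem secondFF_eq (H : IsDefiningAt X p ρ) {a : Cn n} (ha : ⟪normal X p, a⟫_ℝ = 0) (b : Cn n) :
    secondFF X p a b = ⟪fderiv ℝ (unitGradient ρ) p a, b⟫_ℝ := by
  rw [secondFF, H.fderivWithin_frontier_apply H.hasFDerivWithinAt_normal ha]

theorem inner_fderiv_gradient {f : Cn n → ℝ} {x : Cn n} (hf : ContDiffAt ℝ 2 f x) (a b : Cn n) :
    ⟪fderiv ℝ (gradient f) x a, b⟫_ℝ = fderiv ℝ (fderiv ℝ f) x a b := by
  have h : HasFDerivAt (fderiv ℝ f) (fderiv ℝ (fderiv ℝ f) x) x :=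
    ((hf.fderiv_right (m := 1) (by norm_num)).differentiableAt (by simp)).hasFDerivAt
  have h2 : HasFDerivAt (gradient f) _ x :=
    (InnerProductSpace.toDual ℝ (Cn n)).symm.toContinuousLinearEquiv.hasFDerivAt.comp x h
  rw [h2.fderiv]
  exact InnerProductSpace.toDual_symm_apply

theorem fderiv_fderiv_symm {f : Cn n → ℝ} {x : Cn n} (hf : ContDiffAt ℝ 2 f x) (a b : Cn n) :
    fderiv ℝ (fderiv ℝ f) x a b = fderiv ℝ (fderiv ℝ f) x b a :=
  hf.isSymmSndFDerivAt (by simp) a b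

/-- The second fundamental form is symmetric: it is the Hessian of `ρ` divided by `|∇ρ|`. -/
theorem secondFF_symm (H : IsDefiningAt X p ρ) {a b : Cn n} (ha : ⟪normal X p, a⟫_ℝ = 0)
    (hb : ⟪normal X p, b⟫_ℝ = 0) : secondFF X p a b = secondFF X p b a := by
  have key : ∀ a b, ⟪normal X p, b⟫_ℝ = 0 → ⟪fderiv ℝ (unitGradient ρ) p a, b⟫_ℝ =
      ‖gradient ρ p‖⁻¹ * fderiv ℝ (fderiv ℝ ρ) p a b := by
    intro a b hb
    have hb' : ⟪gradient ρ p, b⟫_ℝ = 0 := by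
      rw [H.normal_eq, unitGradient, inner_smul_left] at hb
      rcases mul_eq_zero.1 hb with h | h
      · exact absurd h (by simpa using H.gradient_ne_zero)
      · exact h
    have hn : DifferentiableAt ℝ (fun x => ‖gradient ρ x‖⁻¹) p :=
      ((((contDiff_gradient H.contDiff).contDiffAt.norm ℝ H.gradient_ne_zero).inv
        (norm_ne_zero_iff.2 H.gradient_ne_zero)).differentiableAt (by simp))
    have hd : HasFDerivAt (unitGradient ρ) _ p := hn.hasFDerivAt.smul
      ((contDiff_gradient H.contDiff).differentiable (by simp) p).hasFDerivAt
    rw [hd.fderiv, ← inner_fderiv_gradient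
      (H.contDiff.contDiffAt.of_le (WithTop.coe_le_coe.2 le_top))]
    simp [inner_add_left, inner_smul_left, hb']
  rw [H.secondFF_eq ha, H.secondFF_eq hb, key a b hb, key b a ha,
    fderiv_fderiv_symm (H.contDiff.contDiffAt.of_le (WithTop.coe_le_coe.2 le_top))]

/-- The tangential gradient, computed from any field of vectors representing the derivative of
`u` along the boundary. -/
theorem bdryGrad_eq (H : IsDefiningAt X p ρ) {u : Cn n → ℝ} {v : Cn n}
    (hu : HasFDerivWithinAt u (innerSL ℝ v) (frontier X) p) :
    bdryGrad X u p = v - ⟪normal X p, v⟫_ℝ • normal X p := by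
  set N := normal X p with hN
  set w := gradientWithin u (frontier X) p with hw
  have hwa : ∀ a, ⟪N, a⟫_ℝ = 0 → ⟪w, a⟫_ℝ = ⟪v, a⟫_ℝ := by
    intro a ha
    have h := H.fderivWithin_frontier_apply hu ha
    rw [hw, gradientWithin, InnerProductSpace.toDual_symm_apply, h]
    rfl
  set d := (w - ⟪N, w⟫_ℝ • N) - (v - ⟪N, v⟫_ℝ • N) with hd
  have hNd : ⟪N, d⟫_ℝ = 0 := by
    have hN' : ‖N‖ = 1 := H.norm_normal
    simp [hd, inner_sub_right, inner_smul_right, hN']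
  have hdd : ⟪d, d⟫_ℝ = 0 := by
    have h1 : ⟪d, d⟫_ℝ = ⟪w, d⟫_ℝ - ⟪v, d⟫_ℝ :=
      calc ⟪d, d⟫_ℝ = ⟪(w - ⟪N, w⟫_ℝ • N) - (v - ⟪N, v⟫_ℝ • N), d⟫_ℝ := rfl
        _ = _ := by simp only [inner_sub_left, inner_smul_left, hNd, mul_zero, sub_zero]
    rw [h1, hwa d hNd, sub_self]
  exact sub_eq_zero.1 (inner_self_eq_zero.1 hdd)

/-- The Hessian of `u|_M` on tangent vectors, computed from any field `G` of vectors representing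
the derivative of `u` along the boundary. -/
theorem bdryHess_eq (H : IsDefiningAt X p ρ) {u : Cn n → ℝ} {G : Cn n → Cn n}
    {G' : Cn n →L[ℝ] Cn n}
    (hu : ∀ᶠ x in 𝓝[frontier X] p, HasFDerivWithinAt u (innerSL ℝ (G x)) (frontier X) x)
    (hG : HasFDerivWithinAt G G' (frontier X) p) {a b : Cn n} (ha : ⟪normal X p, a⟫_ℝ = 0)
    (hb : ⟪normal X p, b⟫_ℝ = 0) :
    bdryHess X u p a b = ⟪G' a, b⟫_ℝ - ⟪normal X p, G p⟫_ℝ * secondFF X p a b := by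
  have hE : bdryGrad X u =ᶠ[𝓝[frontier X] p]
      fun x => G x - ⟪normal X x, G x⟫_ℝ • normal X x := by
    filter_upwards [hu, mem_nhdsWithin_of_mem_nhds H.eventually,
      mem_nhdsWithin_of_mem_nhds H.eventually_mem_iff, self_mem_nhdsWithin] with x h1 h2 h3 h4
    exact (h2 (h3.2.1 h4)).bdryGrad_eq h1
  have hd : HasFDerivWithinAt (fun x => G x - ⟪normal X x, G x⟫_ℝ • normal X x) _
      (frontier X) p :=
    hG.sub ((H.hasFDerivWithinAt_normal.inner ℝ hG).smul H.hasFDerivWithinAt_normal)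
  have hd' := hd.congr_of_eventuallyEq hE (hE.self_of_nhdsWithin H.mem_frontier)
  rw [bdryHess, H.fderivWithin_frontier_apply hd' ha, H.secondFF_eq ha]
  simp [inner_sub_left, inner_add_left, inner_smul_left, hb]

end IsDefiningAt

end Boundary

/-! ### Smooth bounded domains -/

section SmoothDomain

variable {n : ℕ} {X : Set (Cn n)} {p : Cn n} {u : Cn n → ℝ}

theorem real_inner_eq_re (x y : Cn n) : ⟪x, y⟫_ℝ = (⟪x, y⟫_ℂ).re := by
  simp [PiLp.inner_apply]

theorem inner_normal_of_mem_holTangent {a : Cn n} (ha : a ∈ holTangent X p) :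
    ⟪normal X p, a⟫_ℝ = 0 := by
  rw [real_inner_eq_re, Submodule.mem_orthogonal_singleton_iff_inner_right.1 ha, Complex.zero_re]

namespace IsSmoothBoundedDomain

theorem isCompact_frontier (hX : IsSmoothBoundedDomain X) : IsCompact (frontier X) :=
  hX.isBounded.isCompact_closure.of_isClosed_subset isClosed_frontier frontier_subset_closure

theorem uniqueDiffOn (hX : IsSmoothBoundedDomain X) : UniqueDiffOn ℝ (closure X) := by
  intro x hx
  by_cases hxX : x ∈ X
  · exact uniqueDiffWithinAt_of_mem_nhds
      (Filter.mem_of_superset (hX.isOpen.mem_nhds hxX) subset_closure)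
  · obtain ⟨ρ, hρ⟩ := hX.smooth_boundary x (by rw [hX.isOpen.frontier_eq]; exact ⟨hx, hxX⟩)
    exact hρ.uniqueDiffWithinAt

theorem continuousOn_normal (hX : IsSmoothBoundedDomain X) :
    ContinuousOn (normal X) (frontier X) := by
  intro p hp
  obtain ⟨ρ, hρ⟩ := hX.smooth_boundary p hp
  exact hρ.hasFDerivWithinAt_normal.continuousWithinAt

theorem norm_normal (hX : IsSmoothBoundedDomain X) (hp : p ∈ frontier X) : ‖normal X p‖ = 1 := by
  obtain ⟨ρ, hρ⟩ := hX.smooth_boundary p hp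
  exact hρ.norm_normal

theorem finrank_eq (hn : n ≠ 0) : Module.finrank ℝ (Cn n) = 2 * n - 1 + 1 := by
  rw [finrank_real_of_complex, finrank_euclideanSpace, Fintype.card_fin]
  omega

theorem hasC1BoundaryAt (hX : IsSmoothBoundedDomain X) :
    ∀ q ∈ frontier X, HasC1BoundaryAt X q (normal X q) := fun q hq => by
  obtain ⟨ρ, hρ⟩ := hX.smooth_boundary q hq
  exact hρ.hasC1BoundaryAt

theorem frontier_eq_empty (hX : IsSmoothBoundedDomain X) (hn : n = 0) : frontier X = ∅ := by
  subst hn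
  have : X = univ := Subsingleton.eq_univ_of_nonempty hX.isConnected.nonempty
  rw [this, frontier_univ]

theorem measure_frontier_lt_top (hX : IsSmoothBoundedDomain X) :
    μHE[2 * n - 1] (frontier X) < ⊤ := by
  by_cases hn : n = 0
  · rw [hX.frontier_eq_empty hn, measure_empty]
    exact ENNReal.zero_lt_top
  · exact _root_.measure_frontier_lt_top (finrank_eq hn) hX.isBounded hX.hasC1BoundaryAt

theorem integrableOn_frontier {F : Type*} [NormedAddCommGroup F] (hX : IsSmoothBoundedDomain X)
    {g : Cn n → F} (hg : ContinuousOn g (frontier X)) :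
    IntegrableOn g (frontier X) μHE[2 * n - 1] :=
  hg.integrableOn_of_subset_isCompact hX.isCompact_frontier isClosed_frontier.measurableSet
    subset_rfl hX.measure_frontier_lt_top.ne

/-- The divergence theorem on `X`. For `n = 0` both sides vanish. -/
theorem setIntegral_fderivWithin (hX : IsSmoothBoundedDomain X) {f : Cn n → ℝ}
    (hf : ContDiffOn ℝ 1 f (closure X)) (e : Cn n) :
    ∫ x in X, fderivWithin ℝ f (closure X) x e =
      ∫ x in frontier X, f x * ⟪normal X x, e⟫_ℝ ∂μHE[2 * n - 1] := by
  by_cases hn : n = 0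
  · subst hn
    simp [Subsingleton.elim e 0]
  · refine setIntegral_deriv_eq_integral_frontier (finrank_eq hn) hX.isOpen hX.isBounded
      hX.hasC1BoundaryAt hX.continuousOn_normal ⟨hf.continuousOn, fun x hx => ?_, ?_⟩ e
    · exact ((hf.differentiableOn (by simp) x (subset_closure hx)).hasFDerivWithinAt).hasFDerivAt
        (Filter.mem_of_superset (hX.isOpen.mem_nhds hx) subset_closure)
    · exact hf.continuousOn_fderivWithin hX.uniqueDiffOn le_rfl

/-- Along the boundary, `∇²u = ∇̄²u + u_ν L` on tangent vectors. -/
theorem hess_eq (hX : IsSmoothBoundedDomain X) (hu : ContDiffOn ℝ 2 u (closure X))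
    (hp : p ∈ frontier X) {a b : Cn n} (ha : ⟪normal X p, a⟫_ℝ = 0)
    (hb : ⟪normal X p, b⟫_ℝ = 0) :
    hess X u p a b = bdryHess X u p a b + normalDeriv X u p * secondFF X p a b := by
  obtain ⟨ρ, hρ⟩ := hX.smooth_boundary p hp
  have hpc := frontier_subset_closure hp
  let T : (Cn n →L[ℝ] ℝ) ≃L[ℝ] Cn n :=
    (InnerProductSpace.toDual ℝ (Cn n)).symm.toContinuousLinearEquiv
  have hT : ∀ l : Cn n →L[ℝ] ℝ, innerSL ℝ (T l) = l := fun l => by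
    ext v
    exact InnerProductSpace.toDual_symm_apply (E := Cn n)
  have hd : ContDiffOn ℝ 1 (diff X u) (closure X) :=
    hu.fderivWithin hX.uniqueDiffOn (by norm_num)
  have hG : HasFDerivWithinAt (fun x => T (diff X u x))
      ((T : (Cn n →L[ℝ] ℝ) →L[ℝ] Cn n) ∘L fderivWithin ℝ (diff X u) (closure X) p) (frontier X) p :=
    (T.hasFDerivAt.comp_hasFDerivWithinAt p
      (hd.differentiableOn (by simp) p hpc).hasFDerivWithinAt).mono frontier_subset_closure
  have hu' : ∀ᶠ x in 𝓝[frontier X] p,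
      HasFDerivWithinAt u (innerSL ℝ (T (diff X u x))) (frontier X) x := by
    filter_upwards [self_mem_nhdsWithin] with x hx
    rw [hT]
    exact (hu.differentiableOn (by simp) x
      (frontier_subset_closure hx)).hasFDerivWithinAt.mono frontier_subset_closure
  rw [hρ.bdryHess_eq hu' hG ha hb]
  have h1 : ⟪((T : (Cn n →L[ℝ] ℝ) →L[ℝ] Cn n) ∘L fderivWithin ℝ (diff X u) (closure X) p) a, b⟫_ℝ =
      hess X u p a b := InnerProductSpace.toDual_symm_apply
  have h2 : ⟪normal X p, T (diff X u p)⟫_ℝ = normalDeriv X u p := by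
    rw [real_inner_comm]
    exact InnerProductSpace.toDual_symm_apply
  rw [h1, h2]
  ring

theorem part11_hess_eq (hX : IsSmoothBoundedDomain X) (hu : ContDiffOn ℝ 2 u (closure X))
    (hp : p ∈ frontier X) {a b : Cn n} (ha : a ∈ holTangent X p) (hb : b ∈ holTangent X p) :
    part11 (hess X u p) a b = part11 (bdryHess X u p) a b +
      (normalDeriv X u p : ℂ) * part11 (secondFF X p) a b := by
  have h := fun {c d : Cn n} (hc : c ∈ holTangent X p) (hd : d ∈ holTangent X p) =>
    hX.hess_eq hu hp (inner_normal_of_mem_holTangent hc) (inner_normal_of_mem_holTangent hd)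
  have hI := fun {c : Cn n} (hc : c ∈ holTangent X p) =>
    (holTangent X p).smul_mem Complex.I hc
  unfold part11
  rw [h ha hb, h (hI ha) (hI hb), h ha (hI hb), h (hI ha) hb]
  push_cast
  ring

/-- A function of class `C²` on `M` extends to a `C²` function near each point of `M`, by
composition with a retraction; its Hessian on `M` is that of the extension up to a multiple of the
second fundamental form. -/
theorem exists_retraction_extension (hX : IsSmoothBoundedDomain X) (hp : p ∈ frontier X) :
    ∃ R : Cn n → Cn n, ContDiffAt ℝ 2 R p ∧ R p = p ∧ (∀ᶠ x in 𝓝 p, R x ∈ frontier X) ∧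
      ∀ u : Cn n → ℝ, ContDiffOn ℝ 2 u (frontier X) → ContDiffAt ℝ 2 (u ∘ R) p ∧
      ∀ᶠ x in 𝓝[frontier X] p, ContDiffAt ℝ 2 (u ∘ R) x ∧ ∀ a b, ⟪normal X x, a⟫_ℝ = 0 →
        ⟪normal X x, b⟫_ℝ = 0 → bdryHess X u x a b = fderiv ℝ (fderiv ℝ (u ∘ R)) x a b -
          fderiv ℝ (u ∘ R) x (normal X x) * secondFF X x a b := by
  obtain ⟨ρ, hρ⟩ := hX.smooth_boundary p hp
  obtain ⟨R, hRs, hRp, hRm, hRi, -⟩ := hρ.exists_retraction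
  have hRs2 : ContDiffAt ℝ 2 R p := hRs.of_le (WithTop.coe_le_coe.2 le_top)
  refine ⟨R, hRs2, hRp, hRm, fun u hu => ?_⟩
  have hU : ContDiffAt ℝ 2 (u ∘ R) p := by
    have h1 : ContDiffWithinAt ℝ 2 (u ∘ R) {x | R x ∈ frontier X} p :=
      ContDiffWithinAt.comp p (t := frontier X) (by rw [hRp]; exact hu p hp)
        hRs2.contDiffWithinAt (fun x hx => hx)
    exact h1.contDiffAt hRm
  refine ⟨hU, ?_⟩
  have hUe : ∀ᶠ x in 𝓝 p, ContDiffAt ℝ 2 (u ∘ R) x := hU.eventually (by simp)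
  have hder : ∀ᶠ x in 𝓝 p, x ∈ frontier X →
      HasFDerivWithinAt u (innerSL ℝ (gradient (u ∘ R) x)) (frontier X) x := by
    filter_upwards [hUe, hRi.eventually_nhds] with x hx hx' hxf
    have h1 : HasFDerivAt (u ∘ R) (innerSL ℝ (gradient (u ∘ R) x)) x := by
      have h2 : innerSL ℝ (gradient (u ∘ R) x) = fderiv ℝ (u ∘ R) x := by
        ext v; exact inner_gradient _ _ _
      rw [h2]
      exact (hx.differentiableAt (by simp)).hasFDerivAt
    refine h1.hasFDerivWithinAt.congr_of_eventuallyEq ?_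
      (by rw [Function.comp_apply, hx'.self_of_nhds hxf])
    filter_upwards [mem_nhdsWithin_of_mem_nhds hx', self_mem_nhdsWithin] with z hz hzf
    rw [Function.comp_apply, hz hzf]
  filter_upwards [mem_nhdsWithin_of_mem_nhds hUe, mem_nhdsWithin_of_mem_nhds hder.eventually_nhds,
    self_mem_nhdsWithin] with x hx hx' hxf
  refine ⟨hx, fun a b ha hb => ?_⟩
  obtain ⟨ρ', hρ'⟩ := hX.smooth_boundary x hxf
  have hG : HasFDerivWithinAt (gradient (u ∘ R)) (fderiv ℝ (gradient (u ∘ R)) x)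
      (frontier X) x := by
    have h1 : ContDiffAt ℝ 1 (gradient (u ∘ R)) x :=
      (InnerProductSpace.toDual ℝ (Cn n)).symm.toContinuousLinearEquiv.contDiff.contDiffAt.comp x
        (hx.fderiv_right (by norm_num))
    exact (h1.differentiableAt (by simp)).hasFDerivAt.hasFDerivWithinAt
  have hu' : ∀ᶠ z in 𝓝[frontier X] x,
      HasFDerivWithinAt u (innerSL ℝ (gradient (u ∘ R) z)) (frontier X) z := by
    filter_upwards [mem_nhdsWithin_of_mem_nhds hx', self_mem_nhdsWithin] with z hz hzf using hz hzf
  rw [hρ'.bdryHess_eq hu' hG ha hb, IsDefiningAt.inner_fderiv_gradient hx, real_inner_comm,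
    inner_gradient]

end IsSmoothBoundedDomain

end SmoothDomain

/-! ### Forms in unitary frames -/

section Frames

variable {n : ℕ}

/-- `B` is a real bilinear form. -/
def IsBilinForm (B : Cn n → Cn n → ℝ) : Prop :=
  ∃ β : Cn n →ₗ[ℝ] Cn n →ₗ[ℝ] ℝ, ∀ a b, B a b = β a b

/-- The form `B(Z_a, Z̄_b)` as a sesquilinear map. -/
noncomputable def part11Sesq (β : Cn n →ₗ[ℝ] Cn n →ₗ[ℝ] ℝ) :
    Cn n →ₗ[ℂ] Cn n →ₛₗ[starRingEnd ℂ] ℂ :=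
  LinearMap.mk₂'ₛₗ (RingHom.id ℂ) (starRingEnd ℂ) (part11 fun a b => β a b)
    (fun a a' b => by
      simp only [part11, smul_add, map_add, LinearMap.add_apply]
      push_cast
      ring)
    (fun c a b => by
      have h : ∀ x : Cn n, c • x = c.re • x + c.im • (Complex.I • x) := fun x => by
        conv_lhs => rw [← Complex.re_add_im c, add_smul, mul_smul]
        rfl
      have h' : Complex.I • c • a = c.re • (Complex.I • a) - c.im • a := by
        rw [h, smul_add, smul_comm, smul_comm Complex.I c.im, smul_smul Complex.I Complex.I,
          Complex.I_mul_I, neg_one_smul, smul_neg, sub_eq_add_neg]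
      simp only [part11, h']
      simp only [h a, map_add, map_sub, map_smul, LinearMap.add_apply,
        LinearMap.sub_apply, LinearMap.smul_apply, smul_eq_mul, RingHom.id_apply]
      apply Complex.ext <;> simp <;> ring)
    (fun a b b' => by
      simp only [part11, smul_add, map_add]
      push_cast
      ring)
    (fun c a b => by
      have h : ∀ x : Cn n, c • x = c.re • x + c.im • (Complex.I • x) := fun x => by
        conv_lhs => rw [← Complex.re_add_im c, add_smul, mul_smul]
        rfl
      have h' : Complex.I • c • b = c.re • (Complex.I • b) - c.im • b := by
        rw [h, smul_add, smul_comm, smul_comm Complex.I c.im, smul_smul Complex.I Complex.I,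
          Complex.I_mul_I, neg_one_smul, smul_neg, sub_eq_add_neg]
      simp only [part11, h']
      simp only [h b, map_add, map_sub, map_smul, smul_eq_mul]
      apply Complex.ext <;> simp <;> ring)

/-- The components of `B` in any frame, in terms of those in the standard frame. -/
theorem part11_eq_sum {B : Cn n → Cn n → ℝ} (hB : IsBilinForm B) (a b : Cn n) :
    part11 B a b =
      ∑ c, ∑ d, a c * (starRingEnd ℂ) (b d) * formMatrix B (stdFrame n) c d := by
  obtain ⟨β, hβ⟩ := hB
  obtain rfl : B = fun a b => β a b := by ext a b; exact hβ a b
  have hsum : ∀ x : Cn n, x = ∑ c, x c • stdFrame n c := fun x => by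
    ext i
    simp [stdFrame, Finset.sum_apply, Pi.single_apply]
  change part11Sesq β a b = _
  conv_lhs => rw [hsum a, hsum b]
  simp only [map_sum, map_smul, LinearMap.sum_apply, LinearMap.smul_apply, map_smulₛₗ,
    smul_eq_mul, Finset.mul_sum]
  rw [Finset.sum_comm]
  refine Finset.sum_congr rfl fun c _ => Finset.sum_congr rfl fun d _ => ?_
  have h : part11Sesq β (stdFrame n c) (stdFrame n d) =
      formMatrix (fun a b => β a b) (stdFrame n) c d := rfl
  rw [h]
  ring

variable {ι m : Type*} [Fintype ι] [DecidableEq ι]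

/-- The polarized symmetric function of the restrictions of real bilinear forms to the range of a
unitary projection with matrix `P`. -/
noncomputable def projSigma (B : ι → Cn n → Cn n → ℝ) (P : Fin n → Fin n → ℂ) : ℂ :=
  ((Fintype.card ι)! : ℂ)⁻¹ * ∑ K : ι → Fin n, ∑ L : ι → Fin n,
    Matrix.det (Matrix.of fun a b : ι => P (K a) (L b)) *
      ∏ l, formMatrix (B l) (stdFrame n) (K l) (L l)

/-- The symmetric functions of forms in a unitary frame depend only on the projection onto the
span of the frame. -/
theorem sigmaPol_formMatrix [Fintype m] [DecidableEq m] {B : ι → Cn n → Cn n → ℝ}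
    (hB : ∀ l, IsBilinForm (B l))
    {e : m → Cn n} {P : Fin n → Fin n → ℂ}
    (hP : ∀ K L, ∑ α, e α K * (starRingEnd ℂ) (e α L) = P K L) :
    sigmaPol (fun l => formMatrix (B l) e) = projSigma B P := by
  have h : (fun l => formMatrix (B l) e) = fun l => Matrix.of fun a b =>
      ∑ c, ∑ d, e a c * (starRingEnd ℂ) (e b d) * formMatrix (B l) (stdFrame n) c d := by
    ext l a b
    exact part11_eq_sum (hB l) _ _
  rw [h, sigmaPol_frame (fun a c => e a c) (fun b d => (starRingEnd ℂ) (e b d))]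
  simp only [hP]
  rfl

theorem formMatrix_congr {B B' : Cn n → Cn n → ℝ} {V : Submodule ℂ (Cn n)} {e : m → Cn n}
    (he : ∀ α, e α ∈ V) (h : ∀ a ∈ V, ∀ b ∈ V, B a b = B' a b) :
    formMatrix B e = formMatrix B' e := by
  ext α β
  have hI := fun α => V.smul_mem Complex.I (he α)
  simp only [formMatrix, Matrix.of_apply, part11, h _ (he α) _ (he β), h _ (hI α) _ (hI β),
    h _ (he α) _ (hI β), h _ (hI α) _ (he β)]

theorem star_formMatrix {B : Cn n → Cn n → ℝ} {V : Submodule ℂ (Cn n)} {e : m → Cn n}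
    (he : ∀ α, e α ∈ V) (h : ∀ a ∈ V, ∀ b ∈ V, B a b = B b a) (α β : m) :
    (starRingEnd ℂ) (formMatrix B e α β) = formMatrix B e β α := by
  have hI := fun α => V.smul_mem Complex.I (he α)
  simp only [formMatrix, Matrix.of_apply, part11, h _ (he α) _ (he β), h _ (hI α) _ (hI β),
    h _ (he α) _ (hI β), h _ (hI α) _ (he β), map_div₀, map_add, map_mul, Complex.conj_ofReal,
    Complex.conj_I, map_ofNat]
  push_cast
  ring

/-- The matrix of the unitary projection onto the holomorphic tangent space. -/
noncomputable def holProj (X : Set (Cn n)) (p : Cn n) (K L : Fin n) : ℂ :=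
  (if K = L then 1 else 0) - normal X p K * (starRingEnd ℂ) (normal X p L)

/-- For every unitary basis of the holomorphic tangent space, `∑ e_α ⊗ ē_α` is the matrix of the
orthogonal projection onto it. -/
theorem sum_orthonormalBasis_holTangent [Fintype m] {X : Set (Cn n)} {p : Cn n}
    (hν : ‖normal X p‖ = 1)
    (e : OrthonormalBasis m ℂ (holTangent X p)) (K L : Fin n) :
    ∑ α, (e α : Cn n) K * (starRingEnd ℂ) ((e α : Cn n) L) = holProj X p K L := by
  have h1 := e.orthogonalProjectionOnto_apply_eq_sum (stdFrame n L)
  have h2 := congrArg (fun x : holTangent X p => (x : Cn n) K) h1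
  have h3 : (((holTangent X p).orthogonalProjectionOnto (stdFrame n L) : holTangent X p) : Cn n) =
      stdFrame n L - ⟪normal X p, stdFrame n L⟫_ℂ • normal X p := by
    rw [← Submodule.starProjection_apply]
    unfold holTangent
    rw [Submodule.starProjection_orthogonal_val, Submodule.starProjection_unit_singleton _ hν]
  simp only [h3] at h2
  rw [holProj]
  have h4 : ⟪normal X p, stdFrame n L⟫_ℂ = (starRingEnd ℂ) (normal X p L) := by
    simp [stdFrame, EuclideanSpace.inner_single_right]
  rw [h4] at h2
  have h5 : (stdFrame n L - (starRingEnd ℂ) (normal X p L) • normal X p) K =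
      (if K = L then 1 else 0) - normal X p K * (starRingEnd ℂ) (normal X p L) := by
    simp [stdFrame, mul_comm]
  rw [← h5, h2]
  have h6 : ∀ α, ⟪(e α : Cn n), stdFrame n L⟫_ℂ = (starRingEnd ℂ) ((e α : Cn n) L) := fun α => by
    simp [stdFrame, EuclideanSpace.inner_single_right]
  simp only [h6, Submodule.coe_sum, Submodule.coe_smul, WithLp.ofLp_sum, Finset.sum_apply,
    WithLp.ofLp_smul, Pi.smul_apply, smul_eq_mul]
  exact Finset.sum_congr rfl fun α _ => mul_comm _ _

end Frames

/-! ### The boundary densities -/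

section Densities

variable {n : ℕ} {X : Set (Cn n)} {p : Cn n} {u : Cn n → ℝ}

theorem isBilinForm_inner (F : Cn n →L[ℝ] Cn n) : IsBilinForm fun a b => ⟪F a, b⟫_ℝ :=
  ⟨(innerₗ (Cn n)) ∘ₗ (F : Cn n →ₗ[ℝ] Cn n), fun _ _ => rfl⟩

theorem isBilinForm_apply (F : Cn n →L[ℝ] Cn n →L[ℝ] ℝ) : IsBilinForm fun a b => F a b :=
  ⟨LinearMap.mk₂ ℝ (fun a b => F a b) (by simp) (by simp) (by simp) (by simp), fun _ _ => rfl⟩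

theorem IsBilinForm.add_const_mul {B B' : Cn n → Cn n → ℝ} (hB : IsBilinForm B)
    (hB' : IsBilinForm B') (c : ℝ) : IsBilinForm fun a b => B a b + c * B' a b := by
  obtain ⟨β, hβ⟩ := hB
  obtain ⟨β', hβ'⟩ := hB'
  exact ⟨β + c • β', fun a b => by simp [hβ, hβ']⟩

theorem isBilinForm_secondFF (X : Set (Cn n)) (p : Cn n) : IsBilinForm (secondFF X p) :=
  isBilinForm_inner _

theorem isBilinForm_bdryForm (X : Set (Cn n)) (u : Cn n → ℝ) (p : Cn n) :
    IsBilinForm (bdryForm X u p) :=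
  (isBilinForm_inner (fderivWithin ℝ (bdryGrad X u) (frontier X) p)).add_const_mul
    (isBilinForm_secondFF X p) _

/-- A boundary density in terms of any forms `L'`, `Φ'` that agree on the holomorphic tangent
space with the given ones. The right-hand side does not involve the frame. -/
theorem density_eq_projSigma {m : Type*} [Fintype m] [DecidableEq m] (k i : ℕ)
    {Φ Φ' L' : Cn n → Cn n → ℝ} (hν : ‖normal X p‖ = 1) (hL' : IsBilinForm L')
    (hΦ' : IsBilinForm Φ')
    (hL : ∀ a ∈ holTangent X p, ∀ b ∈ holTangent X p, secondFF X p a b = L' a b)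
    (hΦ : ∀ a ∈ holTangent X p, ∀ b ∈ holTangent X p, Φ a b = Φ' a b)
    (u : Cn n → ℝ) (e : OrthonormalBasis m ℂ (holTangent X p)) :
    density X k i Φ u p (fun α => (e α : Cn n)) =
      (u p : ℂ) * (normalDeriv X u p : ℂ) ^ (i - 1) *
        projSigma (Sum.elim (fun _ : Fin (i - 2) => L') (fun _ : Fin (k + 1 - i) => Φ'))
          (holProj X p) := by
  have he : ∀ α, (e α : Cn n) ∈ holTangent X p := fun α => (e α).2
  rw [density, formMatrix_congr he hL, formMatrix_congr he hΦ,
    ← sigmaPol_formMatrix (e := fun α => (e α : Cn n)) (fun l => ?_)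
      (sum_orthonormalBasis_holTangent hν e)]
  · congr 2
    ext l
    cases l <;> rfl
  · cases l
    · exact hL'
    · exact hΦ'

/-- The boundary densities are independent of the unitary frame. -/
theorem density_orthonormalBasis_eq {m m' : Type*} [Fintype m] [DecidableEq m] [Fintype m']
    [DecidableEq m'] (k i : ℕ) {Φ : Cn n → Cn n → ℝ} (hν : ‖normal X p‖ = 1)
    (hΦ : IsBilinForm Φ) (u : Cn n → ℝ) (e : OrthonormalBasis m ℂ (holTangent X p))
    (e' : OrthonormalBasis m' ℂ (holTangent X p)) :
    density X k i Φ u p (fun α => (e α : Cn n)) = density X k i Φ u p (fun α => (e' α : Cn n)) := by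
  rw [density_eq_projSigma k i hν (isBilinForm_secondFF X p) hΦ (fun _ _ _ _ => rfl)
    (fun _ _ _ _ => rfl), density_eq_projSigma k i hν (isBilinForm_secondFF X p) hΦ
    (fun _ _ _ _ => rfl) (fun _ _ _ _ => rfl)]

theorem density_im_eq_zero {m : Type*} [Fintype m] [DecidableEq m] (k i : ℕ)
    {Φ : Cn n → Cn n → ℝ} {e : m → Cn n} (he : ∀ α, e α ∈ holTangent X p)
    (hL : ∀ a ∈ holTangent X p, ∀ b ∈ holTangent X p, secondFF X p a b = secondFF X p b a)
    (hΦ : ∀ a ∈ holTangent X p, ∀ b ∈ holTangent X p, Φ a b = Φ b a) (u : Cn n → ℝ) :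
    (density X k i Φ u p e).im = 0 := by
  rw [density, ← Complex.ofReal_pow, ← Complex.ofReal_mul, Complex.im_ofReal_mul,
    sigmaPol_im_eq_zero, mul_zero]
  rintro (l | l) α β
  · exact star_formMatrix he hL α β
  · exact star_formMatrix he hΦ α β

theorem continuousWithinAt_formMatrix {m : Type*} {B : Cn n → Cn n → Cn n → ℝ} {s : Set (Cn n)}
    (hB : ∀ a b, ContinuousWithinAt (fun q => B q a b) s p) (e : m → Cn n) (α β : m) :
    ContinuousWithinAt (fun q => formMatrix (B q) e α β) s p := by
  have hof : ∀ {f : Cn n → ℝ}, ContinuousWithinAt f s p →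
      ContinuousWithinAt (fun q => (f q : ℂ)) s p := fun hf =>
    Complex.continuous_ofReal.continuousAt.comp_continuousWithinAt hf
  exact ((hof ((hB _ _).add (hB _ _))).add
    (continuousWithinAt_const.mul (hof ((hB _ _).sub (hB _ _))))).div_const _

theorem continuousWithinAt_projSigma {ι : Type*} [Fintype ι] [DecidableEq ι]
    {B : Cn n → ι → Cn n → Cn n → ℝ} {P : Cn n → Fin n → Fin n → ℂ} {s : Set (Cn n)}
    (hB : ∀ l a b, ContinuousWithinAt (fun q => B q l a b) s p)
    (hP : ∀ K L, ContinuousWithinAt (fun q => P q K L) s p) :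
    ContinuousWithinAt (fun q => projSigma (B q) (P q)) s p := by
  simp only [projSigma]
  have hdet : ∀ K L : ι → Fin n, ContinuousWithinAt
      (fun q => Matrix.det (Matrix.of fun a b : ι => P q (K a) (L b))) s p := by
    intro K L
    simp only [Matrix.det_apply, Matrix.of_apply]
    exact tendsto_finsetSum _ fun τ _ =>
      (tendsto_finsetProd _ fun a _ => hP (K (τ a)) (L a)).const_smul _
  exact continuousWithinAt_const.mul (tendsto_finsetSum _ fun K _ => tendsto_finsetSum _ fun L _ =>
    (hdet K L).mul (tendsto_finsetProd _ fun l _ =>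
      continuousWithinAt_formMatrix (hB l) (stdFrame n) (K l) (L l)))

namespace IsSmoothBoundedDomain

theorem secondFF_symm (hX : IsSmoothBoundedDomain X) (hp : p ∈ frontier X) :
    ∀ a ∈ holTangent X p, ∀ b ∈ holTangent X p, secondFF X p a b = secondFF X p b a := by
  intro a ha b hb
  obtain ⟨ρ, hρ⟩ := hX.smooth_boundary p hp
  exact hρ.secondFF_symm (inner_normal_of_mem_holTangent ha) (inner_normal_of_mem_holTangent hb)

theorem bdryForm_symm (hX : IsSmoothBoundedDomain X) (hu : ContDiffOn ℝ 2 u (frontier X))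
    (hp : p ∈ frontier X) :
    ∀ a ∈ holTangent X p, ∀ b ∈ holTangent X p, bdryForm X u p a b = bdryForm X u p b a := by
  intro a ha b hb
  obtain ⟨R, -, -, -, hR⟩ := hX.exists_retraction_extension hp
  obtain ⟨hU, hH⟩ := hR u hu
  have ha' := inner_normal_of_mem_holTangent ha
  have hb' := inner_normal_of_mem_holTangent hb
  have h := (hH.self_of_nhdsWithin hp).2
  rw [bdryForm, bdryForm, h a b ha' hb', h b a hb' ha', hX.secondFF_symm hp a ha b hb,
    IsDefiningAt.fderiv_fderiv_symm hU]

theorem continuousOn_normalDeriv (hX : IsSmoothBoundedDomain X)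
    (hu : ContDiffOn ℝ 1 u (closure X)) : ContinuousOn (normalDeriv X u) (frontier X) :=
  ((hu.continuousOn_fderivWithin hX.uniqueDiffOn le_rfl).mono frontier_subset_closure).clm_apply
    hX.continuousOn_normal

/-- The boundary densities are continuous. Locally the forms are replaced by forms which depend
continuously on the point and agree with them on tangent vectors. -/
theorem continuousOn_density (hX : IsSmoothBoundedDomain X) (hu : InClass X u) (k i : ℕ) :
    ContinuousOn (fun p => density X k i (bdryForm X u p) u p (holFrame X p)) (frontier X) := by
  intro p hp
  obtain ⟨ρ, hρ⟩ := hX.smooth_boundary p hp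
  obtain ⟨R, -, -, -, hR⟩ := hX.exists_retraction_extension hp
  obtain ⟨hU, hH⟩ := hR u hu.boundary
  set U := u ∘ R
  set L' : Cn n → Cn n → Cn n → ℝ := fun q a b => ⟪fderiv ℝ (unitGradient ρ) q a, b⟫_ℝ with hL'
  set Φ' : Cn n → Cn n → Cn n → ℝ := fun q a b => fderiv ℝ (fderiv ℝ U) q a b +
    (normalDeriv X u q - fderiv ℝ U q (normal X q)) * L' q a b with hΦ'
  have hev : ∀ᶠ q in 𝓝[frontier X] p, density X k i (bdryForm X u q) u q (holFrame X q) =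
      (u q : ℂ) * (normalDeriv X u q : ℂ) ^ (i - 1) *
        projSigma (Sum.elim (fun _ : Fin (i - 2) => L' q) (fun _ : Fin (k + 1 - i) => Φ' q))
          (holProj X q) := by
    filter_upwards [hH, mem_nhdsWithin_of_mem_nhds hρ.eventually,
      mem_nhdsWithin_of_mem_nhds hρ.eventually_mem_iff, self_mem_nhdsWithin] with q hq h1 h2 hqf
    have hρq := h1 (h2.2.1 hqf)
    have hL : ∀ a ∈ holTangent X q, ∀ b ∈ holTangent X q, secondFF X q a b = L' q a b :=
      fun a ha b _ => hρq.secondFF_eq (inner_normal_of_mem_holTangent ha) b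
    refine density_eq_projSigma k i hρq.norm_normal (isBilinForm_inner _)
      ((isBilinForm_apply _).add_const_mul (isBilinForm_inner _) _) hL (fun a ha b hb => ?_) u
      (stdOrthonormalBasis ℂ (holTangent X q))
    rw [bdryForm, hq.2 a b (inner_normal_of_mem_holTangent ha)
      (inner_normal_of_mem_holTangent hb), hL a ha b hb]
    change _ = fderiv ℝ (fderiv ℝ U) q a b +
      (normalDeriv X u q - fderiv ℝ U q (normal X q)) * L' q a b
    ring
  refine ContinuousWithinAt.congr_of_eventuallyEq ?_ hev (hev.self_of_nhdsWithin hp)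
  have hν := hX.continuousOn_normal p hp
  have hν1 := hX.continuousOn_normalDeriv hu.closure p hp
  have hL1 : ∀ a b, ContinuousWithinAt (fun q => L' q a b) (frontier X) p := by
    intro a b
    have h : ContinuousAt (fderiv ℝ (unitGradient ρ)) p :=
      (hρ.contDiffAt_unitGradient.fderiv_right (m := 0) (by simp)).continuousAt
    exact ((h.clm_apply continuousAt_const).inner continuousAt_const).continuousWithinAt
  have hU1 : ContDiffAt ℝ 1 (fderiv ℝ U) p := hU.fderiv_right (by norm_num)
  have hΦ1 : ∀ a b, ContinuousWithinAt (fun q => Φ' q a b) (frontier X) p := by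
    intro a b
    have h : ContinuousAt (fderiv ℝ (fderiv ℝ U)) p :=
      (hU1.fderiv_right (m := 0) (by simp)).continuousAt
    exact ((h.clm_apply continuousAt_const).clm_apply continuousAt_const).continuousWithinAt.add
      ((hν1.sub (hU1.continuousAt.continuousWithinAt.clm_apply hν)).mul (hL1 a b))
  have hof : ∀ {f : Cn n → ℝ}, ContinuousWithinAt f (frontier X) p →
      ContinuousWithinAt (fun q => (f q : ℂ)) (frontier X) p := fun hf =>
    Complex.continuous_ofReal.continuousAt.comp_continuousWithinAt hf
  refine ((hof (hu.boundary.continuousOn p hp)).mul ((hof hν1).pow _)).mul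
    (continuousWithinAt_projSigma ?_ ?_)
  · rintro (l | l) a b
    · exact hL1 a b
    · exact hΦ1 a b
  · intro K L
    have hc : ∀ K, ContinuousWithinAt (fun q => normal X q K) (frontier X) p := fun K =>
      (EuclideanSpace.proj (𝕜 := ℂ) K).continuous.continuousAt.comp_continuousWithinAt hν
    exact continuousWithinAt_const.sub ((hc K).mul
      (Complex.continuous_conj.continuousAt.comp_continuousWithinAt (hc L)))

theorem density_bdryForm_im_eq_zero (hX : IsSmoothBoundedDomain X)
    (hu : ContDiffOn ℝ 2 u (frontier X)) (hp : p ∈ frontier X) (k i : ℕ) :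
    (density X k i (bdryForm X u p) u p (holFrame X p)).im = 0 :=
  density_im_eq_zero k i (fun α => (stdOrthonormalBasis ℂ (holTangent X p) α).2)
    (hX.secondFF_symm hp) (hX.bdryForm_symm hu hp) u

end IsSmoothBoundedDomain

/-! ### Dependence on the two-jet -/

theorem eq_zero_of_isLittleO {W : Cn n → ℝ} {s : Set (Cn n)} (hp : p ∈ s)
    (h0 : W =o[𝓝[s] p] fun x => ‖x - p‖ ^ 2) : W p = 0 := by
  have h := (h0.def one_pos).self_of_nhdsWithin hp
  simpa using h

theorem hasDerivAt_comp_line {F : Type*} [NormedAddCommGroup F] [NormedSpace ℝ F] {f : Cn n → F}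
    {v : Cn n} {t : ℝ} (hf : DifferentiableAt ℝ f (p + t • v)) :
    HasDerivAt (fun t : ℝ => f (p + t • v)) (fderiv ℝ f (p + t • v) v) t := by
  have h : HasDerivAt (fun t : ℝ => p + t • v) v t := by
    simpa using ((hasDerivAt_id t).smul_const v).const_add p
  exact hf.hasFDerivAt.comp_hasDerivAt t h

/-- A function which is `o(|x - p|²)` has no positive second directional derivative at `p`. -/
theorem fderiv_fderiv_nonpos_of_isLittleO {W : Cn n → ℝ} (hW : ContDiffAt ℝ 2 W p)
    (h0 : W =o[𝓝 p] fun x => ‖x - p‖ ^ 2) (h1 : fderiv ℝ W p = 0) (v : Cn n) :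
    fderiv ℝ (fderiv ℝ W) p v v ≤ 0 := by
  by_contra! hD
  generalize hDdef : fderiv ℝ (fderiv ℝ W) p v v = D at hD
  -- otherwise `W (p + t v) - (D / 4) t ^ 2` would have a strict minimum at `t = 0`
  set g : ℝ → ℝ := fun t => W (p + t • v) - D / 4 * t ^ 2 with hg
  have htend : Filter.Tendsto (fun t : ℝ => p + t • v) (𝓝 0) (𝓝 p) := by
    have h : Continuous fun t : ℝ => p + t • v := by fun_prop
    simpa using h.tendsto 0
  have hW0 : W p = 0 := eq_zero_of_isLittleO (mem_univ p) (by rwa [nhdsWithin_univ])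
  have hdg : ∀ᶠ t in 𝓝 (0 : ℝ), HasDerivAt g (fderiv ℝ W (p + t • v) v - D / 4 * (2 * t)) t := by
    filter_upwards [htend.eventually (hW.eventually (by simp))] with t ht
    have h3 : HasDerivAt (fun t : ℝ => D / 4 * t ^ 2) (D / 4 * (2 * t)) t := by
      simpa using (hasDerivAt_pow 2 t).const_mul (D / 4)
    exact (hasDerivAt_comp_line (ht.differentiableAt (by simp))).sub h3
  have hdg' : deriv g =ᶠ[𝓝 0] fun t => fderiv ℝ W (p + t • v) v - D / 4 * (2 * t) :=
    hdg.mono fun t ht => ht.deriv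
  have hddg : deriv (deriv g) 0 = D / 2 := by
    rw [hdg'.deriv_eq]
    have h2 : DifferentiableAt ℝ (fderiv ℝ W) (p + (0 : ℝ) • v) := by
      rw [zero_smul, add_zero]
      exact (hW.fderiv_right (m := 1) (by norm_num)).differentiableAt (by simp)
    have h3 : HasDerivAt (fun t : ℝ => fderiv ℝ W (p + t • v) v) D 0 := by
      have h := (hasDerivAt_comp_line h2).clm_apply (hasDerivAt_const (0 : ℝ) v)
      rw [map_zero, add_zero, zero_smul, add_zero, hDdef] at h
      exact h
    have h4 : HasDerivAt (fun t : ℝ => D / 4 * (2 * t)) (D / 4 * (2 * 1)) 0 :=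
      ((hasDerivAt_id (0 : ℝ)).const_mul 2).const_mul (D / 4)
    have h6 : HasDerivAt (fun t : ℝ => fderiv ℝ W (p + t • v) v - D / 4 * (2 * t))
        (D - D / 4 * (2 * 1)) 0 := h3.sub h4
    rw [h6.deriv]
    ring
  have hmin : IsLocalMin g 0 := by
    refine isLocalMin_of_deriv_deriv_pos (by rw [hddg]; positivity) ?_
      hdg.self_of_nhds.continuousAt
    rw [hdg'.self_of_nhds]
    simp [h1]
  have hsmall : ∀ᶠ t in 𝓝 (0 : ℝ), ‖W (p + t • v)‖ ≤ D / (8 * (‖v‖ ^ 2 + 1)) *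
      ‖‖p + t • v - p‖ ^ 2‖ := htend.eventually (h0.def (by positivity))
  obtain ⟨t, ⟨ht1, ht2⟩, ht0⟩ := ((Filter.Eventually.filter_mono nhdsWithin_le_nhds
    (hmin.and hsmall)).and (self_mem_nhdsWithin (a := (0 : ℝ)) (s := {0}ᶜ))).exists
  have ht0' : 0 < t ^ 2 := by
    have : t ≠ 0 := ht0
    positivity
  simp only [hg, zero_smul, add_zero, hW0] at ht1
  have ht3 : ‖‖p + t • v - p‖ ^ 2‖ = t ^ 2 * ‖v‖ ^ 2 := by
    rw [norm_pow, norm_norm, add_sub_cancel_left, norm_smul, mul_pow, Real.norm_eq_abs, sq_abs]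
  rw [ht3, Real.norm_eq_abs] at ht2
  have h7 : D / (8 * (‖v‖ ^ 2 + 1)) * (t ^ 2 * ‖v‖ ^ 2) ≤ D / 8 * t ^ 2 := by
    rw [div_mul_eq_mul_div, div_le_iff₀ (by positivity)]
    nlinarith [mul_pos hD ht0']
  have h8 := le_abs_self (W (p + t • v))
  nlinarith

/-- The 2-jet of a `C²` function which is `o(|x - p|²)` vanishes. -/
theorem fderiv_eq_zero_of_isLittleO {W : Cn n → ℝ} (hW : ContDiffAt ℝ 2 W p)
    (h0 : W =o[𝓝 p] fun x => ‖x - p‖ ^ 2) :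
    fderiv ℝ W p = 0 ∧ fderiv ℝ (fderiv ℝ W) p = 0 := by
  have hW0 : W p = 0 := eq_zero_of_isLittleO (mem_univ p) (by rwa [nhdsWithin_univ])
  have h1 : fderiv ℝ W p = 0 := by
    refine HasFDerivAt.fderiv (HasFDerivAt.of_isLittleO ?_)
    have h2 : (fun x : Cn n => ‖x - p‖ ^ 2) =O[𝓝 p] fun x => x - p := by
      refine IsBigO.of_bound 1 ?_
      filter_upwards [Metric.ball_mem_nhds p one_pos] with x hx
      rw [mem_ball_iff_norm] at hx
      rw [norm_pow, norm_norm, one_mul]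
      nlinarith [norm_nonneg (x - p)]
    simpa [hW0] using h0.trans_isBigO h2
  refine ⟨h1, ?_⟩
  have hneg : fderiv ℝ (fun x => -W x) = fun x => -fderiv ℝ W x := by
    ext1 x
    exact fderiv_fun_neg
  have hq : ∀ v, fderiv ℝ (fderiv ℝ W) p v v = 0 := by
    intro v
    have h2 := fderiv_fderiv_nonpos_of_isLittleO hW h0 h1 v
    have h3 := fderiv_fderiv_nonpos_of_isLittleO (W := fun x => -W x) hW.neg h0.neg_left
      (by rw [hneg]; simp [h1]) v
    rw [hneg, fderiv_fun_neg] at h3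
    simp only [neg_apply] at h3
    linarith
  ext a b
  have h5 := hq (a + b)
  have h6 := IsDefiningAt.fderiv_fderiv_symm hW a b
  simp only [map_add, add_apply, hq, zero_add, add_zero] at h5
  simp only [zero_apply]
  linarith

/-- The boundary form depends only on the 2-jet of `u` along the boundary and on `u_ν`. The
hypothesis along the boundary passes to the extensions of `u` and `v` by a retraction `R`, since
`R x - p = O(x - p)`. -/
theorem IsSmoothBoundedDomain.bdryForm_congr (hX : IsSmoothBoundedDomain X) {v : Cn n → ℝ}
    (hu : ContDiffOn ℝ 2 u (frontier X)) (hv : ContDiffOn ℝ 2 v (frontier X))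
    (hp : p ∈ frontier X)
    (h : (fun x => u x - v x) =o[𝓝[frontier X] p] fun x => ‖x - p‖ ^ 2)
    (hν : normalDeriv X u p = normalDeriv X v p) :
    ∀ a ∈ holTangent X p, ∀ b ∈ holTangent X p, bdryForm X u p a b = bdryForm X v p a b := by
  intro a ha b hb
  obtain ⟨R, hRs, hRp, hRm, hR⟩ := hX.exists_retraction_extension hp
  obtain ⟨hU, hHu⟩ := hR u hu
  obtain ⟨hV, hHv⟩ := hR v hv
  have ha' := inner_normal_of_mem_holTangent ha
  have hb' := inner_normal_of_mem_holTangent hb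
  have hW : (fun x => (u ∘ R) x - (v ∘ R) x) =o[𝓝 p] fun x => ‖x - p‖ ^ 2 := by
    have ht : Filter.Tendsto R (𝓝 p) (𝓝[frontier X] p) := by
      refine tendsto_nhdsWithin_iff.2 ⟨?_, hRm⟩
      have := hRs.continuousAt.tendsto
      rwa [hRp] at this
    have h1 := h.comp_tendsto ht
    refine h1.trans_isBigO ?_
    have h2 := (hRs.differentiableAt (by simp)).isBigO_sub
    rw [hRp] at h2
    exact h2.norm_norm.pow 2
  obtain ⟨h1, h2⟩ := fderiv_eq_zero_of_isLittleO (W := fun x => (u ∘ R) x - (v ∘ R) x)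
    (hU.sub hV) hW
  have hd : fderiv ℝ (fun x => (u ∘ R) x - (v ∘ R) x) =ᶠ[𝓝 p]
      fun x => fderiv ℝ (u ∘ R) x - fderiv ℝ (v ∘ R) x := by
    filter_upwards [hU.eventually (by simp), hV.eventually (by simp)] with x hx hx'
    exact fderiv_fun_sub (hx.differentiableAt (by simp)) (hx'.differentiableAt (by simp))
  have hdU := (hU.fderiv_right (m := 1) (by norm_num)).differentiableAt (by simp)
  have hdV := (hV.fderiv_right (m := 1) (by norm_num)).differentiableAt (by simp)
  rw [hd.fderiv_eq, fderiv_fun_sub hdU hdV, sub_eq_zero] at h2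
  rw [hd.self_of_nhds, sub_eq_zero] at h1
  rw [bdryForm, bdryForm, (hHu.self_of_nhdsWithin hp).2 a b ha' hb',
    (hHv.self_of_nhdsWithin hp).2 a b ha' hb', h1, h2, hν]

end Densities

/-! ### Reality and integrability -/

section Integrals

variable {n : ℕ} {X : Set (Cn n)} {p : Cn n} {u : Cn n → ℝ}

theorem setIntegral_im_eq_zero {α : Type*} [MeasurableSpace α] {μ : Measure α} {s : Set α}
    (hs : MeasurableSet s) {f : α → ℂ} (hf : ∀ x ∈ s, (f x).im = 0) :
    (∫ x in s, f x ∂μ).im = 0 := by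
  have h : ∫ x in s, f x ∂μ = ∫ x in s, (((f x).re : ℝ) : ℂ) ∂μ :=
    setIntegral_congr_fun hs fun x hx => Complex.ext (by simp) (by simp [hf x hx])
  rw [h, integral_complex_ofReal, Complex.ofReal_im]

theorem closure_mem_nhds (hX : IsOpen X) {x : Cn n} (hx : x ∈ X) : closure X ∈ 𝓝 x :=
  Filter.mem_of_superset (hX.mem_nhds hx) subset_closure

theorem hess_eq_fderiv_fderiv (hX : IsOpen X) (u : Cn n → ℝ) {x : Cn n} (hx : x ∈ X)
    (a b : Cn n) : hess X u x a b = fderiv ℝ (fderiv ℝ u) x a b := by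
  have h : diff X u =ᶠ[𝓝 x] fderiv ℝ u := by
    filter_upwards [hX.mem_nhds hx] with y hy
    exact fderivWithin_of_mem_nhds (closure_mem_nhds hX hy)
  rw [hess, fderivWithin_of_mem_nhds (closure_mem_nhds hX hx), h.fderiv_eq]

theorem star_cHess (hX : IsOpen X) (hu : ContDiffOn ℝ 2 u X) {x : Cn n} (hx : x ∈ X)
    (a b : Fin n) : (starRingEnd ℂ) (cHess X u x a b) = cHess X u x b a :=
  star_formMatrix (V := ⊤) (fun _ => trivial) (fun a _ b _ => by
    rw [hess_eq_fderiv_fderiv hX u hx, hess_eq_fderiv_fderiv hX u hx,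
      IsDefiningAt.fderiv_fderiv_symm (hu.contDiffAt (hX.mem_nhds hx))]) a b

theorem sigma_cHess_im_eq_zero (hX : IsOpen X) (hu : ContDiffOn ℝ 2 u X) {x : Cn n} (hx : x ∈ X)
    (k : ℕ) : (sigma k (cHess X u x)).im = 0 :=
  sigmaPol_im_eq_zero fun _ a b => star_cHess hX hu hx a b

theorem continuousOn_cHess (hX : IsOpen X) (hu : ContDiffOn ℝ 2 u X) (i j : Fin n) :
    ContinuousOn (fun x => cHess X u x i j) X := by
  intro x hx
  refine continuousWithinAt_formMatrix (fun a b => ?_) (stdFrame n) i j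
  have h : ContinuousAt (fderiv ℝ (fderiv ℝ u)) x :=
    (((hu.contDiffAt (hX.mem_nhds hx)).fderiv_right (m := 1) (by norm_num)).fderiv_right
      (m := 0) (by simp)).continuousAt
  exact (((h.clm_apply continuousAt_const).clm_apply continuousAt_const).continuousWithinAt).congr
    (fun y hy => hess_eq_fderiv_fderiv hX u hy a b) (hess_eq_fderiv_fderiv hX u hx a b)

theorem continuousOn_sigma {f : Cn n → Matrix (Fin n) (Fin n) ℂ} {s : Set (Cn n)}
    (hf : ∀ i j, ContinuousOn (fun x => f x i j) s) (k : ℕ) :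
    ContinuousOn (fun x => sigma k (f x)) s := by
  simp only [sigma, sigmaPol]
  exact continuousOn_const.mul (continuousOn_finsetSum _ fun I _ => continuousOn_finsetSum _
    fun J _ => continuousOn_const.mul (continuousOn_finsetProd _ fun l _ => hf (I l) (J l)))

/-- A product of `k` functions in `L^k` is integrable, hence so is `σ_k` of a matrix with entries
in `L^k`. -/
theorem integrable_sigma {α m : Type*} [Fintype m] [DecidableEq m] [MeasurableSpace α]
    {μ : Measure α} {f : α → Matrix m m ℂ} {k : ℕ} (hk : k ≠ 0)
    (hf : ∀ i j, MemLp (fun x => f x i j) k μ) : Integrable (fun x => sigma k (f x)) μ := by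
  simp only [sigma, sigmaPol]
  refine Integrable.const_mul (integrable_finsetSum _ fun I _ => integrable_finsetSum _ fun J _ =>
    Integrable.const_mul ?_ _) _
  have h := MemLp.prod' (s := Finset.univ) (p := fun _ : Fin k => (k : ENNReal))
    (f := fun l x => f x (I l) (J l)) fun l _ => hf (I l) (J l)
  have h1 : (∑ _l : Fin k, (k : ENNReal)⁻¹)⁻¹ = 1 := by
    rw [Finset.sum_const, Finset.card_univ, Fintype.card_fin, nsmul_eq_mul,
      ENNReal.mul_inv_cancel (by exact_mod_cast hk) (ENNReal.natCast_ne_top k), inv_one]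
  rw [h1] at h
  exact memLp_one_iff_integrable.1 h

theorem integrableOn_mul_sigma_cHess (hX : IsSmoothBoundedDomain X) (hu : InClass X u) {k : ℕ}
    (hk : k ≠ 0) (h : ∀ i j, MemLp (fun x => cHess X u x i j) k (volume.restrict X)) :
    IntegrableOn (fun x => (u x : ℂ) * sigma k (cHess X u x)) X := by
  obtain ⟨C, hC⟩ := hX.isBounded.isCompact_closure.exists_bound_of_continuousOn
    hu.closure.continuousOn
  have hm : AEStronglyMeasurable (fun x => (u x : ℂ)) (volume.restrict X) :=
    (Complex.continuous_ofReal.comp_continuousOn hu.interior.continuousOn).aestronglyMeasurable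
      hX.isOpen.measurableSet
  refine (integrable_sigma hk h).bdd_mul hm (c := C) ?_
  filter_upwards [ae_restrict_mem hX.isOpen.measurableSet] with x hx
  rw [Complex.norm_real]
  exact hC x (subset_closure hx)

theorem extEnergy_im_eq_zero (hX : IsSmoothBoundedDomain X) (hu : InClass X u) (k : ℕ) :
    (extEnergy X k u).im = 0 := by
  have h1 : (∫ x in X, (u x : ℂ) * sigma k (cHess X u x)).im = 0 :=
    setIntegral_im_eq_zero hX.isOpen.measurableSet fun x hx => by
      rw [Complex.im_ofReal_mul, sigma_cHess_im_eq_zero hX.isOpen hu.interior hx, mul_zero]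
  have h2 : ∀ i, (bdryIntegral X fun p =>
      density X k i (bdryForm X u p) u p (holFrame X p)).im = 0 := fun i =>
    setIntegral_im_eq_zero isClosed_frontier.measurableSet fun p hp =>
      hX.density_bdryForm_im_eq_zero hu.boundary hp k i
  have h3 : ∀ i, coeff k i =
      (((-1) ^ i * ((k : ℝ) * (k + 1) / 2) * (k.choose (i - 1) : ℝ) : ℝ) : ℂ) := fun i => by
    rw [coeff]
    push_cast
    ring
  have h4 : (1 / ((k : ℂ) ^ 2 * (k + 1))) = ((1 / ((k : ℝ) ^ 2 * (k + 1)) : ℝ) : ℂ) := by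
    push_cast
    ring
  rw [extEnergy, Complex.add_im, Complex.neg_im, h1, h4, Complex.im_ofReal_mul, Complex.im_sum]
  simp only [h3, Complex.im_ofReal_mul, h2, mul_zero, Finset.sum_const_zero, neg_zero, add_zero]

theorem density_congr_of_isLittleO (hX : IsSmoothBoundedDomain X) {v : Cn n → ℝ}
    (hu : InClass X u) (hv : InClass X v) (hp : p ∈ frontier X)
    (h : (fun x => u x - v x) =o[𝓝[frontier X] p] fun x => ‖x - p‖ ^ 2)
    (hν : normalDeriv X u p = normalDeriv X v p) (k i : ℕ) :
    density X k i (bdryForm X u p) u p (holFrame X p) =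
      density X k i (bdryForm X v p) v p (holFrame X p) := by
  have h0 : u p = v p := sub_eq_zero.1 (eq_zero_of_isLittleO (W := fun x => u x - v x) hp h)
  have he : ∀ α, holFrame X p α ∈ holTangent X p := fun α =>
    (stdOrthonormalBasis ℂ (holTangent X p) α).2
  rw [density, density, h0, hν,
    formMatrix_congr he (hX.bdryForm_congr hu.boundary hv.boundary hp h hν)]

end Integrals

/-! ### Integration by parts against the Newton tensor -/

section GaussGreen

variable {n : ℕ} {X : Set (Cn n)} {u : Cn n → ℝ}

/-- The value at `Z̄_a` of the complex linear extension of a complex-valued real covector. -/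
noncomputable def dbarAt (a : Cn n) : (Cn n →L[ℝ] ℂ) →ₗ[ℂ] ℂ where
  toFun l := (l a + Complex.I * l (Complex.I • a)) / (Real.sqrt 2 : ℂ)
  map_add' l l' := by
    simp only [add_apply]
    ring
  map_smul' c l := by
    simp only [smul_apply, smul_eq_mul, RingHom.id_apply]
    ring

theorem dbarAt_apply (a : Cn n) (l : Cn n →L[ℝ] ℂ) :
    dbarAt a l = (l a + Complex.I * l (Complex.I • a)) / (Real.sqrt 2 : ℂ) := rfl

theorem IsSmoothBoundedDomain.setIntegral_fderivWithin_complex (hX : IsSmoothBoundedDomain X)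
    {g : Cn n → ℂ} (hg : ContDiffOn ℝ 1 g (closure X)) (e : Cn n) :
    ∫ x in X, fderivWithin ℝ g (closure X) x e =
      bdryIntegral X fun x => g x * (⟪normal X x, e⟫_ℝ : ℂ) := by
  have hcont : ContinuousOn (fun x => fderivWithin ℝ g (closure X) x e) (closure X) :=
    (hg.continuousOn_fderivWithin hX.uniqueDiffOn le_rfl).clm_apply continuousOn_const
  have hint : IntegrableOn (fun x => fderivWithin ℝ g (closure X) x e) X :=
    (hcont.integrableOn_compact hX.isBounded.isCompact_closure).mono_set subset_closure
  have hint' : IntegrableOn (fun x => g x * (⟪normal X x, e⟫_ℝ : ℂ)) (frontier X)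
      μHE[2 * n - 1] :=
    hX.integrableOn_frontier ((hg.continuousOn.mono frontier_subset_closure).mul
      (Complex.continuous_ofReal.comp_continuousOn (hX.continuousOn_normal.inner continuousOn_const)))
  have hd : ∀ (T : ℂ →L[ℝ] ℝ), ∀ x ∈ X, fderivWithin ℝ (fun y => T (g y)) (closure X) x e =
      T (fderivWithin ℝ g (closure X) x e) := by
    intro T x hx
    have h := T.hasFDerivAt.comp_hasFDerivWithinAt x
      ((hg.differentiableOn one_ne_zero) x (subset_closure hx)).hasFDerivWithinAt
    have h' : fderivWithin ℝ (fun y => T (g y)) (closure X) x =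
        T.comp (fderivWithin ℝ g (closure X) x) :=
      h.fderivWithin (hX.uniqueDiffOn x (subset_closure hx))
    rw [h']
    rfl
  have key : ∀ T : ℂ →L[ℝ] ℝ, T (∫ x in X, fderivWithin ℝ g (closure X) x e) =
      ∫ x in frontier X, T (g x) * ⟪normal X x, e⟫_ℝ ∂μHE[2 * n - 1] := by
    intro T
    rw [← T.integral_comp_comm hint, ← setIntegral_congr_fun hX.isOpen.measurableSet (hd T)]
    exact hX.setIntegral_fderivWithin (T.contDiff.comp_contDiffOn hg) e
  have key' : ∀ T : ℂ →L[ℝ] ℝ, (∀ (z : ℂ) (r : ℝ), T (z * r) = T z * r) →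
      T (bdryIntegral X fun x => g x * (⟪normal X x, e⟫_ℝ : ℂ)) =
      ∫ x in frontier X, T (g x) * ⟪normal X x, e⟫_ℝ ∂μHE[2 * n - 1] := by
    intro T hT
    rw [bdryIntegral, ← T.integral_comp_comm hint']
    simp only [hT]
  apply Complex.ext
  · exact (key Complex.reCLM).trans (key' Complex.reCLM fun z r => by simp).symm
  · exact (key Complex.imCLM).trans (key' Complex.imCLM fun z r => by simp).symm

theorem inner_normal_add_I_mul_inner (ν : Cn n) (j : Fin n) :
    ((⟪ν, stdFrame n j⟫_ℝ : ℝ) : ℂ) + Complex.I * ((⟪ν, Complex.I • stdFrame n j⟫_ℝ : ℝ) : ℂ) =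
      ν j := by
  rw [real_inner_eq_re, real_inner_eq_re, inner_smul_right, stdFrame,
    EuclideanSpace.inner_single_right]
  apply Complex.ext <;> simp

/-- The divergence theorem for the operator `Z̄_j`. -/
theorem IsSmoothBoundedDomain.setIntegral_dbarAt (hX : IsSmoothBoundedDomain X)
    {g : Cn n → ℂ} (hg : ContDiffOn ℝ 1 g (closure X)) (j : Fin n) :
    ∫ x in X, dbarAt (stdFrame n j) (fderivWithin ℝ g (closure X) x) =
      (bdryIntegral X fun x => g x * normal X x j) / (Real.sqrt 2 : ℂ) := by
  have hint : ∀ e, IntegrableOn (fun x => fderivWithin ℝ g (closure X) x e) X := fun e =>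
    (((hg.continuousOn_fderivWithin hX.uniqueDiffOn le_rfl).clm_apply
      continuousOn_const).integrableOn_compact hX.isBounded.isCompact_closure).mono_set
      subset_closure
  have hint' : ∀ e, IntegrableOn (fun x => g x * (⟪normal X x, e⟫_ℝ : ℂ)) (frontier X)
      μHE[2 * n - 1] := fun e =>
    hX.integrableOn_frontier ((hg.continuousOn.mono frontier_subset_closure).mul
      (Complex.continuous_ofReal.comp_continuousOn (hX.continuousOn_normal.inner continuousOn_const)))
  simp only [dbarAt_apply]
  rw [integral_div, integral_add (hint _) ((hint _).const_mul _), integral_const_mul,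
    hX.setIntegral_fderivWithin_complex hg, hX.setIntegral_fderivWithin_complex hg]
  simp only [bdryIntegral]
  rw [← integral_const_mul, ← integral_add (hint' _) ((hint' _).const_mul _)]
  congr 2
  ext x
  rw [← inner_normal_add_I_mul_inner]
  ring

/-! ### Smoothness up to the boundary -/

theorem contDiffOn_diff (hs : UniqueDiffOn ℝ (closure X)) (hu : ContDiffOn ℝ ∞ u (closure X)) :
    ContDiffOn ℝ ∞ (diff X u) (closure X) :=
  hu.fderivWithin hs (by simp)

theorem contDiffOn_hess (hs : UniqueDiffOn ℝ (closure X)) (hu : ContDiffOn ℝ ∞ u (closure X))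
    (a b : Cn n) : ContDiffOn ℝ ∞ (fun x => hess X u x a b) (closure X) :=
  (((contDiffOn_diff hs hu).fderivWithin hs (m := ∞) (by simp)).clm_apply
    contDiffOn_const).clm_apply contDiffOn_const

theorem contDiffOn_ofReal {f : Cn n → ℝ} {s : Set (Cn n)} (hf : ContDiffOn ℝ ∞ f s) :
    ContDiffOn ℝ ∞ (fun x => (f x : ℂ)) s :=
  Complex.ofRealCLM.contDiff.comp_contDiffOn hf

theorem contDiffOn_cHess (hs : UniqueDiffOn ℝ (closure X)) (hu : ContDiffOn ℝ ∞ u (closure X))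
    (i j : Fin n) : ContDiffOn ℝ ∞ (fun x => cHess X u x i j) (closure X) := by
  have h := contDiffOn_hess hs hu
  simp only [cHess, formMatrix, Matrix.of_apply, part11]
  exact ((contDiffOn_ofReal ((h _ _).add (h _ _))).add
    (contDiffOn_const.mul (contDiffOn_ofReal ((h _ _).sub (h _ _))))).div_const _

theorem contDiffOn_dZ (hs : UniqueDiffOn ℝ (closure X)) (hu : ContDiffOn ℝ ∞ u (closure X))
    (a : Cn n) : ContDiffOn ℝ ∞ (fun x => dZ (diff X u x) a) (closure X) := by
  have h := fun b => (contDiffOn_diff hs hu).clm_apply (contDiffOn_const (c := b))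
  simp only [dZ]
  exact ((contDiffOn_ofReal (h _)).sub
    (contDiffOn_const.mul (contDiffOn_ofReal (h _)))).div_const _

theorem contDiffOn_newtonPol {r : ℕ} {A : Cn n → Matrix (Fin n) (Fin n) ℂ} {s : Set (Cn n)}
    (hA : ∀ a b, ContDiffOn ℝ ∞ (fun x => A x a b) s) (j i : Fin n) :
    ContDiffOn ℝ ∞ (fun x => newtonPol (fun _ : Fin r => A x) j i) s := by
  simp only [newtonPol]
  exact contDiffOn_const.mul (ContDiffOn.sum fun I _ => ContDiffOn.sum fun J _ =>
    contDiffOn_const.mul (contDiffOn_prod fun l _ => hA _ _))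

/-! ### The divergence of the Newton tensor -/

theorem hasFDerivAt_newtonPol {r : ℕ} {A : Cn n → Matrix (Fin n) (Fin n) ℂ} {x : Cn n}
    {A' : Fin n → Fin n → Cn n →L[ℝ] ℂ} (hA : ∀ a b, HasFDerivAt (fun y => A y a b) (A' a b) x)
    (j i : Fin n) :
    HasFDerivAt (fun y => newtonPol (fun _ : Fin r => A y) j i)
      (((r ! : ℕ) : ℂ)⁻¹ • ∑ I : Fin r → Fin n, ∑ J : Fin r → Fin n,
        genDelta (fun o : Option (Fin r) => o.elim i I) (fun o : Option (Fin r) => o.elim j J) •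
          ∑ l, (∏ l' ∈ Finset.univ.erase l, A x (I l') (J l')) • A' (I l) (J l)) x := by
  simp only [newtonPol, Fintype.card_fin]
  refine HasFDerivAt.const_mul (HasFDerivAt.fun_sum fun I _ => HasFDerivAt.fun_sum fun J _ =>
    HasFDerivAt.const_mul ?_ _) _
  exact HasFDerivAt.finsetProd (u := Finset.univ) fun l _ => hA (I l) (J l)

/-- The Newton tensor of a matrix field is divergence free if `Z̄_j A_{a b̄}` is symmetric in `j` and
`b`. -/
theorem sum_dbarAt_newtonPol_eq_zero {r : ℕ} {A : Cn n → Matrix (Fin n) (Fin n) ℂ} {x : Cn n}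
    {A' : Fin n → Fin n → Cn n →L[ℝ] ℂ} (hA : ∀ a b, HasFDerivAt (fun y => A y a b) (A' a b) x)
    (hsymm : ∀ j a b, dbarAt (stdFrame n j) (A' a b) = dbarAt (stdFrame n b) (A' a j))
    (i : Fin n) :
    ∑ j, dbarAt (stdFrame n j)
      (fderiv ℝ (fun y => newtonPol (fun _ : Fin r => A y) j i) x) = 0 := by
  have h := sum_deriv_newtonPol_eq_zero (ι := Fin r) (A x)
    (fun j => Matrix.of fun a b => dbarAt (stdFrame n j) (A' a b)) hsymm i
  simp only [(hasFDerivAt_newtonPol hA _ i).fderiv, map_smul, map_sum, smul_eq_mul,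
    ← Finset.mul_sum]
  simp only [Matrix.of_apply] at h
  rw [h, mul_zero]

/-- The third derivatives of `u` are symmetric in the two barred indices. -/
theorem dbarAt_fderiv_cHess_symm (hX : IsOpen X) (hu : ContDiffOn ℝ ∞ u X) {x : Cn n}
    (hx : x ∈ X) (j a b : Fin n) :
    dbarAt (stdFrame n j) (fderiv ℝ (fun y => cHess X u y a b) x) =
      dbarAt (stdFrame n b) (fderiv ℝ (fun y => cHess X u y a j) x) := by
  have hux : ContDiffAt ℝ ∞ u x := hu.contDiffAt (hX.mem_nhds hx)
  have h1 : ContDiffAt ℝ ∞ (fderiv ℝ u) x := hux.fderiv_right (by simp)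
  have h2 : ContDiffAt ℝ ∞ (fderiv ℝ (fderiv ℝ u)) x := h1.fderiv_right (by simp)
  have hd2 : DifferentiableAt ℝ (fderiv ℝ (fderiv ℝ u)) x := h2.differentiableAt (by simp)
  set t : Cn n → Cn n → Cn n → ℝ := fun r p q => fderiv ℝ (fderiv ℝ (fderiv ℝ u)) x r p q with ht
  have hH : ∀ p q, HasFDerivAt (fun y => hess X u y p q)
      (((ContinuousLinearMap.apply ℝ ℝ q).comp (ContinuousLinearMap.apply ℝ (Cn n →L[ℝ] ℝ) p)).comp
        (fderiv ℝ (fderiv ℝ (fderiv ℝ u)) x)) x := by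
    intro p q
    have h : HasFDerivAt (fun y => fderiv ℝ (fderiv ℝ u) y p q)
        (((ContinuousLinearMap.apply ℝ ℝ q).comp
          (ContinuousLinearMap.apply ℝ (Cn n →L[ℝ] ℝ) p)).comp
            (fderiv ℝ (fderiv ℝ (fderiv ℝ u)) x)) x := by
      refine ((hd2.hasFDerivAt.clm_apply (hasFDerivAt_const p x)).clm_apply
        (hasFDerivAt_const q x)).congr_fderiv ?_
      ext r
      simp
    refine h.congr_of_eventuallyEq ?_
    filter_upwards [hX.mem_nhds hx] with y hy
    exact hess_eq_fderiv_fderiv hX u hy p q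
  have ht1 : ∀ r p q, t r p q = t p r q := fun r p q => by
    have h := h1.isSymmSndFDerivAt
      (by simpa using (WithTop.coe_le_coe.2 le_top : (2 : ℕ∞ω) ≤ ∞)) r p
    exact congrArg (fun l : Cn n →L[ℝ] ℝ => l q) h
  have ht2 : ∀ r p q, t r p q = t r q p := by
    intro r p q
    have he : (fun y => hess X u y p q) =ᶠ[𝓝 x] fun y => hess X u y q p := by
      filter_upwards [hX.mem_nhds hx] with y hy
      rw [hess_eq_fderiv_fderiv hX u hy, hess_eq_fderiv_fderiv hX u hy]
      exact IsDefiningAt.fderiv_fderiv_symm ((hu.contDiffAt (hX.mem_nhds hy)).of_le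
        (WithTop.coe_le_coe.2 le_top)) p q
    have h := he.fderiv_eq (𝕜 := ℝ)
    rw [(hH p q).fderiv, (hH q p).fderiv] at h
    exact congrArg (fun l : Cn n →L[ℝ] ℝ => l r) h
  have ht3 : ∀ r p q, t r p q = t q p r := fun r p q => by
    rw [ht1 r p q, ht2 p r q, ht1 p q r]
  have hof : ∀ {f : Cn n → ℝ} {f' : Cn n →L[ℝ] ℝ}, HasFDerivAt f f' x →
      HasFDerivAt (fun y => (f y : ℂ)) (Complex.ofRealCLM.comp f') x := fun hf =>
    Complex.ofRealCLM.hasFDerivAt.comp x hf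
  have hc : ∀ (a b : Fin n) (r : Cn n), fderiv ℝ (fun y => cHess X u y a b) x r =
      part11 (t r) (stdFrame n a) (stdFrame n b) := by
    intro a b r
    have h : HasFDerivAt (fun y => cHess X u y a b) _ x :=
      (((hof ((hH (stdFrame n a) (stdFrame n b)).add
        (hH (Complex.I • stdFrame n a) (Complex.I • stdFrame n b)))).add
        ((hof ((hH (stdFrame n a) (Complex.I • stdFrame n b)).sub
          (hH (Complex.I • stdFrame n a) (stdFrame n b)))).const_mul Complex.I)).mul_const
            (2 : ℂ)⁻¹)
    rw [h.fderiv, part11, div_eq_mul_inv, mul_comm]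
    rfl
  simp only [dbarAt_apply, hc, part11]
  rw [ht3 (stdFrame n j) (stdFrame n a) (stdFrame n b),
    ht3 (stdFrame n j) (Complex.I • stdFrame n a) (Complex.I • stdFrame n b),
    ht3 (stdFrame n j) (stdFrame n a) (Complex.I • stdFrame n b),
    ht3 (stdFrame n j) (Complex.I • stdFrame n a) (stdFrame n b),
    ht3 (Complex.I • stdFrame n j) (stdFrame n a) (stdFrame n b),
    ht3 (Complex.I • stdFrame n j) (Complex.I • stdFrame n a) (Complex.I • stdFrame n b),
    ht3 (Complex.I • stdFrame n j) (stdFrame n a) (Complex.I • stdFrame n b),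
    ht3 (Complex.I • stdFrame n j) (Complex.I • stdFrame n a) (stdFrame n b)]
  push_cast
  linear_combination (Real.sqrt 2 : ℂ)⁻¹ / 2 * (
    (t (Complex.I • stdFrame n b) (Complex.I • stdFrame n a) (stdFrame n j) : ℂ) -
    (t (stdFrame n b) (Complex.I • stdFrame n a) (Complex.I • stdFrame n j) : ℂ)) * Complex.I_sq

/-- `Z̄_j Z_i u = u_{i j̄}`. -/
theorem dbarAt_fderiv_dZ (hX : IsOpen X) (hu : ContDiffOn ℝ ∞ u X) {x : Cn n}
    (hx : x ∈ X) (i j : Fin n) :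
    dbarAt (stdFrame n j) (fderiv ℝ (fun y => dZ (diff X u y) (stdFrame n i)) x) =
      cHess X u x i j := by
  have hux : ContDiffAt ℝ ∞ u x := hu.contDiffAt (hX.mem_nhds hx)
  have h1 : ContDiffAt ℝ ∞ (fderiv ℝ u) x := hux.fderiv_right (by simp)
  have hH : ∀ q, HasFDerivAt (fun y => diff X u y q)
      ((ContinuousLinearMap.apply ℝ ℝ q).comp (fderiv ℝ (fderiv ℝ u) x)) x := by
    intro q
    refine HasFDerivAt.congr_of_eventuallyEq
      ((ContinuousLinearMap.apply ℝ ℝ q).hasFDerivAt.comp x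
        (h1.differentiableAt (by simp)).hasFDerivAt) ?_
    filter_upwards [hX.mem_nhds hx] with y hy
    rw [diff, fderivWithin_of_mem_nhds (closure_mem_nhds hX hy)]
    rfl
  have hof : ∀ {f : Cn n → ℝ} {f' : Cn n →L[ℝ] ℝ}, HasFDerivAt f f' x →
      HasFDerivAt (fun y => (f y : ℂ)) (Complex.ofRealCLM.comp f') x := fun hf =>
    Complex.ofRealCLM.hasFDerivAt.comp x hf
  have hc : ∀ r : Cn n, fderiv ℝ (fun y => dZ (diff X u y) (stdFrame n i)) x r =
      dZ (fderiv ℝ (fderiv ℝ u) x r) (stdFrame n i) := by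
    intro r
    have h : HasFDerivAt (fun y => dZ (diff X u y) (stdFrame n i)) _ x :=
      ((hof (hH (stdFrame n i))).sub
        ((hof (hH (Complex.I • stdFrame n i))).const_mul Complex.I)).mul_const
          ((Real.sqrt 2 : ℂ)⁻¹)
    rw [h.fderiv, dZ, div_eq_mul_inv, mul_comm]
    rfl
  have hs := IsDefiningAt.fderiv_fderiv_symm (hux.of_le (WithTop.coe_le_coe.2 le_top) :
    ContDiffAt ℝ 2 u x)
  have h2 : (Real.sqrt 2 : ℂ)⁻¹ * (Real.sqrt 2 : ℂ)⁻¹ = 1 / 2 := by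
    rw [← mul_inv, ← Complex.ofReal_mul, Real.mul_self_sqrt (by norm_num)]
    norm_num
  rw [dbarAt_apply, hc, hc]
  simp only [cHess, formMatrix, Matrix.of_apply, part11, dZ, hess_eq_fderiv_fderiv hX u hx]
  rw [hs (stdFrame n i) (stdFrame n j), hs (Complex.I • stdFrame n i) (Complex.I • stdFrame n j),
    hs (stdFrame n i) (Complex.I • stdFrame n j), hs (Complex.I • stdFrame n i) (stdFrame n j)]
  generalize fderiv ℝ (fderiv ℝ u) x (stdFrame n j) (stdFrame n i) = A
  generalize fderiv ℝ (fderiv ℝ u) x (stdFrame n j) (Complex.I • stdFrame n i) = B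
  generalize fderiv ℝ (fderiv ℝ u) x (Complex.I • stdFrame n j) (stdFrame n i) = C
  generalize fderiv ℝ (fderiv ℝ u) x (Complex.I • stdFrame n j) (Complex.I • stdFrame n i) = D
  push_cast
  simp only [div_eq_mul_inv]
  linear_combination h2 * (A - Complex.I * B + Complex.I * C - Complex.I ^ 2 * D) -
    Complex.I_sq * D / 2

end GaussGreen

/-! ### The energy of a smooth function -/

section Energy

variable {n : ℕ} {X : Set (Cn n)} {u : Cn n → ℝ}

theorem star_newtonPol {ι m : Type*} [Fintype ι] [DecidableEq ι] [Fintype m] [DecidableEq m]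
    {A : ι → Matrix m m ℂ} (hA : ∀ l a b, (starRingEnd ℂ) (A l a b) = A l b a) (j i : m) :
    (starRingEnd ℂ) (newtonPol A j i) = newtonPol A i j := by
  unfold newtonPol
  rw [map_mul, map_sum, Finset.sum_comm]
  simp only [map_sum, map_mul, map_prod, star_genDelta, hA, map_inv₀, map_natCast]
  congr 1
  refine Finset.sum_congr rfl fun I _ => Finset.sum_congr rfl fun J _ => ?_
  rw [genDelta_swap]

theorem star_dZ (l : Cn n →L[ℝ] ℝ) (a : Cn n) : (starRingEnd ℂ) (dZ l a) = dZbar l a := by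
  simp [dZ, dZbar]

theorem IsSmoothBoundedDomain.star_cHess (hX : IsSmoothBoundedDomain X)
    (hu : ContDiffOn ℝ ∞ u (closure X)) {x : Cn n} (hx : x ∈ closure X) (a b : Fin n) :
    (starRingEnd ℂ) (cHess X u x a b) = cHess X u x b a :=
  star_formMatrix (V := ⊤) (fun _ => trivial) (fun a _ b _ =>
    (hu x hx).isSymmSndFDerivWithinAt
      (by simpa using (WithTop.coe_le_coe.2 le_top : (2 : ℕ∞ω) ≤ ∞)) hX.uniqueDiffOn
      (closure_mono (interior_maximal subset_closure hX.isOpen) hx) hx a b) a b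

/-- `Z̄_j (u u_i T_{j ī}) = u_i u_j̄ T_{j ī} + k u σ_k`, summed over `i` and `j`, for
`k = r + 1`. -/
theorem sum_dbarAt_fderivWithin (hX : IsSmoothBoundedDomain X)
    (hu : ContDiffOn ℝ ∞ u (closure X)) (r : ℕ) {x : Cn n} (hx : x ∈ X) :
    ∑ j, dbarAt (stdFrame n j) (fderivWithin ℝ (fun y => ∑ i, (u y : ℂ) *
      (dZ (diff X u y) (stdFrame n i) * newtonPol (fun _ : Fin r => cHess X u y) j i))
        (closure X) x) =
      (∑ i, ∑ j, dZ (diff X u x) (stdFrame n i) * dZbar (diff X u x) (stdFrame n j) *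
        newtonPol (fun _ : Fin r => cHess X u x) j i) +
      (r + 1) * ((u x : ℂ) * sigma (r + 1) (cHess X u x)) := by
  have huX : ContDiffOn ℝ ∞ u X := hu.mono subset_closure
  have hn := closure_mem_nhds hX.isOpen hx
  have hd : ∀ {g : Cn n → ℂ}, ContDiffOn ℝ ∞ g (closure X) → HasFDerivAt g (fderiv ℝ g x) x :=
    fun hg => ((hg.contDiffAt hn).differentiableAt (by simp)).hasFDerivAt
  have hp := fun i => hd (contDiffOn_dZ hX.uniqueDiffOn hu (stdFrame n i))
  have hA := fun a b => hd (contDiffOn_cHess hX.uniqueDiffOn hu a b)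
  have hT := fun j i => hd (contDiffOn_newtonPol (r := r)
    (contDiffOn_cHess hX.uniqueDiffOn hu) j i)
  have hu' : HasFDerivAt (fun y => (u y : ℂ)) (Complex.ofRealCLM.comp (diff X u x)) x := by
    have h : HasFDerivAt u (diff X u x) x := by
      rw [diff, fderivWithin_of_mem_nhds hn]
      exact ((hu.contDiffAt hn).differentiableAt (by simp)).hasFDerivAt
    exact Complex.ofRealCLM.hasFDerivAt.comp x h
  have hub : ∀ j, dbarAt (stdFrame n j) (Complex.ofRealCLM.comp (diff X u x)) =
      dZbar (diff X u x) (stdFrame n j) := fun j => rfl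
  have hF : ∀ j, HasFDerivAt (fun y => ∑ i, (u y : ℂ) *
      (dZ (diff X u y) (stdFrame n i) * newtonPol (fun _ : Fin r => cHess X u y) j i))
      (∑ i, ((u x : ℂ) • (dZ (diff X u x) (stdFrame n i) •
          fderiv ℝ (fun y => newtonPol (fun _ : Fin r => cHess X u y) j i) x +
        newtonPol (fun _ : Fin r => cHess X u x) j i •
          fderiv ℝ (fun y => dZ (diff X u y) (stdFrame n i)) x) +
        (dZ (diff X u x) (stdFrame n i) * newtonPol (fun _ : Fin r => cHess X u x) j i) •
          Complex.ofRealCLM.comp (diff X u x))) x := fun j =>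
    HasFDerivAt.fun_sum fun i _ => hu'.mul ((hp i).mul (hT j i))
  simp only [fderivWithin_of_mem_nhds hn, fun j => (hF j).fderiv, map_sum, map_add, map_smul,
    smul_eq_mul, hub, dbarAt_fderiv_dZ hX.isOpen huX hx]
  have hs : (r + 1) * ((u x : ℂ) * sigma (r + 1) (cHess X u x)) = ∑ i, (u x : ℂ) *
      ∑ j, cHess X u x i j * newtonPol (fun _ : Fin r => cHess X u x) j i := by
    rw [← Finset.mul_sum, sum_mul_newtonPol]
    ring
  rw [Finset.sum_comm, hs, ← Finset.sum_add_distrib]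
  refine Finset.sum_congr rfl fun i _ => ?_
  have hdiv := sum_dbarAt_newtonPol_eq_zero (r := r) hA
    (fun j a b => dbarAt_fderiv_cHess_symm hX.isOpen huX hx j a b) i
  have h1 : ∑ j, (u x : ℂ) * (dZ (diff X u x) (stdFrame n i) * dbarAt (stdFrame n j)
      (fderiv ℝ (fun y => newtonPol (fun _ : Fin r => cHess X u y) j i) x)) = 0 := by
    rw [← Finset.mul_sum, ← Finset.mul_sum, hdiv, mul_zero, mul_zero]
  rw [Finset.mul_sum, ← Finset.sum_add_distrib, ← sub_eq_zero, ← h1, ← Finset.sum_sub_distrib]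
  refine Finset.sum_congr rfl fun j _ => ?_
  ring

/-- The flux of `u u_i T_{j ī}` through the boundary, computed by the divergence theorem.
Together with its conjugate it makes up `S_1`, for `k = r + 1`. -/
theorem integral_S1_density (hX : IsSmoothBoundedDomain X)
    (hu : ContDiffOn ℝ ∞ u (closure X)) (r : ℕ) :
    (bdryIntegral X fun p => ∑ i, dZ (diff X u p) (stdFrame n i) * (u p : ℂ) *
      ∑ j, normal X p j * newtonPol (fun _ : Fin r => cHess X u p) j i) / (Real.sqrt 2 : ℂ) =
    (∫ x in X, ∑ i, ∑ j, dZ (diff X u x) (stdFrame n i) * dZbar (diff X u x) (stdFrame n j) *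
        newtonPol (fun _ : Fin r => cHess X u x) j i) +
      (r + 1) * ∫ x in X, (u x : ℂ) * sigma (r + 1) (cHess X u x) := by
  have hF : ∀ j, ContDiffOn ℝ ∞ (fun y => ∑ i, (u y : ℂ) *
      (dZ (diff X u y) (stdFrame n i) * newtonPol (fun _ : Fin r => cHess X u y) j i))
        (closure X) := fun j => ContDiffOn.sum fun i _ => (contDiffOn_ofReal hu).mul
      ((contDiffOn_dZ hX.uniqueDiffOn hu _).mul
        (contDiffOn_newtonPol (contDiffOn_cHess hX.uniqueDiffOn hu) j i))
  have hF1 := fun j => (hF j).of_le (WithTop.coe_le_coe.2 le_top : (1 : ℕ∞ω) ≤ ∞)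
  have hint : ∀ {g : Cn n → ℂ}, ContinuousOn g (closure X) → IntegrableOn g X := fun hg =>
    (hg.integrableOn_compact hX.isBounded.isCompact_closure).mono_set subset_closure
  have h1 : (bdryIntegral X fun p => ∑ i, dZ (diff X u p) (stdFrame n i) * (u p : ℂ) *
      ∑ j, normal X p j * newtonPol (fun _ : Fin r => cHess X u p) j i) =
      ∑ j, bdryIntegral X fun p => (∑ i, (u p : ℂ) * (dZ (diff X u p) (stdFrame n i) *
        newtonPol (fun _ : Fin r => cHess X u p) j i)) * normal X p j := by
    simp only [bdryIntegral]
    rw [← integral_finsetSum]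
    · congr 1
      ext p
      simp only [Finset.mul_sum, Finset.sum_mul]
      rw [Finset.sum_comm]
      refine Finset.sum_congr rfl fun j _ => Finset.sum_congr rfl fun i _ => ?_
      ring
    · intro j _
      exact hX.integrableOn_frontier (((hF j).continuousOn.mono frontier_subset_closure).mul
        ((EuclideanSpace.proj (𝕜 := ℂ) j).continuous.comp_continuousOn hX.continuousOn_normal))
  rw [h1, Finset.sum_div, Finset.sum_congr rfl fun j _ => (hX.setIntegral_dbarAt (hF1 j) j).symm,
    ← integral_finsetSum, ← integral_const_mul, ← integral_add]
  · exact setIntegral_congr_fun hX.isOpen.measurableSet fun x hx =>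
      sum_dbarAt_fderivWithin hX hu r hx
  · refine hint (continuousOn_finsetSum _ fun i _ => continuousOn_finsetSum _ fun j _ =>
      ((contDiffOn_dZ hX.uniqueDiffOn hu _).continuousOn.mul ?_).mul
        (contDiffOn_newtonPol (contDiffOn_cHess hX.uniqueDiffOn hu) j i).continuousOn)
    simp only [← star_dZ]
    exact Complex.continuous_conj.comp_continuousOn
      (contDiffOn_dZ hX.uniqueDiffOn hu _).continuousOn
  · exact (hint ((contDiffOn_ofReal hu).continuousOn.mul (continuousOn_sigma
      (fun i j => (contDiffOn_cHess hX.uniqueDiffOn hu i j).continuousOn) _))).const_mul _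
  · intro j _
    refine hint ?_
    have h := fun e => ((hF1 j).continuousOn_fderivWithin hX.uniqueDiffOn le_rfl).clm_apply
      (continuousOn_const (c := e))
    simp only [dbarAt_apply]
    exact ((h _).add (continuousOn_const.mul (h _))).div_const _

theorem card_ne_and_ne {r : ℕ} {a b : Fin (r + 2)} (hab : b ≠ a) :
    Fintype.card {c // c ≠ a ∧ c ≠ b} = r := by
  rw [Fintype.card_subtype]
  have h : (Finset.univ.filter fun c => c ≠ a ∧ c ≠ b) = (Finset.univ.erase a).erase b := by
    ext c
    simp [and_comm]
  rw [h, Finset.card_erase_of_mem (by simp [hab]), Finset.card_erase_of_mem (by simp)]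
  simp

theorem newtonPol_ne_and_ne {m : Type*} [Fintype m] [DecidableEq m] {r : ℕ} {a b : Fin (r + 2)}
    (hab : b ≠ a) (A : Matrix m m ℂ) (j i : m) :
    newtonPol (fun _ : {c // c ≠ a ∧ c ≠ b} => A) j i = newtonPol (fun _ : Fin r => A) j i :=
  newtonPol_reindex (Fintype.equivFinOfCardEq (card_ne_and_ne hab)) (fun _ => A) j i

/-- For `k = r + 1`, a sum over the `(k + 1) k` ordered pairs of distinct arguments. -/
theorem sum_erase_const {r : ℕ} {F : Fin (r + 2) → Fin (r + 2) → ℂ} {C : ℂ}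
    (h : ∀ a b, b ≠ a → F a b = C) :
    ∑ a, ∑ b ∈ Finset.univ.erase a, F a b = (r + 2) * (r + 1) * C := by
  have h1 : ∀ a, ∑ b ∈ Finset.univ.erase a, F a b = (r + 1) * C := fun a => by
    rw [Finset.sum_congr rfl fun b hb => h a b (Finset.ne_of_mem_erase hb), Finset.sum_const,
      Finset.card_erase_of_mem (Finset.mem_univ a), Finset.card_univ, Fintype.card_fin,
      nsmul_eq_mul]
    push_cast [Nat.add_sub_cancel]
    simp
  simp only [h1, Finset.sum_const, Finset.card_univ, Fintype.card_fin, nsmul_eq_mul]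
  push_cast
  ring

theorem S0_const (X : Set (Cn n)) (u : Cn n → ℝ) (r : ℕ) :
    S0 X (r + 1) (fun _ => u) = -((r + 2) * (r + 1) * ∫ x in X, ∑ i, ∑ j,
      dZ (diff X u x) (stdFrame n i) * dZbar (diff X u x) (stdFrame n j) *
        newtonPol (fun _ : Fin r => cHess X u x) j i) := by
  rw [S0, sum_erase_const]
  intro a b hab
  simp only [newtonPol_ne_and_ne hab]

theorem S1_const (hX : IsSmoothBoundedDomain X) (hu : ContDiffOn ℝ ∞ u (closure X)) (r : ℕ) :
    S1 X (r + 1) (fun _ => u) = -((r + 2) * (r + 1) *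
      ((∫ x in X, ∑ i, ∑ j, dZ (diff X u x) (stdFrame n i) *
        dZbar (diff X u x) (stdFrame n j) * newtonPol (fun _ : Fin r => cHess X u x) j i) +
      (r + 1) * ∫ x in X, (u x : ℂ) * sigma (r + 1) (cHess X u x))) := by
  have hT : ∀ x ∈ closure X, ∀ j i, (starRingEnd ℂ)
      (newtonPol (fun _ : Fin r => cHess X u x) j i) =
        newtonPol (fun _ : Fin r => cHess X u x) i j := fun x hx j i =>
    star_newtonPol (fun _ => hX.star_cHess hu hx) j i
  set f : Cn n → ℂ := fun p => ∑ i, dZ (diff X u p) (stdFrame n i) * (u p : ℂ) *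
      ∑ j, normal X p j * newtonPol (fun _ : Fin r => cHess X u p) j i with hf
  have hfint : IntegrableOn f (frontier X) μHE[2 * n - 1] :=
    hX.integrableOn_frontier <| continuousOn_finsetSum _ fun i _ =>
      (((contDiffOn_dZ hX.uniqueDiffOn hu _).continuousOn.mul
        (contDiffOn_ofReal hu).continuousOn).mono frontier_subset_closure).mul
      (continuousOn_finsetSum _ fun j _ => ((EuclideanSpace.proj (𝕜 := ℂ)
        j).continuous.comp_continuousOn hX.continuousOn_normal).mul
        ((contDiffOn_newtonPol (contDiffOn_cHess hX.uniqueDiffOn hu)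
          j i).continuousOn.mono frontier_subset_closure))
  have hgreen := integral_S1_density hX hu r
  -- the two halves of the boundary integrand are complex conjugates
  have hsum : ∀ a b : Fin (r + 2), b ≠ a → (bdryIntegral X fun p =>
      (∑ i, dZ (diff X u p) (stdFrame n i) * (u p : ℂ) *
        ∑ j, normal X p j * newtonPol (fun _ : {c // c ≠ a ∧ c ≠ b} => cHess X u p) j i) +
      (∑ j, (u p : ℂ) * dZbar (diff X u p) (stdFrame n j) *
        ∑ i, (starRingEnd ℂ) (normal X p i) *
          newtonPol (fun _ : {c // c ≠ a ∧ c ≠ b} => cHess X u p) j i)) =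
      bdryIntegral X f + (starRingEnd ℂ) (bdryIntegral X f) := by
    intro a b hab
    simp only [newtonPol_ne_and_ne hab]
    simp only [bdryIntegral]
    have hfint' : IntegrableOn (fun p => (starRingEnd ℂ) (f p)) (frontier X) μHE[2 * n - 1] :=
      Complex.conjCLE.integrable_comp_iff.2 hfint
    rw [← integral_conj, ← integral_add hfint hfint']
    refine setIntegral_congr_fun isClosed_frontier.measurableSet fun p hp => ?_
    simp only [hf, map_sum, map_mul, star_dZ, Complex.conj_ofReal,
      hT p (frontier_subset_closure hp)]
    congr 1
    refine Finset.sum_congr rfl fun i _ => ?_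
    ring
  set G := (∫ x in X, ∑ i, ∑ j, dZ (diff X u x) (stdFrame n i) *
        dZbar (diff X u x) (stdFrame n j) * newtonPol (fun _ : Fin r => cHess X u x) j i) +
      (r + 1) * ∫ x in X, (u x : ℂ) * sigma (r + 1) (cHess X u x) with hG
  have hGreal : (starRingEnd ℂ) G = G := by
    rw [Complex.conj_eq_iff_im, hG, Complex.add_im]
    have h1 : ((r : ℂ) + 1) = ((r + 1 : ℝ) : ℂ) := by push_cast; rfl
    rw [h1, Complex.im_ofReal_mul, setIntegral_im_eq_zero hX.isOpen.measurableSet,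
      setIntegral_im_eq_zero hX.isOpen.measurableSet, mul_zero, add_zero]
    · intro x hx
      rw [Complex.im_ofReal_mul, sigma_cHess_im_eq_zero hX.isOpen ((hu.of_le
        (WithTop.coe_le_coe.2 le_top)).mono subset_closure) hx, mul_zero]
    · intro x hx
      rw [← Complex.conj_eq_iff_im, map_sum, Finset.sum_comm]
      refine Finset.sum_congr rfl fun i _ => ?_
      rw [map_sum]
      refine Finset.sum_congr rfl fun j _ => ?_
      rw [map_mul, map_mul, hT x (subset_closure hx), star_dZ,
        ← star_dZ _ (stdFrame n j), Complex.conj_conj]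
      ring
  have h2 : (Real.sqrt 2 : ℂ) ≠ 0 := by
    rw [Complex.ofReal_ne_zero]
    positivity
  have hfG : bdryIntegral X f = G * (Real.sqrt 2 : ℂ) := (div_eq_iff h2).1 hgreen
  rw [S1, sum_erase_const hsum, hfG, map_mul, hGreal, Complex.conj_ofReal]
  field_simp
  ring

/-- The interior and the first boundary term combine by the divergence theorem. -/
theorem S0_sub_S1_const (hX : IsSmoothBoundedDomain X) (hu : ContDiffOn ℝ ∞ u (closure X))
    {k : ℕ} (hk : 1 ≤ k) : S0 X k (fun _ => u) - S1 X k (fun _ => u) =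
      (k : ℂ) ^ 2 * (k + 1) * ∫ x in X, (u x : ℂ) * sigma k (cHess X u x) := by
  obtain ⟨r, rfl⟩ := Nat.exists_eq_add_of_le' hk
  rw [S0_const, S1_const hX hu]
  push_cast
  ring

theorem energy_eq (hX : IsSmoothBoundedDomain X) (hu : ContDiffOn ℝ ∞ u (closure X))
    {k : ℕ} (hk : 1 ≤ k) : energy X k u = -(∫ x in X, (u x : ℂ) * sigma k (cHess X u x)) +
      1 / ((k : ℂ) ^ 2 * (k + 1)) * ∑ i ∈ Finset.Icc 2 (k + 1), S X k i (fun _ => u) := by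
  have h := S0_sub_S1_const hX hu hk
  have hk0 : (k : ℂ) ≠ 0 := by exact_mod_cast (by lia : k ≠ 0)
  have hk1 : (k : ℂ) + 1 ≠ 0 := by exact_mod_cast Nat.succ_ne_zero k
  rw [energy, Lform, ← sub_sub, h]
  field_simp
  ring

/-- All `(k + 1) (k choose i - 1)` terms of `S_i(u, …, u)` are equal. -/
theorem S_const (X : Set (Cn n)) (u : Cn n → ℝ) {k i : ℕ} (hi : i ∈ Finset.Icc 2 (k + 1)) :
    S X k i (fun _ => u) = coeff k i *
      bdryIntegral X fun p => density X k i (hess X u p) u p (holFrame X p) := by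
  rw [Finset.mem_Icc] at hi
  have h : ∀ a : Fin (k + 1), ∀ B ∈ (Finset.univ.erase a).powersetCard (i - 1),
      (bdryIntegral X fun p => (u p : ℂ) * (∏ _b ∈ B, (normalDeriv X u p : ℂ)) *
        sigmaPol (Sum.elim
          (fun _ : Fin (i - 2) => formMatrix (secondFF X p) (holFrame X p))
          (fun _ : {c // c ∉ insert a B} => formMatrix (hess X u p) (holFrame X p)))) =
      bdryIntegral X fun p => density X k i (hess X u p) u p (holFrame X p) := by
    intro a B hB
    rw [Finset.mem_powersetCard] at hB
    have ha : a ∉ B := fun h => Finset.notMem_erase a _ (hB.1 h)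
    have hc : Fintype.card {c // c ∉ insert a B} = k + 1 - i := by
      rw [Fintype.card_subtype_compl, Fintype.card_coe, Finset.card_insert_of_notMem ha,
        Fintype.card_fin, hB.2]
      lia
    congr 1
    ext p
    rw [Finset.prod_const, hB.2, density,
      ← sigmaPol_reindex (Equiv.sumCongr (Equiv.refl _) (Fintype.equivFinOfCardEq hc))]
    congr 2
    ext l
    cases l <;> rfl
  rw [S, Finset.sum_congr rfl fun a _ => Finset.sum_congr rfl (h a)]
  simp only [Finset.sum_const, Finset.card_powersetCard, Finset.mem_univ,
    Finset.card_erase_of_mem, Finset.card_univ, Fintype.card_fin, Nat.add_sub_cancel,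
    nsmul_eq_mul, coeff]
  push_cast
  ring

/-- On the boundary `∇²u` is replaced by `∇̄²u + u_ν L`. -/
theorem energy_eq_extEnergy (hX : IsSmoothBoundedDomain X)
    (hu : ContDiffOn ℝ ∞ u (closure X)) {k : ℕ} (hk : 1 ≤ k) :
    energy X k u = extEnergy X k u := by
  have hB : ∀ i, (bdryIntegral X fun p => density X k i (hess X u p) u p (holFrame X p)) =
      bdryIntegral X fun p => density X k i (bdryForm X u p) u p (holFrame X p) := by
    intro i
    refine setIntegral_congr_fun isClosed_frontier.measurableSet fun p hp => ?_
    have he : ∀ α, holFrame X p α ∈ holTangent X p := fun α =>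
      (stdOrthonormalBasis ℂ (holTangent X p) α).2
    have hform : formMatrix (hess X u p) (holFrame X p) =
        formMatrix (bdryForm X u p) (holFrame X p) :=
      formMatrix_congr he fun a ha b hb =>
        hX.hess_eq (hu.of_le (WithTop.coe_le_coe.2 le_top)) hp (inner_normal_of_mem_holTangent ha)
          (inner_normal_of_mem_holTangent hb)
    simp only [density, hform]
  have hS : ∑ i ∈ Finset.Icc 2 (k + 1), S X k i (fun _ => u) =
      ∑ i ∈ Finset.Icc 2 (k + 1), coeff k i *
        bdryIntegral X fun p => density X k i (bdryForm X u p) u p (holFrame X p) :=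
    Finset.sum_congr rfl fun i hi => by rw [S_const X u hi, hB]
  rw [energy_eq hX hu hk, extEnergy, hS]

theorem inClass_of_contDiffOn (hu : ContDiffOn ℝ ∞ u (closure X)) : InClass X u where
  interior := (hu.of_le (WithTop.coe_le_coe.2 le_top)).mono subset_closure
  boundary := (hu.of_le (WithTop.coe_le_coe.2 le_top)).mono frontier_subset_closure
  closure := hu.of_le (WithTop.coe_le_coe.2 le_top)

end Energy

end ComplexHessian

theorem proposition4p1 (n k : ℕ) (hk : 1 ≤ k) (X : Set (Cn n))
    (hX : IsSmoothBoundedDomain X) :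
    -- the formula on smooth functions
    (∀ u : Cn n → ℝ, ContDiffOn ℝ ∞ u (closure X) →
      (energy X k u).im = 0 ∧
      energy X k u = -(∫ x in X, (u x : ℂ) * sigma k (cHess X u x)) +
        1 / ((k : ℂ) ^ 2 * (k + 1)) * ∑ i ∈ Finset.Icc 2 (k + 1), S X k i (fun _ => u) ∧
      (∀ i ∈ Finset.Icc 2 (k + 1),
        S X k i (fun _ => u) = coeff k i *
          bdryIntegral X fun p => density X k i (hess X u p) u p (holFrame X p)) ∧
      -- only second order tangential and first order normal derivatives occur on the boundary
      (∀ p ∈ frontier X, ∀ a ∈ holTangent X p, ∀ b ∈ holTangent X p,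
        part11 (hess X u p) a b =
          part11 (bdryHess X u p) a b + (normalDeriv X u p : ℂ) * part11 (secondFF X p) a b) ∧
      energy X k u = extEnergy X k u) ∧
    -- the resulting expression makes sense on `C²(X) ∩ C²(M) ∩ C¹(X̄)`
    (∀ u : Cn n → ℝ, InClass X u →
      (∀ i ∈ Finset.Icc 2 (k + 1),
        IntegrableOn (fun p => density X k i (bdryForm X u p) u p (holFrame X p))
          (frontier X) (μHE[2 * n - 1]) ∧
        ∀ p ∈ frontier X,
          (density X k i (bdryForm X u p) u p (holFrame X p)).im = 0 ∧
          ∀ e : OrthonormalBasis (Fin (n - 1)) ℂ (holTangent X p),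
            density X k i (bdryForm X u p) u p (fun α => (e α : Cn n)) =
              density X k i (bdryForm X u p) u p (holFrame X p)) ∧
      ContinuousOn (fun x => (u x : ℂ) * sigma k (cHess X u x)) X ∧
      ((∀ i j, MemLp (fun x => cHess X u x i j) k (volume.restrict X)) →
        IntegrableOn (fun x => (u x : ℂ) * sigma k (cHess X u x)) X) ∧
      (extEnergy X k u).im = 0) ∧
    -- the boundary densities depend only on the 2-jet of `u|_M` and on `u_ν`
    (∀ u v : Cn n → ℝ, InClass X u → InClass X v → ∀ p ∈ frontier X,
      (fun x => u x - v x) =o[𝓝[frontier X] p] (fun x => ‖x - p‖ ^ 2) →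
      normalDeriv X u p = normalDeriv X v p →
      ∀ i ∈ Finset.Icc 2 (k + 1),
        density X k i (bdryForm X u p) u p (holFrame X p) =
          density X k i (bdryForm X v p) v p (holFrame X p)) := by
  refine ⟨fun u hu => ?_, fun u hu => ?_, fun u v hu hv p hp h hν i _ =>
    density_congr_of_isLittleO hX hu hv hp h hν k i⟩
  · have hE := energy_eq_extEnergy hX hu hk
    refine ⟨?_, energy_eq hX hu hk, fun i hi => S_const X u hi, fun p hp a ha b hb =>
      hX.part11_hess_eq (hu.of_le (WithTop.coe_le_coe.2 le_top)) hp ha hb, hE⟩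
    rw [hE, extEnergy_im_eq_zero hX (inClass_of_contDiffOn hu)]
  · refine ⟨fun i _ => ⟨hX.integrableOn_frontier (hX.continuousOn_density hu k i), fun p hp =>
      ⟨hX.density_bdryForm_im_eq_zero hu.boundary hp k i, fun e => ?_⟩⟩, ?_,
      integrableOn_mul_sigma_cHess hX hu (by lia), extEnergy_im_eq_zero hX hu k⟩
    · exact density_orthonormalBasis_eq k i (hX.norm_normal hp) (isBilinForm_bdryForm X u p) u e
        (stdOrthonormalBasis ℂ (holTangent X p))
    · exact (Complex.continuous_ofReal.comp_continuousOn hu.interior.continuousOn).mul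
        (continuousOn_sigma (continuousOn_cHess hX.isOpen hu.interior) k)
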